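/- **Conventions.** Fix a universe $\mathcal U$. A $\mathcal U$-category is a category with $\mathcal U$-small hom-sets that is equivalent to a category all of whose objects and arrows are elements of $\mathcal U$. A $\mathcal U$-topos is a category equivalent to the category of $\mathcal U$-valued sheaves on a $\mathcal U$-small site. A sink $\langle X,S\rangle$ is a set $S$ of arrows with common target $X$; it is epi if arrows $g,h\colon X\to Z$ with $gs=hs$ for all $s\in S$ are equal. A colimit is universal if it is preserved by pullback along every arrow into the colimit object. A *clopos structure* on a category $\mathcal C$ is a set $\mathcal O$ of arrows that (G1) contains all isomorphisms, consists of arrows whose pullbacks along arbitrary arrows exist, and is stable under composition and pullback. $\mathcal O/X$ is the full subcategory of $\mathcal C/X$ on the arrows of $\mathcal O$. A parallel pair $u,v\colon R\rightrightarrows X$ is *$\mathcal O$-coequalizable* if $qu=qv$ for some $q\in\mathcal O$ with source $X$, and *locally $\mathcal O$-coequalizable* if there is an epi sink of arrows $f\colon X'\to X$ of $\mathcal O$ such that each inverse image pair $X'\times_XR\times_XX'\rightrightarrows X'$ is $\mathcal O$-coequalizable. $(\mathcal C,\mathcal O)$ is a *$\mathcal U$-glutos* if $\mathcal C$ is a $\mathcal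 U$-category, $\mathcal O$ is a clopos structure and: (G2) $fg\in\mathcal O$ and $f\in\mathcal O$ imply $g\in\mathcal O$; (G3) every $\mathcal O/X$ is a $\mathcal U$-topos and every $f^*\colon\mathcal O/Y\to\mathcal O/X$ ($f\colon X\to Y$ in $\mathcal C$) is an inverse image of a geometric morphism; (G4$_{\mathcal U}$) $\mathcal C$ has disjoint universal $\mathcal U$-small coproducts with injections in $\mathcal O$, and for every $\mathcal U$-small family $U_i\to X$ in $\mathcal O$ the arrow $\coprod U_i\to X$ is in $\mathcal O$; (G5) every epi in $\mathcal O$ is effective; if $fp,p\in\mathcal O$ and $p$ is epi then $f\in\mathcal O$; every locally $\mathcal O$-coequalizable equivalence relation $u,v$ with $u,v\in\mathcal O$ is effective and has a universal coequalizer, which lies in $\mathcal O$; (G5P) if $r\colon X\to R$ is an epi in $\mathcal O$, and $g\colon R\to S$, $f\colon Y\to S$ are such that the pullback of $f$ along $gr$ exists, then the pullback of $f$ along $g$ exists. A *presite* $(\mathcal C,\tau)$ is a category with a pretopology: a class $\tau$ of sinks (coverings) whose members can be pulled back along arbitrary arrows, containing the isomorphisms, stable under pullback and composition, and such that a sink of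 clopen arrows having a refinement in $\tau$ is in $\tau$. Here the set $\mathcal O_\tau$ of *clopen* arrows consists of the arrows belonging to some covering, and $T$ refines $S$ if each member of $T$ factors through a member of $S$. It is an *$\mathcal M$-presite* if all coverings consist of monos; $\mathcal M\tau$ is the set of coverings of $\tau$ consisting of monos, and $\mathcal M(\mathcal C,\tau)=(\mathcal C,\mathcal M\tau)$. It is a *$\mathcal U$-presite* if $\mathcal C$ is a $\mathcal U$-category and each object $X$ has a $\mathcal U$-small set $G_X$ of objects such that for each clopen $U\to X$ the object $U$ has a covering by arrows with sources in $G_X$. A functor between presites is *continuous* if it preserves coverings, clopen arrows, and pullbacks of clopen arrows along arbitrary arrows; $[\mathcal C,\mathcal D]$ is the category of continuous functors and natural transformations. Two presites are naturally equivalent if there is an equivalence of categories which is continuous in both directions. A $\mathcal U$-glutos $(\mathcal D,\mathcal O)$ is regarded as a presite whose coverings are all epi sinks of arrows of $\mathcal O$. A *universal $\mathcal U$-glutos* of a $\mathcal U$-presite $\mathcal B$ is a $\mathcal U$-glutos $\widetilde{\mathcal B}$ with a continuous functor $Y\colon\mathcal B\to\widetilde{\mathcal B}$ such that for each $\mathcal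 U$-glutos $\mathcal E$ the functor $[Y,\mathcal E]\colon[\widetilde{\mathcal B},\mathcal E]\to[\mathcal B,\mathcal E]$, $\sigma\mapsto\sigma Y$, is an equivalence having a right inverse. A *nearly $\mathcal U$-glutos* is a $\mathcal U$-presite naturally equivalent to $\mathcal M\widetilde{\mathcal B}$ for some $\mathcal U$-presite $\mathcal B$ and some universal $\mathcal U$-glutos $\widetilde{\mathcal B}$ of $\mathcal B$. A *gluon* indexed by a set $I$ consists of objects $U_i$, $U_{ij}$ and arrows $d_0^{ij}\colon U_{ij}\to U_i$, $d_1^{ij}\colon U_{ij}\to U_j$ ($i,j\in I$) such that: each pair $(d_0^{ij},d_1^{ij})$ is jointly monic; there are $\tau_{ij}\colon U_{ij}\to U_{ji}$ with $d_0^{ji}\tau_{ij}=d_1^{ij}$, $d_1^{ji}\tau_{ij}=d_0^{ij}$; there are common sections $s_i\colon U_i\to U_{ii}$ of $d_0^{ii}$ and $d_1^{ii}$; and for all $i,j,k$ there are an object $U_{ijk}$ and arrows $p_0,p,p_1$ from it to $U_{ij},U_{ik},U_{jk}$ such that the three squares $d_0^{ij}p_0=d_0^{ik}p$, $d_1^{ij}p_0=d_0^{jk}p_1$,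 $d_1^{ik}p=d_1^{jk}p_1$ are pullbacks. It is clopen if all $d_\varepsilon^{ij}$ are, and locally $\mathcal O$-coequalizable if all pairs $(d_0^{ii},d_1^{ii})$ are. **Proposition.** Let $(\mathcal C,\tau)$ be an $\mathcal M$-presite such that $\mathcal C$ is a $\mathcal U$-category and $\tau$ is subcanonical. Then $(\mathcal C,\tau)$ is a nearly $\mathcal U$-glutos if and only if the following hold, with $\mathcal O=\mathcal O_\tau$: (G4$_{\mathcal U}$+5) every $\mathcal U$-small clopen locally $\mathcal O$-coequalizable gluon has a universal colimit $U_\bullet$ whose colimit cone $U_i\to U_\bullet$ consists of clopen arrows, and which is effective, i.e. $U_{ij}\cong U_i\times_{U_\bullet}U_j$ for all $i,j$; (NG1) for every object $X$ the set of clopen subobjects of $X$ is $\mathcal U$-small; (NG2) every family $\{U_i\to X\}_{i\in I}$ of clopen arrows factors as a covering $\{U_i\to U_\bullet\}_{i\in I}$ followed by a clopen arrow $U_\bullet\to X$; (NG3) every epi sink consisting of clopen arrows is a covering. Moreover, if (NG2) holds, then any set of clopen subobjects of an object $X$ has a least upper bound in the ordered set of all subobjects of $X$, and it is clopen; if (NG3)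 holds, then every epi sink of clopen arrows is universal effective epi. -/

import Mathlib

open CategoryTheory CategoryTheory.Limits

universe u v w v' w' v'' w''

namespace Glutos

/-! ### Size conditions -/

/-- A `𝒰`-category, for the universe `𝒰` of `u`-small sets: a category naturally equivalent to one
whose objects are elements of `𝒰` and whose hom-sets are `u`-small. `ZFSet.{u}` is the class of all
`u`-small sets. -/
def IsUCategory (C : Type v) [Category.{w} C] : Prop :=
  ∃ (S : Set ZFSet.{u}) (_ : Category.{u} S), Nonempty (C ≌ S)

/-- A `𝒰`-topos: a category equivalent to the category of `𝒰`-valued sheaves on a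
`u`-small site. -/
def IsUTopos (E : Type v) [Category.{w} E] : Prop :=
  ∃ (S : Type u) (_ : SmallCategory S) (J : GrothendieckTopology S), Nonempty (E ≌ Sheaf J (Type u))

section Sinks

variable {C : Type v} [Category.{w} C]

/-! ### Sinks -/

/-- A sink `⟨X, S⟩` is epi if two arrows out of `X` agreeing on all members of `S` are equal. -/
def IsEpiSink {X : C} (S : Presieve X) : Prop :=
  ∀ ⦃Z : C⦄ (g h : X ⟶ Z), (∀ ⦃Y : C⦄ (f : Y ⟶ X), S f → f ≫ g = f ≫ h) → g = h

/-- All members of the sink belong to the set of arrows `O`. -/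
def SinkIn (O : MorphismProperty C) {X : C} (S : Presieve X) : Prop :=
  ∀ ⦃Y : C⦄ (f : Y ⟶ X), S f → O f

/-- Universal effective epi sinks: all pullbacks of the sieve generated by the sink are
effective epi. -/
def IsUniversalEffectiveEpiSink {X : C} (S : Presieve X) : Prop :=
  ∀ ⦃Y : C⦄ (f : Y ⟶ X), ((Sieve.generate S).pullback f).EffectiveEpimorphic

/-- `T` is a refinement of `S`: every member of `T` factors through some member of `S`. -/
def IsRefinement {X : C} (T S : Presieve X) : Prop :=
  ∀ ⦃Y : C⦄ (t : Y ⟶ X), T t → ∃ (Z : C) (s : Z ⟶ X) (a : Y ⟶ Z), S s ∧ a ≫ s = t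

/-! ### Equivalence relations and gluing data -/

/-- `O` is a clopos structure. -/
structure IsClopos (O : MorphismProperty C) : Prop where
  of_isIso : ∀ ⦃X Y : C⦄ (f : X ⟶ Y), IsIso f → O f
  hasPullbacks : O.HasPullbacks
  isStableUnderComposition : O.IsStableUnderComposition
  isStableUnderBaseChange : O.IsStableUnderBaseChange

/-- The pair `u, v` is coequalized by some arrow belonging to `O`. -/
def OCoequalizable (O : MorphismProperty C) {R X : C} (u v : R ⟶ X) : Prop :=
  ∃ (Q : C) (q : X ⟶ Q), O q ∧ u ≫ q = v ≫ q

/-- `u', v'` is (a choice of) the inverse image of the pair `u, v` along `f`, formed through three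
pullbacks `R₀ = X' ×_X R` (along `u`), `R₁ = R ×_X X'` (along `v`) and `R' = R₀ ×_R R₁`. -/
def IsInducedRelation {X X' R R' : C} (f : X' ⟶ X) (u v : R ⟶ X) (u' v' : R' ⟶ X') : Prop :=
  ∃ (R₀ R₁ : C) (a₀ : R₀ ⟶ X') (b₀ : R₀ ⟶ R) (b₁ : R₁ ⟶ R) (a₁ : R₁ ⟶ X')
    (c₀ : R' ⟶ R₀) (c₁ : R' ⟶ R₁),
    IsPullback a₀ b₀ f u ∧ IsPullback b₁ a₁ v f ∧ IsPullback c₀ c₁ b₀ b₁ ∧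
      c₀ ≫ a₀ = u' ∧ c₁ ≫ a₁ = v'

/-- There is an epi sink of arrows of `O` along whose members the pair `u, v` induces
`O`-coequalizable relations. -/
def LocallyOCoequalizable (O : MorphismProperty C) {R X : C} (u v : R ⟶ X) : Prop :=
  ∃ S : Presieve X, SinkIn O S ∧ IsEpiSink S ∧ ∀ ⦃X' : C⦄ (f : X' ⟶ X), S f →
    ∃ (R' : C) (u' v' : R' ⟶ X'), IsInducedRelation f u v u' v' ∧ OCoequalizable O u' v'

/-- Glueing data (a gluon). A diagram `U` of shape `ΓI` is given by objects `U_i = d.right i`,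
`U_ij = d.left (i, j)` and arrows `d.fst (i, j) : U_ij ⟶ U_i`, `d.snd (i, j) : U_ij ⟶ U_j`. -/
structure IsGluon {I : Type u} (d : MultispanIndex (MultispanShape.prod I) C) : Prop where
  jointlyMono : ∀ i j : I, JointlyMono₂ (d.fst (i, j)) (d.snd (i, j))
  symm : ∀ i j : I, ∃ t : d.left (i, j) ⟶ d.left (j, i),
    t ≫ d.fst (j, i) = d.snd (i, j) ∧ t ≫ d.snd (j, i) = d.fst (i, j)
  refl : ∀ i : I, ∃ s : d.right i ⟶ d.left (i, i),
    s ≫ d.fst (i, i) = 𝟙 (d.right i) ∧ s ≫ d.snd (i, i) = 𝟙 (d.right i)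
  cocycle : ∀ i j k : I, ∃ (T : C) (p₀ : T ⟶ d.left (i, j)) (p : T ⟶ d.left (i, k))
    (p₁ : T ⟶ d.left (j, k)),
    IsPullback p₀ p (d.fst (i, j)) (d.fst (i, k)) ∧
    IsPullback p₀ p₁ (d.snd (i, j)) (d.fst (j, k)) ∧
    IsPullback p p₁ (d.snd (i, k)) (d.snd (j, k))

/-- The condition (G4_𝒰+5): every `u`-small, clopen, locally `O`-coequalizable gluon has a universal
and effective colimit, whose colimit cone consists of clopen arrows. -/
def GluingCondition (O : MorphismProperty C) : Prop :=
  ∀ (I : Type u) (d : MultispanIndex (MultispanShape.prod I) C), IsGluon d →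
    (∀ a, O (d.fst a) ∧ O (d.snd a)) →
    (∀ i : I, LocallyOCoequalizable O (d.fst (i, i)) (d.snd (i, i))) →
    ∃ c : Multicofork d, IsUniversalColimit c ∧
      (∀ i j : I, IsPullback (d.fst (i, j)) (d.snd (i, j)) (c.π i) (c.π j)) ∧
      ∀ i : I, O (c.π i)

/-! ### `𝒰`-glutoses -/

variable (C) in
/-- `(C, O)` is a `𝒰`-glutos. The category `O/X` is `O.Over ⊤ X`, the full subcategory of `C/X`
on the arrows of `O`. -/
structure IsUGlutos (O : MorphismProperty C) : Prop extends IsClopos O where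
  isUCategory : IsUCategory.{u} C
  /-- (G2) -/
  of_postcomp : ∀ ⦃X Y Z : C⦄ (g : X ⟶ Y) (f : Y ⟶ Z), O (g ≫ f) → O f → O g
  /-- (G3) a) -/
  isUTopos : ∀ X : C, IsUTopos.{u} (O.Over ⊤ X)
  /-- (G3) b): the functor `f^*` is an inverse image of a geometric morphism. -/
  inverseImage : ∀ ⦃X Y : C⦄ (f : X ⟶ Y),
    haveI := hasPullbacks
    haveI := isStableUnderBaseChange
    PreservesFiniteLimits (MorphismProperty.Over.pullback O ⊤ f) ∧
      (MorphismProperty.Over.pullback O ⊤ f).IsLeftAdjoint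
  /-- (G4_𝒰) a): disjoint universal `u`-small coproducts with injections in `O`. -/
  coproducts : ∀ (I : Type u) (U : I → C), ∃ c : Cofan U, IsUniversalColimit c ∧
    (∀ i, O (c.inj i) ∧ Mono (c.inj i)) ∧
    ∀ i j, i ≠ j → ∀ (Z : C) (p : Z ⟶ U i) (q : Z ⟶ U j),
      IsPullback p q (c.inj i) (c.inj j) → Nonempty (IsInitial Z)
  /-- (G4_𝒰) b) -/
  coproductDesc : ∀ (I : Type u) (U : I → C) (X : C) (f : ∀ i, U i ⟶ X), (∀ i, O (f i)) →
    ∀ (c : Cofan U) (hc : IsColimit c), O (hc.desc (Cofan.mk X f))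
  /-- (G5) a) -/
  effectiveEpi : ∀ ⦃X Y : C⦄ (f : X ⟶ Y), O f → Epi f → EffectiveEpi f
  /-- (G5) b) -/
  of_precomp : ∀ ⦃X Y Z : C⦄ (p : X ⟶ Y) (f : Y ⟶ Z), O (p ≫ f) → O p → Epi p → O f
  /-- (G5) c), weak form: open, locally `O`-coequalizable equivalence relations are effective and
  have a universal coequalizer belonging to `O`. -/
  quotients : ∀ ⦃R X : C⦄ (u v : R ⟶ X), IsEquivalenceRelation u v → O u → O v →
    LocallyOCoequalizable O u v →
    ∃ (Q : C) (q : X ⟶ Q) (h : u ≫ q = v ≫ q), O q ∧ IsKernelPair q u v ∧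
      IsUniversalColimit (Cofork.ofπ q h)
  /-- (G5P) -/
  localPullbacks : ∀ ⦃X R S Y : C⦄ (r : X ⟶ R) (g : R ⟶ S) (f : Y ⟶ S), O r → Epi r →
    HasPullback (r ≫ g) f → HasPullback g f

/-- The pretopology of a `𝒰`-glutos: all epi sinks with members in `O`. -/
def epiPretopology (O : MorphismProperty C) : Precoverage C where
  coverings _ := {S | SinkIn O S ∧ IsEpiSink S}

/-! ### Presites -/

/-- The clopen arrows: those belonging to some covering. -/
def clopens (τ : Precoverage C) : MorphismProperty C :=
  fun _ Y f => ∃ S ∈ τ Y, S f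

/-- `τ` is a pretopology, i.e. `(C, τ)` is a presite. The field `complete` is (PT4). -/
structure IsPresite (τ : Precoverage C) : Prop where
  hasPullbacks : τ.HasPullbacks
  hasIsos : τ.HasIsos
  isStableUnderBaseChange : τ.IsStableUnderBaseChange
  isStableUnderComposition : τ.IsStableUnderComposition
  complete : ∀ ⦃X : C⦄ (S T : Presieve X), SinkIn (clopens τ) S → T ∈ τ X → IsRefinement T S →
    S ∈ τ X

/-- The operation `ℳ`: the coverings of `ℳτ` are the coverings of `τ` consisting of monos. -/
def monoPart (τ : Precoverage C) : Precoverage C where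
  coverings X := {S | S ∈ τ X ∧ ∀ ⦃Y : C⦄ (f : Y ⟶ X), S f → Mono f}

/-- An `ℳ`-presite: a presite all of whose coverings consist of monos. -/
structure IsMPresite (τ : Precoverage C) : Prop extends IsPresite τ where
  mono : ∀ ⦃X : C⦄ (S : Presieve X), S ∈ τ X → ∀ ⦃Y : C⦄ (f : Y ⟶ X), S f → Mono f

/-- A `𝒰`-presite: the underlying category is a `𝒰`-category and there exist `u`-small local sets
of topological generators (LTG_𝒰). -/
structure IsUPresite (τ : Precoverage C) : Prop extends IsPresite τ where
  isUCategory : IsUCategory.{u} C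
  localGenerators : ∀ X : C, ∃ G : Set C, Small.{u} G ∧ ∀ ⦃U : C⦄ (a : U ⟶ X), clopens τ a →
    ∃ S ∈ τ U, ∀ ⦃V : C⦄ (f : V ⟶ U), S f → V ∈ G

end Sinks

/-! ### Continuous functors and universal `𝒰`-glutoses -/

section Functors

variable {C : Type v} [Category.{w} C] {D : Type v'} [Category.{w'} D]
  {E : Type v''} [Category.{w''} E]

/-- Continuous functors (morphisms of presites): they respect coverings, clopen arrows and
pullbacks of clopen arrows along arbitrary arrows. -/
structure IsContinuous (τ : Precoverage C) (σ : Precoverage D) (F : C ⥤ D) : Prop where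
  map_covering : ∀ ⦃X : C⦄ (S : Presieve X), S ∈ τ X → S.map F ∈ σ (F.obj X)
  map_clopen : ∀ ⦃X Y : C⦄ (f : X ⟶ Y), clopens τ f → clopens σ (F.map f)
  map_isPullback : ∀ ⦃P X Y Z : C⦄ (p : P ⟶ X) (q : P ⟶ Y) (f : X ⟶ Z) (g : Y ⟶ Z),
    clopens τ f → IsPullback p q f g → IsPullback (F.map p) (F.map q) (F.map f) (F.map g)

theorem IsContinuous.comp {τ : Precoverage C} {σ : Precoverage D} {ρ : Precoverage E}
    {F : C ⥤ D} {G : D ⥤ E} (hF : IsContinuous τ σ F) (hG : IsContinuous σ ρ G) :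
    IsContinuous τ ρ (F ⋙ G) where
  map_covering X S hS := by
    have h : S.map (F ⋙ G) = (S.map F).map G := by
      apply le_antisymm
      · rintro Y _ ⟨hf⟩
        exact .of (.of hf)
      · rintro Y _ ⟨⟨hf⟩⟩
        exact Presieve.map.of (F := F ⋙ G) hf
    rw [h]
    exact hG.map_covering _ (hF.map_covering _ hS)
  map_clopen X Y f hf := hG.map_clopen _ (hF.map_clopen _ hf)
  map_isPullback P X Y Z p q f g hf h :=
    hG.map_isPullback _ _ _ _ (hF.map_clopen _ hf) (hF.map_isPullback _ _ _ _ hf h)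

/-- The category `[C, D]` of continuous functors and all natural transformations. -/
abbrev ContinuousFunctors (τ : Precoverage C) (σ : Precoverage D) :=
  ObjectProperty.FullSubcategory (fun F : C ⥤ D => IsContinuous τ σ F)

/-- The functor `[Y, E] : [D, E] ⥤ [C, E]` of precomposition with a continuous functor `Y`. -/
def precomp {τ : Precoverage C} {σ : Precoverage D} (ρ : Precoverage E) (Y : C ⥤ D)
    (hY : IsContinuous τ σ Y) : ContinuousFunctors σ ρ ⥤ ContinuousFunctors τ ρ :=
  ObjectProperty.lift _ (ObjectProperty.ι _ ⋙ (Functor.whiskeringLeft C D E).obj Y)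
    (fun F => hY.comp F.property)

/-- The continuous functor `Y` from the presite `(C, τ)` to the `𝒰`-glutos `(D, O)` is universal:
for every `𝒰`-glutos `E` the functor `[Y, E]` is a natural equivalence having a right inverse. -/
def IsUniversalArrow (τ : Precoverage C) (O : MorphismProperty D) (Y : C ⥤ D) : Prop :=
  ∃ hY : IsContinuous τ (epiPretopology O) Y,
    ∀ (E : Type (u + 1)) [Category.{u} E] (P : MorphismProperty E), IsUGlutos.{u} E P →
      (precomp (epiPretopology P) Y hY).IsEquivalence ∧
      ∃ K : ContinuousFunctors τ (epiPretopology P) ⥤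
          ContinuousFunctors (epiPretopology O) (epiPretopology P),
        K ⋙ precomp (epiPretopology P) Y hY = 𝟭 _

/-- Natural equivalence of presites. -/
def PresiteEquivalent (τ : Precoverage C) (σ : Precoverage D) : Prop :=
  ∃ e : C ≌ D, IsContinuous τ σ e.functor ∧ IsContinuous σ τ e.inverse

/-- A nearly `𝒰`-glutos: a `𝒰`-presite naturally equivalent to the presite `ℳ D`, for a universal
`𝒰`-glutos `D` of some `𝒰`-presite `B`. -/
def IsNearlyUGlutos (τ : Precoverage C) : Prop :=
  IsUPresite.{u} τ ∧
    ∃ (B : Type v) (_ : Category.{w} B) (ρ : Precoverage B)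
      (D : Type v) (_ : Category.{w} D) (O : MorphismProperty D) (Y : B ⥤ D),
      IsUPresite.{u} ρ ∧ IsUGlutos.{u} D O ∧ IsUniversalArrow.{u} ρ O Y ∧
        PresiteEquivalent τ (monoPart (epiPretopology O))

/-! ### The conditions characterizing nearly `𝒰`-glutoses -/

/-- (NG1) The clopen subobjects of any object form a `u`-small set. -/
def NG1 (τ : Precoverage C) : Prop :=
  ∀ X : C, Small.{u} {A : Subobject X // clopens τ A.arrow}

/-- (NG2) Any family of clopen arrows `U_i ⟶ X` factors as a covering followed by a
clopen arrow. -/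
def NG2 (τ : Precoverage C) : Prop :=
  ∀ (X : C) (I : Type (max v w)) (U : I → C) (a : ∀ i, U i ⟶ X), (∀ i, clopens τ (a i)) →
    ∃ (Z : C) (z : Z ⟶ X) (a' : ∀ i, U i ⟶ Z),
      Presieve.ofArrows U a' ∈ τ Z ∧ clopens τ z ∧ ∀ i, a' i ≫ z = a i

/-- (NG3) Any epi sink of clopen arrows is a covering. -/
def NG3 (τ : Precoverage C) : Prop :=
  ∀ (X : C) (S : Presieve X), SinkIn (clopens τ) S → IsEpiSink S → S ∈ τ X

end Functors

end Glutos

/-!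
Call an arrow étale if its source is covered by clopen subobjects on which its restriction is
clopen.

If `(C, τ)` satisfies the four conditions, then `C` with the étale arrows is a `𝒰`-glutos: by (NG1)
the étale arrows over `X` are the sheaves on a small site of clopen subobjects of `X`, each such
sheaf being represented by gluing the clopens on which it has sections, while coproducts and
quotients are again obtained by gluing. A continuous functor into a `𝒰`-glutos is automatically
continuous for the étale arrows, since it preserves small epi sinks of clopens and a glutos allows
to descend along these; so the identity of `C` is a universal `𝒰`-glutos of `(C, τ)`. Étale
monomorphisms are clopen by (NG2), and with (NG3) this shows that `τ` consists of the epi sinks of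
étale monomorphisms.

Conversely, a family `U i` in a `𝒰`-glutos can be glued along monomorphisms belonging to it: the
coproduct of the overlaps is an equivalence relation on the coproduct of the `U i`, which is locally
coequalizable because it is trivial on every `U i`. Gluing is invariant under equivalences of
presites. The union of a family of clopen subobjects, as needed for (NG2), is glued along the
intersections; the local generators bound the number of clopen subobjects, so that small families
suffice.
-/

namespace Glutos

/-! ### Subcanonical sites -/

section Sites

variable {C : Type v} [Category.{w} C]

theorem isPullback_of_jointlyMono {P X Y Z : C} {p : P ⟶ X} {q : P ⟶ Y} {f : X ⟶ Z} {g : Y ⟶ Z}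
    (w : p ≫ f = q ≫ g) (hpq : JointlyMono₂ p q)
    (hlift : ∀ (T : C) (s : T ⟶ X) (t : T ⟶ Y), s ≫ f = t ≫ g →
      ∃ l : T ⟶ P, l ≫ p = s ∧ l ≫ q = t) : IsPullback p q f g := by
  choose l hp hq using hlift
  exact ⟨⟨w⟩, ⟨PullbackCone.IsLimit.mk w (fun s => l _ s.fst s.snd s.condition)
    (fun _ => hp ..) (fun _ => hq ..) fun _ _ h₁ h₂ =>
      hpq.right_cancellation _ _ (h₁.trans (hp ..).symm) (h₂.trans (hq ..).symm)⟩⟩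

variable {J : GrothendieckTopology C}

theorem mem_of_generate_mem {X : C} {S : Presieve X} (hS : Sieve.generate S ∈ J X) {R : Sieve X}
    (h : ∀ ⦃Y : C⦄ (f : Y ⟶ X), S f → R.pullback f ∈ J Y) : R ∈ J X := by
  refine J.transitive hS R ?_
  rintro Y _ ⟨Z, g, f, hf, rfl⟩
  rw [Sieve.pullback_comp]
  exact J.pullback_stable g (h f hf)

theorem bot_mem_of_hom {Y Z : C} (f : Y ⟶ Z) (hZ : ⊥ ∈ J Z) : ⊥ ∈ J Y := by
  simpa using J.pullback_stable f hZ

theorem ofArrows_mem_of_isPullback {X Y : C} {I : Type*} {U P : I → C} {a : ∀ i, U i ⟶ X}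
    (h : Sieve.ofArrows U a ∈ J X) (g : Y ⟶ X) (p : ∀ i, P i ⟶ Y) (q : ∀ i, P i ⟶ U i)
    (hp : ∀ i, IsPullback (p i) (q i) g (a i)) : Sieve.ofArrows P p ∈ J Y := by
  refine J.superset_covering ?_ (J.pullback_stable g h)
  rintro T k ⟨_, b, _, ⟨i⟩, hb⟩
  exact (Sieve.mem_ofArrows_iff _ _ _).2 ⟨i, (hp i).lift k b hb.symm, by simp⟩

variable [J.Subcanonical]

theorem hom_ext_of_mem {X : C} {S : Sieve X} (hS : S ∈ J X) {T : C} {f g : X ⟶ T}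
    (h : ∀ ⦃Y : C⦄ (a : Y ⟶ X), S a → a ≫ f = a ≫ g) : f = g :=
  ((GrothendieckTopology.Subcanonical.isSheaf_of_isRepresentable (J := J)
    (yoneda.obj T)) S hS).isSeparatedFor.ext fun _ a ha => h a ha

theorem hom_ext_of_bot_mem {X T : C} (hX : ⊥ ∈ J X) (f g : X ⟶ T) : f = g :=
  hom_ext_of_mem hX fun _ _ h => h.elim

theorem hom_ext_of_ofArrows_mem {X : C} {I : Type*} {U : I → C} {a : ∀ i, U i ⟶ X}
    (hS : Sieve.ofArrows U a ∈ J X) {T : C} {f g : X ⟶ T}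
    (h : ∀ i, a i ≫ f = a i ≫ g) : f = g := by
  refine hom_ext_of_mem hS ?_
  rintro Y _ ⟨_, b, _, ⟨i⟩, rfl⟩
  simp only [Category.assoc, h]

theorem isEpiSink_of_generate_mem {X : C} {S : Presieve X} (hS : Sieve.generate S ∈ J X) :
    IsEpiSink S := fun Z g h H => hom_ext_of_mem hS (by
  rintro Y _ ⟨_, b, a, ha, rfl⟩
  simp only [Category.assoc, H a ha])

theorem exists_desc_of_ofArrows_mem {X : C} {I : Type*} {U : I → C} {a : ∀ i, U i ⟶ X}
    (hS : Sieve.ofArrows U a ∈ J X) {T : C} (e : ∀ i, U i ⟶ T)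
    (he : ∀ (i j : I) (W : C) (p : W ⟶ U i) (q : W ⟶ U j), p ≫ a i = q ≫ a j →
      p ≫ e i = q ≫ e j) : ∃ f : X ⟶ T, ∀ i, a i ≫ f = e i := by
  have h := (GrothendieckTopology.Subcanonical.isSheaf_of_isRepresentable (J := J)
    (yoneda.obj T)) _ hS
  rw [Sieve.ofArrows, ← Presieve.isSheafFor_iff_generate, Presieve.isSheafFor_arrows_iff] at h
  obtain ⟨f, hf, -⟩ := h e fun i j W p q hpq => he i j W p q hpq
  exact ⟨f, hf⟩

theorem exists_desc_of_mem {X : C} {S : Sieve X} (hS : S ∈ J X) {T : C}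
    (e : ∀ ⦃Y : C⦄ (a : Y ⟶ X), S a → (Y ⟶ T))
    (he : ∀ ⦃Y Z W : C⦄ (a : Y ⟶ X) (ha : S a) (b : Z ⟶ X) (hb : S b) (p : W ⟶ Y) (q : W ⟶ Z),
      p ≫ a = q ≫ b → p ≫ e a ha = q ≫ e b hb) :
    ∃ f : X ⟶ T, ∀ ⦃Y : C⦄ (a : Y ⟶ X) (ha : S a), a ≫ f = e a ha := by
  have hS' : Sieve.ofArrows (fun i : Σ Y : C, {a : Y ⟶ X // S a} => i.1) (fun i => i.2.1) ∈ J X :=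
    J.superset_covering (fun Y f hf => Sieve.ofArrows_mk
      (fun i : Σ Y : C, {a : Y ⟶ X // S a} => i.1) (fun i => i.2.1) ⟨Y, f, hf⟩) hS
  obtain ⟨f, hf⟩ := exists_desc_of_ofArrows_mem hS' (fun i => e i.2.1 i.2.2)
    fun i j W p q h => he _ i.2.2 _ j.2.2 p q h
  exact ⟨f, fun Y a ha => hf ⟨Y, a, ha⟩⟩

theorem exists_jointLift_of_mem {R X Y T : C} {p : R ⟶ X} {q : R ⟶ Y} (hpq : JointlyMono₂ p q)
    {s : T ⟶ X} {t : T ⟶ Y} {A : Sieve T} (hA : A ∈ J T)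
    (h : ∀ ⦃W : C⦄ (k : W ⟶ T), A k → ∃ l : W ⟶ R, l ≫ p = k ≫ s ∧ l ≫ q = k ≫ t) :
    ∃ l : T ⟶ R, l ≫ p = s ∧ l ≫ q = t := by
  choose l hp hq using h
  obtain ⟨f, hf⟩ := exists_desc_of_mem hA l fun Y Z W a ha b hb x y e =>
    hpq.right_cancellation _ _ (by simp [hp, reassoc_of% e]) (by simp [hq, reassoc_of% e])
  exact ⟨f, hom_ext_of_mem hA fun Y a ha => by rw [← hp a ha, ← hf a ha, Category.assoc],
    hom_ext_of_mem hA fun Y a ha => by rw [← hq a ha, ← hf a ha, Category.assoc]⟩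

theorem isPullback_of_ofArrows_mem {P X Y Z : C} {p : P ⟶ X} {q : P ⟶ Y} {f : X ⟶ Z} {g : Y ⟶ Z}
    {I : Type*} {U V : I → C} {a : ∀ i, U i ⟶ X} (hU : Sieve.ofArrows U a ∈ J X)
    (w : p ≫ f = q ≫ g) {x : ∀ i, V i ⟶ U i} {r : ∀ i, V i ⟶ P}
    (H : ∀ i, IsPullback (x i) (r i) (a i) p)
    (H' : ∀ i, IsPullback (x i) (r i ≫ q) (a i ≫ f) g) : IsPullback p q f g := by
  have hpq : JointlyMono₂ p q := by
    refine ⟨fun T s t ep eq => hom_ext_of_mem (J.pullback_stable (s ≫ p) hU) ?_⟩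
    rintro W k ⟨_, y, _, ⟨i⟩, e⟩
    have lp := (H i).lift_snd y (k ≫ s) (by simp [e])
    have lp' := (H i).lift_snd y (k ≫ t) (by simp [e, ep])
    rw [← lp, ← lp']
    refine congrArg (· ≫ r i) ((H' i).hom_ext (by simp) ?_)
    rw [reassoc_of% lp, reassoc_of% lp', eq]
  refine isPullback_of_jointlyMono w hpq fun T s t e =>
    exists_jointLift_of_mem hpq (J.pullback_stable s hU) ?_
  rintro W k ⟨_, y, _, ⟨i⟩, ey⟩
  obtain ⟨l, lx, lq⟩ := (H' i).exists_lift y (k ≫ t) (by simp [reassoc_of% ey, e])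
  exact ⟨l ≫ r i, by rw [Category.assoc, ← (H i).w, reassoc_of% lx, ey], by simpa using lq⟩

theorem exists_lift_of_mem {A Y T : C} (m : A ⟶ Y) [Mono m] (g : T ⟶ Y) {R : Sieve T}
    (hR : R ∈ J T) (h : ∀ ⦃W : C⦄ (k : W ⟶ T), R k → ∃ l : W ⟶ A, l ≫ m = k ≫ g) :
    ∃ l : T ⟶ A, l ≫ m = g := by
  have hm : JointlyMono₂ m m := ⟨fun _ _ _ e _ => (cancel_mono m).1 e⟩
  obtain ⟨l, hl, -⟩ := exists_jointLift_of_mem hm (s := g) (t := g) hR fun W k hk =>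
    (h k hk).imp fun _ e => ⟨e, e⟩
  exact ⟨l, hl⟩

theorem nonempty_isInitial_of_bot_mem {Z : C} (hZ : ⊥ ∈ J Z) : Nonempty (IsInitial Z) := by
  choose f _ using fun T => exists_desc_of_mem hZ (T := T) (fun _ _ h => h.elim)
    (fun _ _ _ _ h => h.elim)
  exact ⟨IsInitial.ofUniqueHom f fun T m => hom_ext_of_bot_mem hZ _ _⟩

end Sites

/-! ### Clopos structures and presites -/

section Presites

variable {C : Type v} [Category.{w} C]

namespace IsClopos

variable {O : MorphismProperty C} (hO : IsClopos O)

include hO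

theorem comp {X Y Z : C} {g : X ⟶ Y} {f : Y ⟶ Z} (hg : O g) (hf : O f) : O (g ≫ f) :=
  hO.isStableUnderComposition.comp_mem g f hg hf

theorem hasPullback {X Y Z : C} {f : X ⟶ Z} (hf : O f) (g : Y ⟶ Z) : HasPullback f g :=
  hO.hasPullbacks.hasPullback g hf

theorem snd_of_isPullback {P X Y Z : C} {p : P ⟶ X} {q : P ⟶ Y} {f : X ⟶ Z} {g : Y ⟶ Z}
    (H : IsPullback p q f g) (hf : O f) : O q :=
  hO.isStableUnderBaseChange.of_isPullback H hf

theorem fst_of_isPullback {P X Y Z : C} {p : P ⟶ X} {q : P ⟶ Y} {f : X ⟶ Z} {g : Y ⟶ Z}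
    (H : IsPullback p q f g) (hg : O g) : O p :=
  hO.snd_of_isPullback H.flip hg

theorem of_comp_mono {X Y Z : C} {g : X ⟶ Y} {f : Y ⟶ Z} [Mono f] (hgf : O (g ≫ f)) : O g :=
  have := hO.isStableUnderBaseChange
  O.of_postcomp (W' := MorphismProperty.monomorphisms C) g f inferInstance hgf

end IsClopos

variable {τ : Precoverage C}

theorem sinkIn_clopens_of_mem {X : C} {S : Presieve X} (hS : S ∈ τ X) : SinkIn (clopens τ) S :=
  fun _ _ hf => ⟨S, hS, hf⟩

theorem clopens_iff_exists_ofArrows {X Y : C} (f : X ⟶ Y) : clopens τ f ↔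
    ∃ (I : Type (max v w)) (U : I → C) (a : ∀ i, U i ⟶ Y) (i₀ : I) (e : U i₀ = X),
      Presieve.ofArrows U a ∈ τ Y ∧ a i₀ = eqToHom e ≫ f := by
  constructor
  · rintro ⟨S, hS, hf⟩
    obtain ⟨I, U, a, rfl⟩ := S.exists_eq_ofArrows
    exact ⟨I, U, a, hf.idx, hf.obj_idx, hS, hf.hom_idx⟩
  · rintro ⟨I, U, a, i₀, rfl, hS, e⟩
    refine ⟨_, hS, ?_⟩
    obtain rfl : a i₀ = f := by simpa using e
    exact .mk i₀

theorem isUniversalEffectiveEpiSink_of_mem (hsub : τ.toGrothendieck.Subcanonical) {X : C}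
    {S : Presieve X} (hS : S ∈ τ X) : IsUniversalEffectiveEpiSink S := fun Y f => by
  rw [Sieve.EffectiveEpimorphic.iff_forall_isSheafFor_yoneda]
  exact fun T => (GrothendieckTopology.Subcanonical.isSheaf_of_isRepresentable
    (J := τ.toGrothendieck) (yoneda.obj T)) _
      (τ.toGrothendieck.pullback_stable f (Precoverage.generate_mem_toGrothendieck hS))

namespace IsPresite

variable (h : IsPresite τ)

include h

theorem clopens_of_isIso {X Y : C} (f : X ⟶ Y) [IsIso f] : clopens τ f :=
  ⟨_, h.hasIsos.mem_coverings_of_isIso f, ⟨⟩⟩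

theorem hasPullback_of_clopens {X Y Z : C} {f : X ⟶ Z} (hf : clopens τ f) (g : Y ⟶ Z) :
    HasPullback f g := by
  obtain ⟨S, hS, hf⟩ := hf
  exact (h.hasPullbacks.hasPullbacks_of_mem g hS).hasPullback hf

theorem clopens_comp {X Y Z : C} {g : X ⟶ Y} {f : Y ⟶ Z} (hg : clopens τ g) (hf : clopens τ f) :
    clopens τ (g ≫ f) := by
  classical
  have := h.isStableUnderComposition
  have := h.hasIsos
  obtain ⟨I, U, a, i₀, rfl, hS, e⟩ := (clopens_iff_exists_ofArrows f).1 hf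
  obtain rfl : a i₀ = f := by simpa using e
  -- Refine the covering containing `f` by the covering containing `g` over the source of `f` and
  -- by identities elsewhere.
  have exists_covering : ∀ i, ∃ T ∈ τ (U i), ∀ e : i = i₀, T (g ≫ eqToHom (by rw [e])) := by
    intro i
    by_cases hi : i = i₀
    · subst hi
      obtain ⟨T, hT, hg⟩ := hg
      exact ⟨T, hT, fun _ => by simpa using hg⟩
    · exact ⟨_, Precoverage.mem_coverings_of_isIso (𝟙 _), fun e => (hi e).elim⟩
  choose T hT mem_T using exists_covering
  choose K V b hb using fun i => (T i).exists_eq_ofArrows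
  refine ⟨_, Precoverage.comp_mem_coverings a hS (fun i j => b i j)
    (fun i => by rw [← hb]; exact hT i), ?_⟩
  have mem_b := mem_T i₀ rfl
  rw [hb] at mem_b
  simp only [eqToHom_refl, Category.comp_id] at mem_b
  obtain ⟨j, e, hj⟩ := Presieve.ofArrows_surj _ _ mem_b
  subst e
  obtain rfl : g = b i₀ j := by simpa using hj
  exact Presieve.ofArrows.mk (f := fun p : Σ i, K i => b p.1 p.2 ≫ a p.1) ⟨i₀, j⟩

theorem clopens_snd_of_isPullback {P X Y Z : C} {p : P ⟶ X} {q : P ⟶ Y} {f : X ⟶ Z} {g : Y ⟶ Z}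
    (H : IsPullback p q f g) (hf : clopens τ f) : clopens τ q := by
  have := h.isStableUnderBaseChange
  obtain ⟨I, U, a, i₀, rfl, hS, e⟩ := (clopens_iff_exists_ofArrows f).1 hf
  obtain rfl : a i₀ = f := by simpa using e
  have (i : I) : HasPullback (a i) g := h.hasPullback_of_clopens ⟨_, hS, .mk i⟩ g
  have hsnd : clopens τ (pullback.snd (a i₀) g) :=
    ⟨_, Precoverage.mem_coverings_of_isPullback a hS g (fun i => pullback.snd (a i) g)
      (fun i => pullback.fst (a i) g) fun i => (IsPullback.of_hasPullback _ _).flip, .mk i₀⟩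
  rw [← H.isoIsPullback_hom_snd _ _ (IsPullback.of_hasPullback (a i₀) g)]
  exact h.clopens_comp (h.clopens_of_isIso _) hsnd

theorem isClopos : IsClopos (clopens τ) where
  of_isIso _ _ f _ := h.clopens_of_isIso f
  hasPullbacks := ⟨fun g hf => h.hasPullback_of_clopens hf g⟩
  isStableUnderComposition := ⟨fun _ _ hg hf => h.clopens_comp hg hf⟩
  isStableUnderBaseChange := ⟨fun H hf => h.clopens_snd_of_isPullback H hf⟩

theorem clopens_subobjectMk_arrow {X Y : C} {f : X ⟶ Y} [Mono f] (hf : clopens τ f) :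
    clopens τ (Subobject.mk f).arrow := by
  rw [← Subobject.underlyingIso_hom_comp_eq_mk]
  exact h.isClopos.comp (h.clopens_of_isIso _) hf

theorem mem_iff_generate_mem {X : C} {S : Presieve X} (hS : SinkIn (clopens τ) S) :
    S ∈ τ X ↔ Sieve.generate S ∈ τ.toGrothendieck X := by
  have := h.isStableUnderBaseChange
  have := h.isStableUnderComposition
  have := h.hasPullbacks
  have := h.hasIsos
  refine ⟨fun hS => Precoverage.generate_mem_toGrothendieck hS, fun H => ?_⟩
  obtain ⟨R, hR, hle⟩ := Precoverage.mem_toGrothendieck_iff_of_isStableUnderComposition.1 H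
  refine h.complete S R hS hR fun Y t ht => ?_
  obtain ⟨Z, a, s, hs, e⟩ := hle _ _ ht
  exact ⟨Z, s, a, hs, e⟩

theorem ofArrows_mem_iff {X : C} {I : Type*} {U : I → C} {a : ∀ i, U i ⟶ X}
    (ha : ∀ i, clopens τ (a i)) :
    Presieve.ofArrows U a ∈ τ X ↔ Sieve.ofArrows U a ∈ τ.toGrothendieck X :=
  h.mem_iff_generate_mem fun _ _ ⟨i⟩ => ha i

end IsPresite

namespace IsMPresite

variable (h : IsMPresite τ)

include h

theorem mono_of_clopens {X Y : C} {f : X ⟶ Y} (hf : clopens τ f) : Mono f := by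
  obtain ⟨S, hS, hf⟩ := hf
  exact h.mono S hS f hf

theorem exists_isLUB_of_ng2 (hsub : τ.toGrothendieck.Subcanonical) (h2 : NG2 τ) (X : C)
    (A : Set (Subobject X)) (hA : ∀ a ∈ A, clopens τ a.arrow) :
    ∃ b : Subobject X, IsLUB A b ∧ clopens τ b.arrow := by
  obtain ⟨Z, z, a', hc, hz, e⟩ := h2 X A (fun a => (a.1 : C)) (fun a => a.1.arrow)
    fun a => hA _ a.2
  have := h.mono_of_clopens hz
  refine ⟨Subobject.mk z, ⟨fun a ha => ?_, fun c hc' => ?_⟩, h.clopens_subobjectMk_arrow hz⟩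
  · exact Subobject.le_mk_of_comm (a' ⟨a, ha⟩) (e ⟨a, ha⟩)
  · obtain ⟨l, hl⟩ := exists_lift_of_mem c.arrow z
      (Precoverage.generate_mem_toGrothendieck hc) (by
        rintro W _ ⟨_, b, _, ⟨i⟩, rfl⟩
        exact ⟨b ≫ Subobject.ofLE _ _ (hc' i.2), by simp [e]⟩)
    exact Subobject.mk_le_of_comm l hl

theorem exists_small_ofArrows (h1 : NG1.{u} τ) {X : C} {S : Presieve X}
    (hS : SinkIn (clopens τ) S) :
    ∃ (I : Type u) (U : I → C) (a : ∀ i, U i ⟶ X), (∀ i, S (a i)) ∧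
      Sieve.generate S = Sieve.ofArrows U a := by
  have := h1 X
  let A : Set {A : Subobject X // clopens τ A.arrow} :=
    {A | ∃ (Y : C) (f : Y ⟶ X) (_ : Mono f), S f ∧ Subobject.mk f = A.1}
  choose Y f hf hfS mk_f using fun x : A => x.2
  refine ⟨Shrink.{u} A, fun i => Y ((equivShrink A).symm i), fun i => f ((equivShrink A).symm i),
    fun i => hfS _, le_antisymm ?_ ?_⟩
  · rw [Sieve.generate_le_iff]
    intro Z g hg
    have := h.mono_of_clopens (hS g hg)
    let x : A := ⟨⟨Subobject.mk g, h.clopens_subobjectMk_arrow (hS g hg)⟩, Z, g, this, hg, rfl⟩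
    refine (Sieve.mem_ofArrows_iff _ _ _).2 ⟨equivShrink A x, ?_⟩
    rw [Equiv.symm_apply_apply]
    have hx : Subobject.mk g ≤ Subobject.mk (f x) := (mk_f x).ge
    exact ⟨Subobject.ofMkLEMk _ _ hx, by simp⟩
  · rw [Sieve.generate_le_iff]
    rintro _ _ ⟨i⟩
    exact Sieve.le_generate _ _ _ (hfS _)

end IsMPresite

end Presites

/-! ### Gluing -/

section GluingRelations

variable {C : Type v} [Category.{w} C]

theorem isEpiSink_ofArrows_iff {X : C} {I : Type*} {U : I → C} {a : ∀ i, U i ⟶ X} :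
    IsEpiSink (Presieve.ofArrows U a) ↔
      ∀ ⦃Z : C⦄ (g h : X ⟶ Z), (∀ i, a i ≫ g = a i ≫ h) → g = h :=
  ⟨fun H _ g h e => H g h fun _ _ ⟨i⟩ => e i, fun H _ g h e => H g h fun i => e _ (.mk i)⟩

theorem jointlyMono₂_of_mono {R X Y : C} (p : R ⟶ X) [Mono p] (q : R ⟶ Y) : JointlyMono₂ p q :=
  ⟨fun _ _ _ e _ => (cancel_mono p).1 e⟩

theorem jointlyMono₂_symm {R X Y : C} {p : R ⟶ X} {q : R ⟶ Y} (h : JointlyMono₂ p q) :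
    JointlyMono₂ q p :=
  ⟨fun _ s t e e' => h.right_cancellation s t e' e⟩

/-- Gluing data for a family of objects in terms of generalized elements: an equivalence relation
on the disjoint union of the presheaves represented by the objects `U i`. -/
structure GluingRelation {I : Type*} (U : I → C) where
  /-- The generalized elements `a` of `U i` and `b` of `U j` are to be identified. -/
  rel : ∀ {i j : I} {T : C}, (T ⟶ U i) → (T ⟶ U j) → Prop
  refl : ∀ {i : I} {T : C} (a : T ⟶ U i), rel a a
  symm : ∀ {i j : I} {T : C} {a : T ⟶ U i} {b : T ⟶ U j}, rel a b → rel b a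
  trans : ∀ {i j k : I} {T : C} {a : T ⟶ U i} {b : T ⟶ U j} {c : T ⟶ U k},
    rel a b → rel b c → rel a c
  precomp : ∀ {i j : I} {T T' : C} (t : T' ⟶ T) {a : T ⟶ U i} {b : T ⟶ U j},
    rel a b → rel (t ≫ a) (t ≫ b)

namespace GluingRelation

variable {I : Type*} {U : I → C}

/-- The pair `p, q` is the universal pair of generalized elements of `U i` and `U j` related by `ρ`,
up to uniqueness of the factorization, which is automatic when `p` is a monomorphism. -/
structure IsRepresentedBy (ρ : GluingRelation U) {i j : I} {V : C} (p : V ⟶ U i) (q : V ⟶ U j) :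
    Prop where
  rel : ρ.rel p q
  exists_lift : ∀ {T : C} {a : T ⟶ U i} {b : T ⟶ U j}, ρ.rel a b →
    ∃ t : T ⟶ V, t ≫ p = a ∧ t ≫ q = b

/-- The family `π` exhibits its target as the result of gluing the objects `U i` along `ρ`. -/
structure IsGluing (ρ : GluingRelation U) {Q : C} (π : ∀ i, U i ⟶ Q) : Prop where
  isEpiSink : IsEpiSink (Presieve.ofArrows U π)
  comp_eq_comp_iff : ∀ {i j : I} {T : C} {a : T ⟶ U i} {b : T ⟶ U j},
    a ≫ π i = b ≫ π j ↔ ρ.rel a b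

/-- The relation of having the same image in `X`. -/
def ker {X : C} (x : ∀ i, U i ⟶ X) : GluingRelation U where
  rel a b := a ≫ x _ = b ≫ x _
  refl _ := rfl
  symm := Eq.symm
  trans := Eq.trans
  precomp t _ _ e := by rw [Category.assoc, e, Category.assoc]

/-- The conjunction of two gluing relations. -/
def inf (ρ σ : GluingRelation U) : GluingRelation U where
  rel a b := ρ.rel a b ∧ σ.rel a b
  refl a := ⟨ρ.refl a, σ.refl a⟩
  symm h := ⟨ρ.symm h.1, σ.symm h.2⟩
  trans h h' := ⟨ρ.trans h.1 h'.1, σ.trans h.2 h'.2⟩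
  precomp t _ _ h := ⟨ρ.precomp t h.1, σ.precomp t h.2⟩

theorem isRepresentedBy_ker {X : C} {x : ∀ i, U i ⟶ X} {i j : I} {V : C} {p : V ⟶ U i}
    {q : V ⟶ U j} (H : IsPullback p q (x i) (x j)) : (ker x).IsRepresentedBy p q where
  rel := H.w
  exists_lift e := ⟨H.lift _ _ e, H.lift_fst .., H.lift_snd ..⟩

variable {ρ : GluingRelation U}

namespace IsRepresentedBy

theorem symm {i j : I} {V : C} {p : V ⟶ U i} {q : V ⟶ U j} (h : ρ.IsRepresentedBy p q) :
    ρ.IsRepresentedBy q p where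
  rel := ρ.symm h.rel
  exists_lift r := (h.exists_lift (ρ.symm r)).imp fun _ e => e.symm

theorem exists_iso {i j : I} {V V' : C} {p : V ⟶ U i} {q : V ⟶ U j} {p' : V' ⟶ U i} {q' : V' ⟶ U j}
    (h : ρ.IsRepresentedBy p q) (h' : ρ.IsRepresentedBy p' q') (hpq : JointlyMono₂ p q)
    (hpq' : JointlyMono₂ p' q') : ∃ e : V ≅ V', e.hom ≫ p' = p ∧ e.hom ≫ q' = q := by
  obtain ⟨s, sp, sq⟩ := h'.exists_lift h.rel
  obtain ⟨t, tp, tq⟩ := h.exists_lift h'.rel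
  exact ⟨⟨s, t, hpq.right_cancellation _ _ (by simp [tp, sp]) (by simp [tq, sq]),
    hpq'.right_cancellation _ _ (by simp [tp, sp]) (by simp [tq, sq])⟩, sp, sq⟩

theorem eq_of_mono {i : I} {V : C} {p q : V ⟶ U i} [Mono p] (h : ρ.IsRepresentedBy p q) :
    p = q := by
  obtain ⟨s, sp, sq⟩ := h.exists_lift (ρ.refl (𝟙 _))
  have ps : p ≫ s = 𝟙 _ := by rw [← cancel_mono p, Category.assoc, sp]; simp
  rw [← Category.comp_id p, ← sq, reassoc_of% ps]

theorem isPullback {i j : I} {V Q : C} {p : V ⟶ U i} {q : V ⟶ U j} {π : ∀ i, U i ⟶ Q}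
    (h : ρ.IsRepresentedBy p q) (hpq : JointlyMono₂ p q) (hπ : ρ.IsGluing π) :
    IsPullback p q (π i) (π j) :=
  isPullback_of_jointlyMono (hπ.comp_eq_comp_iff.2 h.rel) hpq fun _ _ _ e =>
    h.exists_lift (hπ.comp_eq_comp_iff.1 e)

end IsRepresentedBy

theorem rel_of_isPullback {i j : I} {V Q : C} {p : V ⟶ U i} {q : V ⟶ U j} {π : ∀ i, U i ⟶ Q}
    (hpq : ρ.rel p q) (H : IsPullback p q (π i) (π j)) {T : C} {a : T ⟶ U i} {b : T ⟶ U j}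
    (e : a ≫ π i = b ≫ π j) : ρ.rel a b := by
  have r := ρ.precomp (H.lift a b e) hpq
  rwa [H.lift_fst, H.lift_snd] at r

theorem isPullback_of_isRepresentedBy {i j k : I} {A B D T : C} {p₀ : A ⟶ U i} {q₀ : A ⟶ U j}
    {p₁ : B ⟶ U j} {q₁ : B ⟶ U k} {p₂ : D ⟶ U i} {q₂ : D ⟶ U k} (h₀ : ρ.IsRepresentedBy p₀ q₀)
    (h₁ : ρ.IsRepresentedBy p₁ q₁) (h₂ : ρ.IsRepresentedBy p₂ q₂) (m₁ : JointlyMono₂ p₁ q₁)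
    (m₂ : JointlyMono₂ p₂ q₂) {x : T ⟶ A} {y : T ⟶ D} {z : T ⟶ B} (H : IsPullback x y p₀ p₂)
    (hz : z ≫ p₁ = x ≫ q₀) (hz' : z ≫ q₁ = y ≫ q₂) : IsPullback x z q₀ p₁ := by
  refine isPullback_of_jointlyMono hz.symm ⟨fun W s t hx hz'' => ?_⟩ fun W s t e => ?_
  · refine H.hom_ext hx (m₂.right_cancellation _ _ ?_ ?_)
    · simp only [Category.assoc, ← H.w, reassoc_of% hx]
    · simp only [Category.assoc, ← hz', reassoc_of% hz'']
  · obtain ⟨l, lp, lq⟩ := h₂.exists_lift (ρ.trans (ρ.precomp s h₀.rel)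
      (by rw [e]; exact ρ.precomp t h₁.rel))
    refine ⟨H.lift s l lp.symm, H.lift_fst .., m₁.right_cancellation _ _ ?_ ?_⟩
    · rw [Category.assoc, hz, H.lift_fst_assoc, e]
    · rw [Category.assoc, hz', H.lift_snd_assoc, lq]

end GluingRelation

theorem IsGluon.of_isRepresentedBy {I : Type u} {d : MultispanIndex (MultispanShape.prod I) C}
    {ρ : GluingRelation d.right} (h : ∀ i j, ρ.IsRepresentedBy (d.fst (i, j)) (d.snd (i, j)))
    (hm : ∀ i j, JointlyMono₂ (d.fst (i, j)) (d.snd (i, j)))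
    (hpb : ∀ i j k, HasPullback (d.fst (i, j)) (d.fst (i, k))) : IsGluon d where
  jointlyMono := hm
  symm i j := (h j i).exists_lift (ρ.symm (h i j).rel)
  refl i := (h i i).exists_lift (ρ.refl _)
  cocycle i j k := by
    have H := IsPullback.of_hasPullback (d.fst (i, j)) (d.fst (i, k))
    obtain ⟨z, hz, hz'⟩ := (h j k).exists_lift (ρ.trans
      (ρ.symm (ρ.precomp (pullback.fst (d.fst (i, j)) (d.fst (i, k))) (h i j).rel))
      (by rw [H.w]; exact ρ.precomp _ (h i k).rel))
    exact ⟨_, _, _, z, H,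
      GluingRelation.isPullback_of_isRepresentedBy (h i j) (h j k) (h i k) (hm j k) (hm i k)
        H hz hz',
      GluingRelation.isPullback_of_isRepresentedBy (h i k) (h j k).symm (h i j)
        (jointlyMono₂_symm (hm j k)) (hm i j) H.flip hz' hz⟩

/-- The gluing relation represented by a reflexive, symmetric and transitive family of spans: two
generalized elements are related if they come from a common generalized element of `V i j`. -/
def GluingRelation.ofSpans {I : Type*} {U : I → C} {V : I → I → C} (p : ∀ i j, V i j ⟶ U i)
    (q : ∀ i j, V i j ⟶ U j)
    (symm : ∀ i j, ∃ t : V i j ⟶ V j i, t ≫ p j i = q i j ∧ t ≫ q j i = p i j)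
    (refl : ∀ i, ∃ s : U i ⟶ V i i, s ≫ p i i = 𝟙 _ ∧ s ≫ q i i = 𝟙 _)
    (trans : ∀ i j k, ∃ (W : C) (p₀ : W ⟶ V i j) (p' : W ⟶ V i k) (p₁ : W ⟶ V j k),
      p₀ ≫ p i j = p' ≫ p i k ∧ IsPullback p₀ p₁ (q i j) (p j k) ∧
        p' ≫ q i k = p₁ ≫ q j k) : GluingRelation U where
  rel {i j T} a b := ∃ t : T ⟶ V i j, t ≫ p i j = a ∧ t ≫ q i j = b
  refl {i T} a := by
    obtain ⟨s, s₁, s₂⟩ := refl i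
    exact ⟨a ≫ s, by simp [s₁], by simp [s₂]⟩
  symm {i j T a b} := by
    rintro ⟨t, rfl, rfl⟩
    obtain ⟨s, s₁, s₂⟩ := symm i j
    exact ⟨t ≫ s, by simp [s₁], by simp [s₂]⟩
  trans {i j k T a b c} := by
    rintro ⟨t, rfl, rfl⟩ ⟨t', e, rfl⟩
    obtain ⟨W, p₀, p', p₁, w, H, w'⟩ := trans i j k
    refine ⟨H.lift t t' e.symm ≫ p', ?_, ?_⟩
    · rw [Category.assoc, ← w, H.lift_fst_assoc]
    · rw [Category.assoc, w', H.lift_snd_assoc]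
  precomp {i j T T'} t {a b} := by
    rintro ⟨s, rfl, rfl⟩
    exact ⟨t ≫ s, Category.assoc .., Category.assoc ..⟩

/-- The gluing relation represented by the spans `U_i ← U_ij → U_j` of a gluon. -/
def IsGluon.relation {I : Type u} {d : MultispanIndex (MultispanShape.prod I) C}
    (hd : IsGluon d) : GluingRelation (I := I) d.right :=
  .ofSpans (fun i j => d.fst (i, j)) (fun i j => d.snd (i, j)) hd.symm hd.refl fun i j k =>
    let ⟨W, p₀, p, p₁, H, H', H''⟩ := hd.cocycle i j k
    ⟨W, p₀, p, p₁, H.w, H', H''.w⟩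

theorem IsGluon.isRepresentedBy {I : Type u} {d : MultispanIndex (MultispanShape.prod I) C}
    (hd : IsGluon d) (i j : I) : hd.relation.IsRepresentedBy (d.fst (i, j)) (d.snd (i, j)) where
  rel := ⟨𝟙 _, Category.id_comp _, Category.id_comp _⟩
  exists_lift h := h

theorem locallyOCoequalizable_of_comp_eq {O : MorphismProperty C} {R X Q : C} (hO : O (𝟙 X))
    {u v : R ⟶ X} {q : X ⟶ Q} (hq : O q) (e : u ≫ q = v ≫ q) : LocallyOCoequalizable O u v :=
  ⟨.singleton (𝟙 X), fun _ _ ⟨⟩ => hO, fun _ _ _ h => by simpa using h (𝟙 X) ⟨⟩, by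
    rintro _ _ ⟨⟩
    exact ⟨R, u, v, ⟨R, R, u, 𝟙 R, 𝟙 R, v, 𝟙 R, 𝟙 R, .of_vert_isIso ⟨by simp⟩,
      .of_horiz_isIso ⟨by simp⟩, .of_vert_isIso ⟨by simp⟩, by simp, by simp⟩, Q, q, hq, e⟩⟩

end GluingRelations

section GluingPresites

variable {C : Type v} [Category.{w} C] {τ : Precoverage C}

namespace IsMPresite

variable (h : IsMPresite τ)

include h

theorem exists_isGluing (hg : GluingCondition.{u} (clopens τ)) {I : Type u} {U : I → C}
    (ρ : GluingRelation U)
    (rep : ∀ i j, ∃ (V : C) (p : V ⟶ U i) (q : V ⟶ U j), clopens τ p ∧ ρ.IsRepresentedBy p q) :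
    ∃ (Q : C) (π : ∀ i, U i ⟶ Q), (∀ i, clopens τ (π i)) ∧ ρ.IsGluing π := by
  choose V p q hp hpq using rep
  have (i j : I) : Mono (p i j) := h.mono_of_clopens (hp i j)
  have hm (i j : I) : JointlyMono₂ (p i j) (q i j) := jointlyMono₂_of_mono _ _
  have hq (i j : I) : clopens τ (q i j) := by
    obtain ⟨e, ep, -⟩ := (hpq i j).symm.exists_iso (hpq j i)
      (jointlyMono₂_symm (hm i j)) (hm j i)
    rw [← ep]
    exact h.isClopos.comp (h.clopens_of_isIso _) (hp j i)
  let d : MultispanIndex (MultispanShape.prod I) C :=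
    { left := fun x => V x.1 x.2
      right := U
      fst := fun x => p x.1 x.2
      snd := fun x => q x.1 x.2 }
  have hd : IsGluon d := .of_isRepresentedBy (ρ := ρ) hpq hm fun i j k =>
    h.isClopos.hasPullback (hp i j) _
  obtain ⟨c, hc, hpb, hπ⟩ := hg I d hd (fun a => ⟨hp _ _, hq _ _⟩) fun i => by
    change LocallyOCoequalizable _ (p i i) (q i i)
    rw [← (hpq i i).eq_of_mono]
    exact locallyOCoequalizable_of_comp_eq (h.clopens_of_isIso _) (h.clopens_of_isIso (𝟙 _)) rfl
  refine ⟨c.pt, c.π, hπ, isEpiSink_ofArrows_iff.2 fun Z f g =>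
    Multicofork.IsColimit.hom_ext hc.isColimit, fun {i j T a b} =>
      ⟨GluingRelation.rel_of_isPullback (hpq i j).rel (hpb i j), fun r => ?_⟩⟩
  obtain ⟨t, rfl, rfl⟩ := (hpq i j).exists_lift r
  have w : p i j ≫ c.π i = q i j ≫ c.π j := (hpb i j).w
  rw [Category.assoc, Category.assoc, w]

theorem generate_mem_of_isGluing (h3 : NG3 τ) {I : Type*} {U : I → C} {ρ : GluingRelation U} {Q : C}
    {π : ∀ i, U i ⟶ Q} (hπ : ∀ i, clopens τ (π i)) (hρ : ρ.IsGluing π) :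
    Sieve.ofArrows U π ∈ τ.toGrothendieck Q :=
  (h.ofArrows_mem_iff hπ).1 (h3 Q _ (fun _ _ ⟨i⟩ => hπ i) hρ.isEpiSink)

end IsMPresite

/-- Subcanonical `ℳ`-presites satisfying the conditions that characterize nearly `𝒰`-glutoses. -/
structure IsGluingPresite (τ : Precoverage C) : Prop extends IsMPresite τ where
  isUCategory : IsUCategory.{u} C
  subcanonical : τ.toGrothendieck.Subcanonical
  gluing : GluingCondition.{u} (clopens τ)
  ng1 : NG1.{u} τ
  ng2 : NG2 τ
  ng3 : NG3 τ

namespace IsGluingPresite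

variable (h : IsGluingPresite.{u} τ)

include h

theorem exists_gluing {I : Type u} {U : I → C} (ρ : GluingRelation U)
    (rep : ∀ i j, ∃ (V : C) (p : V ⟶ U i) (q : V ⟶ U j), clopens τ p ∧ ρ.IsRepresentedBy p q) :
    ∃ (Q : C) (π : ∀ i, U i ⟶ Q), (∀ i, clopens τ (π i)) ∧
      Sieve.ofArrows U π ∈ τ.toGrothendieck Q ∧ ρ.IsGluing π := by
  obtain ⟨Q, π, hπ, hρ⟩ := h.exists_isGluing h.gluing ρ rep
  exact ⟨Q, π, hπ, h.generate_mem_of_isGluing h.ng3 hπ hρ, hρ⟩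

theorem exists_union {X : C} {S : Presieve X} (hS : SinkIn (clopens τ) S) :
    ∃ (Z : C) (z : Z ⟶ X), clopens τ z ∧ (Sieve.generate S).pullback z ∈ τ.toGrothendieck Z ∧
      ∀ ⦃Y : C⦄ (f : Y ⟶ X), S f → ∃ l : Y ⟶ Z, l ≫ z = f := by
  obtain ⟨I, U, a, rfl⟩ := S.exists_eq_ofArrows
  obtain ⟨Z, z, a', hc, hz, e⟩ := h.ng2 X I U a fun i => hS _ (.mk i)
  refine ⟨Z, z, hz, ?_, ?_⟩
  · refine τ.toGrothendieck.superset_covering ?_ (Precoverage.generate_mem_toGrothendieck hc)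
    rw [Sieve.generate_le_iff]
    rintro _ _ ⟨i⟩
    exact (Sieve.mem_ofArrows_iff _ _ _).2 ⟨i, 𝟙 _, by simp [e]⟩
  · rintro _ _ ⟨i⟩
    exact ⟨a' i, e i⟩

theorem exists_bot_mem (X : C) : ∃ (Z : C) (z : Z ⟶ X), clopens τ z ∧
    ⊥ ∈ τ.toGrothendieck Z := by
  obtain ⟨Z, z, hz, hc, -⟩ := h.exists_union (S := (⊥ : Presieve X)) fun _ _ hf => hf.elim
  refine ⟨Z, z, hz, τ.toGrothendieck.superset_covering ?_ hc⟩
  rintro Y f ⟨_, _, _, hf, _⟩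
  exact hf.elim

end IsGluingPresite

end GluingPresites

/-! ### Étale arrows -/

section Etale

variable {C : Type v} [Category.{w} C]

/-- The clopen arrows into the source of `f` whose composite with `f` is clopen. -/
def etaleSink (τ : Precoverage C) {X Y : C} (f : X ⟶ Y) : Presieve X :=
  fun _ a => clopens τ a ∧ clopens τ (a ≫ f)

/-- The arrows that are locally on the source clopen. They are the distinguished arrows of the
glutos on the underlying category of a nearly glutos. -/
def etale (τ : Precoverage C) : MorphismProperty C :=
  fun X _ f => Sieve.generate (etaleSink τ f) ∈ τ.toGrothendieck X

variable {τ : Precoverage C}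

namespace IsPresite

variable (h : IsPresite τ)

include h

theorem etale_of_clopens {X Y : C} {f : X ⟶ Y} (hf : clopens τ f) : etale τ f :=
  τ.toGrothendieck.superset_covering (fun _ g _ => ⟨X, g, 𝟙 X,
    ⟨h.clopens_of_isIso _, by simpa using hf⟩, Category.comp_id g⟩) (τ.toGrothendieck.top_mem X)

theorem etale_of_cover {X Y : C} {f : X ⟶ Y} {S : Presieve X} (hS : SinkIn (clopens τ) S)
    (hc : Sieve.generate S ∈ τ.toGrothendieck X)
    (H : ∀ ⦃Z : C⦄ (a : Z ⟶ X), S a → etale τ (a ≫ f)) : etale τ f := by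
  refine mem_of_generate_mem hc fun Z a ha => τ.toGrothendieck.superset_covering ?_ (H a ha)
  rw [Sieve.generate_le_iff]
  rintro W b ⟨hb, hb'⟩
  exact Sieve.le_generate _ _ _ ⟨h.clopens_comp hb (hS a ha), by simpa using hb'⟩

theorem etale_comp {X Y Z : C} {f : X ⟶ Y} {g : Y ⟶ Z} (hf : etale τ f) (hg : etale τ g) :
    etale τ (f ≫ g) := by
  refine mem_of_generate_mem hf fun W a ha => τ.toGrothendieck.superset_covering ?_
    (τ.toGrothendieck.pullback_stable (a ≫ f) hg)
  rintro T k ⟨V, t, b, hb, e⟩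
  have := h.hasPullback_of_clopens hb.1 (a ≫ f)
  have H := IsPullback.of_hasPullback b (a ≫ f)
  refine ⟨_, pullback.lift t k e, pullback.snd b (a ≫ f) ≫ a, ⟨?_, ?_⟩, pullback.lift_snd_assoc ..⟩
  · exact h.clopens_comp (h.isClopos.snd_of_isPullback H hb.1) ha.1
  · have w : (pullback.snd b (a ≫ f) ≫ a) ≫ f ≫ g = pullback.fst b (a ≫ f) ≫ b ≫ g := by
      simp [pullback.condition_assoc]
    rw [w]
    exact h.clopens_comp (h.isClopos.fst_of_isPullback H ha.2) hb.2

theorem etale_of_isPullback {P X Y Z : C} {p : P ⟶ X} {q : P ⟶ Y} {f : X ⟶ Z} {g : Y ⟶ Z}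
    (H : IsPullback p q f g) (hf : etale τ f) : etale τ q := by
  refine τ.toGrothendieck.superset_covering ?_ (τ.toGrothendieck.pullback_stable p hf)
  rintro T k ⟨V, t, a, ha, e⟩
  have := h.hasPullback_of_clopens ha.1 p
  have H' := IsPullback.of_hasPullback a p
  exact ⟨_, pullback.lift t k e, pullback.snd a p, ⟨h.isClopos.snd_of_isPullback H' ha.1,
    h.isClopos.snd_of_isPullback (H'.paste_vert H) ha.2⟩, pullback.lift_snd ..⟩

end IsPresite

theorem IsMPresite.etale_of_postcomp (h : IsMPresite τ) {X Y Z : C} {g : X ⟶ Y} {f : Y ⟶ Z}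
    (hgf : etale τ (g ≫ f)) (hf : etale τ f) : etale τ g := by
  refine mem_of_generate_mem hgf fun W a ha => τ.toGrothendieck.superset_covering ?_
    (τ.toGrothendieck.pullback_stable (a ≫ g) hf)
  rintro T k ⟨V, t, b, hb, e⟩
  have := h.hasPullback_of_clopens hb.1 (a ≫ g)
  have := h.mono_of_clopens hb.2
  have w := pullback.condition (f := b) (g := a ≫ g)
  have hs := h.isClopos.snd_of_isPullback (.of_hasPullback b (a ≫ g)) hb.1
  have hfst : clopens τ (pullback.fst b (a ≫ g)) := by
    refine h.isClopos.of_comp_mono (f := b ≫ f) ?_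
    rw [reassoc_of% w]
    exact h.clopens_comp hs ha.2
  refine ⟨_, pullback.lift t k e, pullback.snd b (a ≫ g) ≫ a, ⟨?_, ?_⟩, pullback.lift_snd_assoc ..⟩
  · exact h.clopens_comp hs ha.1
  · rw [Category.assoc, ← w]
    exact h.clopens_comp hfst hb.1

theorem IsGluingPresite.clopens_of_etale_of_mono (h : IsGluingPresite.{u} τ) {X Y : C} {f : X ⟶ Y}
    (hf : etale τ f) [Mono f] : clopens τ f := by
  have := h.subcanonical
  let S : Presieve Y := fun W b => ∃ a : W ⟶ X, etaleSink τ f a ∧ a ≫ f = b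
  obtain ⟨Z, z, hz, hc, hl⟩ := h.exists_union (S := S) (by rintro W _ ⟨a, ha, rfl⟩; exact ha.2)
  have := h.mono_of_clopens hz
  obtain ⟨s, hs⟩ := exists_lift_of_mem z f hf (by
    rintro W _ ⟨_, b, a, ha, rfl⟩
    obtain ⟨l, hl⟩ := hl (a ≫ f) ⟨a, ha, rfl⟩
    exact ⟨b ≫ l, by simp [hl]⟩)
  obtain ⟨t, ht⟩ := exists_lift_of_mem f z hc (by
    rintro W k ⟨_, b, _, ⟨a, -, rfl⟩, e⟩
    exact ⟨b ≫ a, by simp [e]⟩)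
  have : IsIso s := ⟨t, by rw [← cancel_mono f]; simp [ht, hs],
    by rw [← cancel_mono z]; simp [ht, hs]⟩
  rw [← hs]
  exact h.clopens_comp (h.clopens_of_isIso _) hz

end Etale

section LocalPullbacks

variable {C : Type v} [Category.{w} C] {I : Type*} {U P : I → C}

theorem jointlyMono₂_of_ofArrows_mem {J : GrothendieckTopology C} [J.Subcanonical] {Q X Y : C}
    {π : ∀ i, P i ⟶ Q} (hπ : Sieve.ofArrows P π ∈ J Q) {x : Q ⟶ X} {y : Q ⟶ Y}
    (h : ∀ {i j : I} {T : C} (s : T ⟶ P i) (t : T ⟶ P j), s ≫ π i ≫ x = t ≫ π j ≫ x →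
      s ≫ π i ≫ y = t ≫ π j ≫ y → s ≫ π i = t ≫ π j) : JointlyMono₂ x y where
  right_cancellation _ s t hx hy := by
    refine hom_ext_of_mem (J.intersection_covering (J.pullback_stable s hπ)
      (J.pullback_stable t hπ)) ?_
    rintro W k ⟨⟨_, l, _, ⟨i⟩, el⟩, ⟨_, m, _, ⟨j⟩, em⟩⟩
    rw [← el, ← em]
    refine h l m ?_ ?_ <;> simp only [reassoc_of% el, reassoc_of% em, hx, hy]

theorem exists_isRepresentedBy_inf_ker {X Y Y' : C} {a : ∀ i, U i ⟶ X} {f : X ⟶ Y} {g : Y' ⟶ Y}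
    {r : ∀ i, P i ⟶ U i} {q : ∀ i, P i ⟶ Y'} (hP : ∀ i, IsPullback (r i) (q i) (a i ≫ f) g)
    {i j : I} {V : C} {v : V ⟶ P i} {l : V ⟶ U j} (H : IsPullback v l (r i ≫ a i) (a j)) :
    ∃ v' : V ⟶ P j,
      ((GluingRelation.ker fun i => r i ≫ a i).inf (.ker q)).IsRepresentedBy v v' := by
  have w : l ≫ a j ≫ f = (v ≫ q i) ≫ g := by
    rw [← H.w_assoc, Category.assoc, Category.assoc, (hP i).w]
  refine ⟨(hP j).lift l (v ≫ q i) w, ⟨?_, ((hP j).lift_snd ..).symm⟩, fun {T s t} e => ?_⟩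
  · change _ = _ ≫ r j ≫ a j
    rw [(hP j).lift_fst_assoc, H.w]
  · have e₁ : s ≫ r i ≫ a i = (t ≫ r j) ≫ a j :=
      e.1.trans (Category.assoc ..).symm
    refine ⟨H.lift s (t ≫ r j) e₁, H.lift_fst .., (hP j).hom_ext ?_ ?_⟩
    · rw [Category.assoc, (hP j).lift_fst, H.lift_snd]
    · rw [Category.assoc, (hP j).lift_snd, H.lift_fst_assoc]
      exact e.2

variable {τ : Precoverage C}

namespace IsGluingPresite

variable (h : IsGluingPresite.{u} τ)

include h

/-- The pullbacks over the members of the cover are glued along the relation of having the same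
components in `X` and in `Y'`. -/
theorem hasPullback_of_cover {X Y Y' : C} {f : X ⟶ Y} (g : Y' ⟶ Y) {S : Presieve X}
    (hS : SinkIn (clopens τ) S) (hc : Sieve.generate S ∈ τ.toGrothendieck X)
    (H : ∀ ⦃W : C⦄ (a : W ⟶ X), S a → HasPullback (a ≫ f) g) : HasPullback f g := by
  have := h.subcanonical
  obtain ⟨I, U, a, haS, e⟩ := h.exists_small_ofArrows h.ng1 hS
  rw [e] at hc
  have ha (i : I) : clopens τ (a i) := hS _ (haS i)
  have (i : I) := H _ (haS i)
  let r (i : I) := pullback.fst (a i ≫ f) g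
  let q (i : I) := pullback.snd (a i ≫ f) g
  have hP (i : I) : IsPullback (r i) (q i) (a i ≫ f) g := .of_hasPullback _ _
  obtain ⟨Q, π, -, hπ, hρ⟩ := h.exists_gluing
    ((GluingRelation.ker fun i => r i ≫ a i).inf (.ker q)) fun i j => by
      have := h.hasPullback_of_clopens (ha j) (r i ≫ a i)
      have H := (IsPullback.of_hasPullback (a j) (r i ≫ a i)).flip
      obtain ⟨v', hv'⟩ := exists_isRepresentedBy_inf_ker hP H
      exact ⟨_, _, v', h.isClopos.fst_of_isPullback H (ha j), hv'⟩
  obtain ⟨x, hx⟩ := exists_desc_of_ofArrows_mem hπ (fun i => r i ≫ a i)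
    fun i j W s t e => (hρ.comp_eq_comp_iff.1 e).1
  obtain ⟨y, hy⟩ := exists_desc_of_ofArrows_mem hπ q
    fun i j W s t e => (hρ.comp_eq_comp_iff.1 e).2
  have hxy : x ≫ f = y ≫ g := hom_ext_of_ofArrows_mem hπ fun i => by
    rw [reassoc_of% hx, reassoc_of% hy, (hP i).w]
  have hmono : JointlyMono₂ x y := jointlyMono₂_of_ofArrows_mem hπ fun s t ex ey =>
    hρ.comp_eq_comp_iff.2 ⟨by rwa [hx, hx] at ex, by rwa [hy, hy] at ey⟩
  refine (isPullback_of_jointlyMono hxy hmono fun T s t e =>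
    exists_jointLift_of_mem hmono (τ.toGrothendieck.pullback_stable s hc) ?_).hasPullback
  rintro W k ⟨_, l, _, ⟨i⟩, el⟩
  have w : l ≫ a i ≫ f = (k ≫ t) ≫ g := by rw [reassoc_of% el, e, Category.assoc]
  exact ⟨(hP i).lift l (k ≫ t) w ≫ π i, by rw [Category.assoc, hx, (hP i).lift_fst_assoc, el],
    by rw [Category.assoc, hy, (hP i).lift_snd]⟩

theorem hasPullback_of_etale {X Y Y' : C} {f : X ⟶ Y} (hf : etale τ f) (g : Y' ⟶ Y) :
    HasPullback f g :=
  h.hasPullback_of_cover g (fun _ _ ha => ha.1) hf fun _ _ ha => h.hasPullback_of_clopens ha.2 g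

theorem isClopos_etale : IsClopos (etale τ) where
  of_isIso _ _ f _ := h.etale_of_clopens (h.clopens_of_isIso f)
  hasPullbacks := ⟨fun g hf => h.hasPullback_of_etale hf g⟩
  isStableUnderComposition := ⟨fun _ _ hf hg => h.etale_comp hf hg⟩
  isStableUnderBaseChange := ⟨fun sq hg => h.etale_of_isPullback sq hg⟩

end IsGluingPresite

end LocalPullbacks

/-! ### Universal colimits -/

section Colimits

variable {C : Type v} [Category.{w} C] {J : GrothendieckTopology C} [J.Subcanonical]

theorem nonempty_isColimit_of_cover {K : Type*} [Category* K] {F : K ⥤ C} (c : Cocone F)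
    {I : Type*} (k : I → K)
    (hc : Sieve.ofArrows (fun i => F.obj (k i)) (fun i => c.ι.app (k i)) ∈ J c.pt)
    (H : ∀ (i j : I) (T : C) (a : T ⟶ F.obj (k i)) (b : T ⟶ F.obj (k j)),
      a ≫ c.ι.app (k i) = b ≫ c.ι.app (k j) → ⊥ ∈ J T ∨
        ∃ (l : K) (m : l ⟶ k i) (n : l ⟶ k j) (t : T ⟶ F.obj l), t ≫ F.map m = a ∧ t ≫ F.map n = b)
    (hK : ∀ l : K, ∃ i, Nonempty (l ⟶ k i)) : Nonempty (IsColimit c) := by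
  choose d hd using fun s : Cocone F => exists_desc_of_ofArrows_mem hc (fun i => s.ι.app (k i))
    fun i j T a b e => by
      obtain hT | ⟨l, m, n, t, rfl, rfl⟩ := H i j T a b e
      · exact hom_ext_of_bot_mem hT _ _
      · simp
  refine ⟨⟨d, fun s l => ?_, fun s m hm => ?_⟩⟩
  · obtain ⟨i, ⟨m⟩⟩ := hK l
    rw [← c.w m, Category.assoc, hd, s.w]
  · exact hom_ext_of_ofArrows_mem hc fun i => by rw [hm, hd]

theorem isUniversalColimit_of_cover {K : Type*} [Category* K] {F : K ⥤ C} (c : Cocone F)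
    {I : Type*} (k : I → K)
    (hc : Sieve.ofArrows (fun i => F.obj (k i)) (fun i => c.ι.app (k i)) ∈ J c.pt)
    (H : ∀ (i j : I) (T : C) (a : T ⟶ F.obj (k i)) (b : T ⟶ F.obj (k j)),
      a ≫ c.ι.app (k i) = b ≫ c.ι.app (k j) → ⊥ ∈ J T ∨
        ∃ (l : K) (m : l ⟶ k i) (n : l ⟶ k j) (t : T ⟶ F.obj l), t ≫ F.map m = a ∧ t ≫ F.map n = b)
    (hK : ∀ l : K, ∃ i, Nonempty (l ⟶ k i)) : IsUniversalColimit c := by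
  intro F' c' α f hw _ hp
  have hw' (l : K) : α.app l ≫ c.ι.app l = c'.ι.app l ≫ f := congr_app hw l
  refine nonempty_isColimit_of_cover c' k (ofArrows_mem_of_isPullback hc f
    (fun i => c'.ι.app (k i)) (fun i => α.app (k i)) fun i => hp (k i)) ?_ hK
  intro i j T a b e
  obtain hT | ⟨l, m, n, t, ha, hb⟩ := H i j T (a ≫ α.app _) (b ≫ α.app _) (by
    rw [Category.assoc, Category.assoc, hw', hw', reassoc_of% e])
  · exact .inl hT
  have e' : (a ≫ c'.ι.app (k i)) ≫ f = t ≫ c.ι.app l := by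
    rw [Category.assoc, ← hw', ← Category.assoc, ← ha, Category.assoc, c.w]
  refine .inr ⟨l, m, n, (hp l).lift _ _ e', (hp (k i)).hom_ext ?_ ?_, (hp (k j)).hom_ext ?_ ?_⟩
  · rw [Category.assoc, c'.w, (hp l).lift_fst]
  · rw [Category.assoc, α.naturality, (hp l).lift_snd_assoc, ha]
  · rw [Category.assoc, c'.w, (hp l).lift_fst, e]
  · rw [Category.assoc, α.naturality, (hp l).lift_snd_assoc, hb]

theorem isUniversalColimit_cofan {I : Type*} {U : I → C} {Q : C} {π : ∀ i, U i ⟶ Q}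
    [∀ i, Mono (π i)] (hQ : Sieve.ofArrows U π ∈ J Q)
    (hd : ∀ i j T (a : T ⟶ U i) (b : T ⟶ U j), i ≠ j → a ≫ π i = b ≫ π j → ⊥ ∈ J T) :
    IsUniversalColimit (Cofan.mk Q π) := by
  refine isUniversalColimit_of_cover (Cofan.mk Q π) (fun i : I => (⟨i⟩ : Discrete I)) hQ
    (fun i j T a b e => ?_) fun l => ⟨l.as, ⟨𝟙 _⟩⟩
  obtain rfl | hij := eq_or_ne i j
  · have e' : a = b := (cancel_mono (π i)).1 e
    exact .inr ⟨⟨i⟩, 𝟙 _, 𝟙 _, a, by simp, by simp [e']⟩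
  · exact .inl (hd i j T a b hij e)

theorem isUniversalColimit_cofork {R X Q : C} {u v : R ⟶ X} {q : X ⟶ Q} (H : IsKernelPair q u v)
    (hq : Sieve.ofArrows (fun _ : Unit => X) (fun _ => q) ∈ J Q) :
    IsUniversalColimit (Cofork.ofπ q H.w) := by
  refine isUniversalColimit_of_cover (J := J) _ (fun _ : Unit => WalkingParallelPair.one) hq
    (fun _ _ T s t e => .inr ⟨.zero, .left, .right, H.lift s t e, H.lift_fst .., H.lift_snd ..⟩) ?_
  rintro (_ | _)
  · exact ⟨(), ⟨.left⟩⟩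
  · exact ⟨(), ⟨𝟙 _⟩⟩

end Colimits

section Coproducts

variable {C : Type v} [Category.{w} C]

/-- The gluing relation of a disjoint union: generalized elements of objects with different indices
are identified only on objects covered by the empty sieve. -/
def GluingRelation.disjoint (J : GrothendieckTopology C) {I : Type*} (U : I → C) :
    GluingRelation U where
  rel {i j T} a b := (∃ e : i = j, a ≫ eqToHom (congrArg U e) = b) ∨ ⊥ ∈ J T
  refl a := .inl ⟨rfl, by simp⟩
  symm := by
    rintro i j T a b (⟨rfl, rfl⟩ | hT)
    · exact .inl ⟨rfl, by simp⟩
    · exact .inr hT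
  trans := by
    rintro i j k T a b c (⟨rfl, rfl⟩ | hT) (⟨rfl, rfl⟩ | hT')
    · exact .inl ⟨rfl, by simp⟩
    · exact .inr hT'
    · exact .inr hT
    · exact .inr hT
  precomp := by
    rintro i j T T' t a b (⟨rfl, rfl⟩ | hT)
    · exact .inl ⟨rfl, by simp⟩
    · exact .inr (bot_mem_of_hom t hT)

namespace GluingRelation

variable {J : GrothendieckTopology C} {I : Type*} {U : I → C}

theorem disjoint_isRepresentedBy_id [J.Subcanonical] (i : I) :
    (disjoint J U).IsRepresentedBy (𝟙 (U i)) (𝟙 (U i)) where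
  rel := .inl ⟨rfl, by simp⟩
  exists_lift := by
    rintro T a b (⟨_, rfl⟩ | hT)
    · exact ⟨a, by simp, by simp⟩
    · exact ⟨a, by simp, hom_ext_of_bot_mem hT _ _⟩

theorem disjoint_isRepresentedBy_of_ne [J.Subcanonical] {i j : I} (hij : i ≠ j) {V : C}
    (hV : ⊥ ∈ J V) (p : V ⟶ U i) (q : V ⟶ U j) : (disjoint J U).IsRepresentedBy p q where
  rel := .inr hV
  exists_lift := by
    rintro T a b (⟨e, -⟩ | hT)
    · exact (hij e).elim
    · exact ⟨(nonempty_isInitial_of_bot_mem hT).some.to _, hom_ext_of_bot_mem hT _ _,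
        hom_ext_of_bot_mem hT _ _⟩

theorem bot_mem_of_disjoint {i j : I} (hij : i ≠ j) {T : C} {a : T ⟶ U i} {b : T ⟶ U j}
    (h : (disjoint J U).rel a b) : ⊥ ∈ J T :=
  h.resolve_left fun ⟨e, _⟩ => hij e

end GluingRelation

theorem IsGluingPresite.exists_coproduct {τ : Precoverage C} (h : IsGluingPresite.{u} τ)
    {I : Type u} (U : I → C) : ∃ (Q : C) (π : ∀ i, U i ⟶ Q), (∀ i, clopens τ (π i)) ∧
      Sieve.ofArrows U π ∈ τ.toGrothendieck Q ∧
      ∀ i j T (a : T ⟶ U i) (b : T ⟶ U j), i ≠ j → a ≫ π i = b ≫ π j →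
        ⊥ ∈ τ.toGrothendieck T := by
  have := h.subcanonical
  obtain ⟨Q, π, hπ, hQ, hρ⟩ := h.exists_gluing (.disjoint τ.toGrothendieck U) fun i j => by
    obtain rfl | hij := eq_or_ne i j
    · exact ⟨U i, 𝟙 _, 𝟙 _, h.clopens_of_isIso _, GluingRelation.disjoint_isRepresentedBy_id i⟩
    · obtain ⟨V, p, hp, hV⟩ := h.exists_bot_mem (U i)
      exact ⟨V, p, (nonempty_isInitial_of_bot_mem hV).some.to _, hp,
        GluingRelation.disjoint_isRepresentedBy_of_ne hij hV _ _⟩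
  exact ⟨Q, π, hπ, hQ, fun i j T a b hij e =>
    GluingRelation.bot_mem_of_disjoint hij (hρ.comp_eq_comp_iff.1 e)⟩

end Coproducts

/-! ### Étale epimorphisms and quotients -/

section Quotients

variable {C : Type v} [Category.{w} C]

theorem isKernelPair_of_ofArrows_mem {J : GrothendieckTopology C} [J.Subcanonical] {R X Q : C}
    {u v : R ⟶ X} (huv : JointlyMono₂ u v) {q : X ⟶ Q} {I : Type*} {V : I → C} {a : ∀ i, V i ⟶ X}
    (ha : Sieve.ofArrows V a ∈ J X)
    (H : ∀ {i j : I} {T : C} (x : T ⟶ V i) (y : T ⟶ V j), x ≫ a i ≫ q = y ≫ a j ≫ q ↔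
      ∃ r : T ⟶ R, r ≫ u = x ≫ a i ∧ r ≫ v = y ≫ a j) : IsKernelPair q u v := by
  have hloc {T : C} (s t : T ⟶ X) :
      (Sieve.ofArrows V a).pullback s ⊓ (Sieve.ofArrows V a).pullback t ∈ J T :=
    J.intersection_covering (J.pullback_stable s ha) (J.pullback_stable t ha)
  refine isPullback_of_jointlyMono (hom_ext_of_mem (hloc u v) ?_) huv fun T s t e =>
    exists_jointLift_of_mem huv (hloc s t) ?_
  · rintro T k ⟨⟨_, x, _, ⟨i⟩, ex⟩, ⟨_, y, _, ⟨j⟩, ey⟩⟩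
    rw [← reassoc_of% ex, ← reassoc_of% ey]
    exact (H x y).2 ⟨k, ex.symm, ey.symm⟩
  · rintro W k ⟨⟨_, x, _, ⟨i⟩, ex⟩, ⟨_, y, _, ⟨j⟩, ey⟩⟩
    rw [← ex, ← ey]
    exact (H x y).1 (by rw [reassoc_of% ex, reassoc_of% ey, e])

/-- The relation induced on a family of objects over `X` by an equivalence relation on `X`. -/
def GluingRelation.ofEquivalenceRelation {R X : C} {u v : R ⟶ X} (hE : IsEquivalenceRelation u v)
    {I : Type*} {V : I → C} (a : ∀ i, V i ⟶ X) : GluingRelation V where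
  rel {i j T} x y := ∃ r : T ⟶ R, r ≫ u = x ≫ a i ∧ r ≫ v = y ≫ a j
  refl {i T} x := by
    obtain ⟨⟨E⟩⟩ := hE
    exact ⟨x ≫ a i ≫ E.r, by simp [E.reflexivity₁], by simp [E.reflexivity₂]⟩
  symm := by
    rintro i j T x y ⟨r, hu, hv⟩
    obtain ⟨⟨E⟩⟩ := hE
    exact ⟨r ≫ E.s, by simp [E.symmetry₁, hv], by simp [E.symmetry₂, hu]⟩
  trans := by
    rintro i j k T x y z ⟨r, hu, hv⟩ ⟨r', hu', hv'⟩
    obtain ⟨⟨E⟩⟩ := hE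
    obtain ⟨l, l₁, l₂⟩ := PullbackCone.IsLimit.lift' E.isLimit r r' (hv.trans hu'.symm)
    exact ⟨l ≫ E.t, by rw [Category.assoc, E.transitivity₁, reassoc_of% l₁, hu],
      by rw [Category.assoc, E.transitivity₂, reassoc_of% l₂, hv']⟩
  precomp := by
    rintro i j T T' t x y ⟨r, hu, hv⟩
    exact ⟨t ≫ r, by simp [hu], by simp [hv]⟩

/-- The clopen subobjects on which the relation given by the pair `u, v` is trivial. -/
def separatedClopens (τ : Precoverage C) {R X : C} (u v : R ⟶ X) : Presieve X :=
  fun V a => clopens τ a ∧ ∀ (T : C) (r : T ⟶ R) (s t : T ⟶ V),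
    r ≫ u = s ≫ a → r ≫ v = t ≫ a → s = t

variable {τ : Precoverage C}

namespace IsGluingPresite

variable (h : IsGluingPresite.{u} τ)

include h

theorem generate_mem_of_isEpiSink {X : C} {S : Presieve X} (hS : SinkIn (etale τ) S)
    (he : IsEpiSink S) : Sieve.generate S ∈ τ.toGrothendieck X := by
  have := h.subcanonical
  let S' : Presieve X := fun W a => ∃ (Y : C) (f : Y ⟶ X) (b : W ⟶ Y),
    S f ∧ etaleSink τ f b ∧ b ≫ f = a
  have hS' : SinkIn (clopens τ) S' := by
    rintro W _ ⟨Y, f, b, -, hb, rfl⟩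
    exact hb.2
  refine τ.toGrothendieck.superset_covering ?_ ((h.mem_iff_generate_mem hS').1
    (h.ng3 X S' hS' fun Z x y hxy => he x y fun Y f hf =>
      isEpiSink_of_generate_mem (hS f hf) _ _ fun W b hb => ?_))
  · rw [Sieve.generate_le_iff]
    rintro W _ ⟨Y, f, b, hf, -, rfl⟩
    exact ⟨Y, b, f, hf, rfl⟩
  · simpa using hxy (b ≫ f) ⟨Y, f, b, hf, hb, rfl⟩

theorem generate_singleton_mem {X Y : C} {f : X ⟶ Y} (hf : etale τ f) [Epi f] :
    Sieve.generate (Presieve.singleton f) ∈ τ.toGrothendieck Y :=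
  h.generate_mem_of_isEpiSink (fun _ _ ⟨⟩ => hf) fun _ _ _ H => (cancel_epi f).1 (H f ⟨⟩)

theorem effectiveEpi_of_etale {X Y : C} {f : X ⟶ Y} (hf : etale τ f) [Epi f] : EffectiveEpi f := by
  have := h.subcanonical
  rw [← Sieve.effectiveEpimorphic_singleton,
    Presieve.EffectiveEpimorphic.iff_forall_isSheafFor_yoneda]
  intro T
  rw [Presieve.isSheafFor_iff_generate]
  exact GrothendieckTopology.Subcanonical.isSheaf_of_isRepresentable (J := τ.toGrothendieck)
    (yoneda.obj T) _ (h.generate_singleton_mem hf)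

theorem generate_clopen_sections_mem {X Y : C} {p : X ⟶ Y} (hp : etale τ p) [Epi p] :
    Sieve.generate (fun W b => ∃ a : W ⟶ X, etaleSink τ p a ∧ a ≫ p = b : Presieve Y) ∈
      τ.toGrothendieck Y := by
  refine mem_of_generate_mem (h.generate_singleton_mem hp) ?_
  rintro _ _ ⟨⟩
  refine τ.toGrothendieck.superset_covering ?_ hp
  rw [Sieve.generate_le_iff]
  intro W a ha
  exact ⟨W, 𝟙 _, a ≫ p, ⟨a, ha, rfl⟩, Category.id_comp _⟩

theorem etale_of_precomp {X Y Z : C} {p : X ⟶ Y} {f : Y ⟶ Z} (hpf : etale τ (p ≫ f))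
    (hp : etale τ p) [Epi p] : etale τ f := by
  refine h.etale_of_cover ?_ (h.generate_clopen_sections_mem hp) ?_
  · rintro W _ ⟨a, ha, rfl⟩
    exact ha.2
  · rintro W _ ⟨a, ha, rfl⟩
    rw [Category.assoc]
    exact h.etale_comp (h.etale_of_clopens ha.1) hpf

theorem hasPullback_of_epi {X R S Y : C} {r : X ⟶ R} {g : R ⟶ S} {f : Y ⟶ S} (hr : etale τ r)
    [Epi r] [HasPullback (r ≫ g) f] : HasPullback g f := by
  refine h.hasPullback_of_cover f ?_ (h.generate_clopen_sections_mem hr) ?_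
  · rintro W _ ⟨a, ha, rfl⟩
    exact ha.2
  · rintro W _ ⟨a, ha, rfl⟩
    have := h.hasPullback_of_clopens ha.1 (pullback.fst (r ≫ g) f)
    have := ((IsPullback.of_hasPullback a (pullback.fst (r ≫ g) f)).flip.paste_horiz
      (IsPullback.of_hasPullback (r ≫ g) f).flip).flip
    rw [Category.assoc]
    exact this.hasPullback

theorem generate_separatedClopens_mem {R X : C} {u v : R ⟶ X}
    (hl : LocallyOCoequalizable (etale τ) u v) :
    Sieve.generate (separatedClopens τ u v) ∈ τ.toGrothendieck X := by
  obtain ⟨S, hS, hSe, hSl⟩ := hl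
  refine mem_of_generate_mem (h.generate_mem_of_isEpiSink hS hSe) fun X' f hf => ?_
  obtain ⟨R', u', v', ⟨R₀, R₁, a₀, b₀, b₁, a₁, c₀, c₁, H₀, H₁, H₂, rfl, rfl⟩, Q', q', hq', e⟩ :=
    hSl f hf
  refine τ.toGrothendieck.superset_covering ?_
    (τ.toGrothendieck.intersection_covering (hS f hf) hq')
  rintro V k ⟨⟨V₁, k₁, g₁, hg₁, e₁⟩, ⟨V₂, k₂, g₂, hg₂, e₂⟩⟩
  have := h.hasPullback_of_clopens hg₁.1 g₂
  have H := IsPullback.of_hasPullback g₁ g₂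
  have hfst : clopens τ (pullback.fst g₁ g₂) := h.isClopos.fst_of_isPullback H hg₂.1
  have hsnd : clopens τ (pullback.snd g₁ g₂) := h.isClopos.snd_of_isPullback H hg₁.1
  refine ⟨_, pullback.lift k₁ k₂ (e₁.trans e₂.symm), pullback.snd g₁ g₂ ≫ g₂ ≫ f, ⟨?_, ?_⟩, ?_⟩
  · rw [← pullback.condition_assoc]
    exact h.clopens_comp hfst hg₁.2
  · intro T r s t hs ht
    have hr₀ : (s ≫ pullback.snd g₁ g₂ ≫ g₂) ≫ f = r ≫ u := by simp [hs]
    have hr₁ : r ≫ v = (t ≫ pullback.snd g₁ g₂ ≫ g₂) ≫ f := by simp [ht]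
    have hr₂ : H₀.lift _ _ hr₀ ≫ b₀ = H₁.lift _ _ hr₁ ≫ b₁ := by simp
    have := h.mono_of_clopens hsnd
    have := h.mono_of_clopens hg₂.2
    rw [← cancel_mono (pullback.snd g₁ g₂), ← cancel_mono (g₂ ≫ q')]
    simpa using congrArg (H₂.lift _ _ hr₂ ≫ ·) e
  · rw [pullback.lift_snd_assoc, reassoc_of% e₂]

theorem exists_isRepresentedBy_ofEquivalenceRelation {R X : C} {u v : R ⟶ X}
    (hE : IsEquivalenceRelation u v) (hu : etale τ u) {I : Type*} {V : I → C} {a : ∀ i, V i ⟶ X}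
    (ha : ∀ i, separatedClopens τ u v (a i)) (i j : I) :
    ∃ (W : C) (p : W ⟶ V i) (q : W ⟶ V j), clopens τ p ∧
      (GluingRelation.ofEquivalenceRelation hE a).IsRepresentedBy p q := by
  have hj : JointlyMono₂ u v := let ⟨⟨E⟩⟩ := hE; E.toJointlyMono₂
  have := h.hasPullback_of_clopens (ha i).1 u
  obtain ⟨B, x, r, H₁⟩ : ∃ (B : C) (x : B ⟶ V i) (r : B ⟶ R), IsPullback x r (a i) u :=
    ⟨_, _, _, .of_hasPullback (a i) u⟩
  have := h.hasPullback_of_clopens (ha j).1 (r ≫ v)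
  obtain ⟨W, y, z, H₂⟩ : ∃ (W : C) (y : W ⟶ V j) (z : W ⟶ B), IsPullback y z (a j) (r ≫ v) :=
    ⟨_, _, _, .of_hasPullback (a j) (r ≫ v)⟩
  let ρ := GluingRelation.ofEquivalenceRelation hE a
  have hrel : ρ.rel (z ≫ x) y := ⟨z ≫ r, by simp [H₁.w], by simp [H₂.w]⟩
  have hmono : Mono (z ≫ x) := ⟨fun {T} s t e => by
    have e' : (s ≫ z) ≫ x = (t ≫ z) ≫ x := by simpa using e
    obtain ⟨k, hk, hk'⟩ := ρ.trans (ρ.symm (ρ.precomp s hrel)) (by rw [e]; exact ρ.precomp t hrel)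
    have ey : s ≫ y = t ≫ y := (ha j).2 T k _ _ hk hk'
    refine H₂.hom_ext ey (H₁.hom_ext e' (hj.right_cancellation _ _ ?_ ?_))
    · simpa only [Category.assoc, H₁.w] using congrArg (· ≫ a i) e'
    · simpa only [Category.assoc, H₂.w] using congrArg (· ≫ a j) ey⟩
  refine ⟨W, z ≫ x, y, ?_, hrel, fun {T s t} hst => ?_⟩
  · exact h.clopens_of_etale_of_mono (h.etale_comp (h.etale_of_clopens
      (h.isClopos.snd_of_isPullback H₂ (ha j).1)) (h.etale_of_isPullback H₁.flip hu))
  · obtain ⟨k, hk, hk'⟩ := hst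
    exact ⟨H₂.lift t (H₁.lift s k hk.symm) (by simp [hk']), by simp, by simp⟩

theorem exists_quotient {R X : C} {u v : R ⟶ X} (hE : IsEquivalenceRelation u v) (hu : etale τ u)
    (hl : LocallyOCoequalizable (etale τ) u v) :
    ∃ (Q : C) (q : X ⟶ Q) (hq : u ≫ q = v ≫ q), etale τ q ∧ IsKernelPair q u v ∧
      IsUniversalColimit (Cofork.ofπ q hq) := by
  have := h.subcanonical
  obtain ⟨I, V, a, ha, e⟩ := h.exists_small_ofArrows h.ng1
    (S := separatedClopens τ u v) fun _ _ ha => ha.1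
  have hX := h.generate_separatedClopens_mem hl
  rw [e] at hX
  obtain ⟨Q, π, hπ, hQ, hρ⟩ := h.exists_gluing (.ofEquivalenceRelation hE a)
    (h.exists_isRepresentedBy_ofEquivalenceRelation hE hu ha)
  obtain ⟨q, hq⟩ := exists_desc_of_ofArrows_mem hX π fun i j W x y e => by
    obtain ⟨⟨E⟩⟩ := hE
    exact hρ.comp_eq_comp_iff.2
      ⟨x ≫ a i ≫ E.r, by simp [E.reflexivity₁], by simpa [E.reflexivity₂] using e⟩
  have hq_etale : etale τ q := h.etale_of_cover (S := Presieve.ofArrows V a)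
    (fun _ _ ⟨i⟩ => (ha i).1) hX fun _ _ ⟨i⟩ => by
      rw [hq]
      exact h.etale_of_clopens (hπ i)
  have hq_ker : IsKernelPair q u v := isKernelPair_of_ofArrows_mem
    (let ⟨⟨E⟩⟩ := hE; E.toJointlyMono₂) hX fun {i j T} x y => by
      rw [hq, hq]
      exact hρ.comp_eq_comp_iff
  refine ⟨Q, q, hq_ker.w, hq_etale, hq_ker, isUniversalColimit_cofork (J := τ.toGrothendieck)
    hq_ker (τ.toGrothendieck.superset_covering ?_ hQ)⟩
  rw [Sieve.generate_le_iff]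
  rintro _ _ ⟨i⟩
  exact (Sieve.mem_ofArrows_iff _ _ _).2 ⟨(), a i, (hq i).symm⟩

end IsGluingPresite

end Quotients

/-! ### The site of clopen subobjects -/

section ClopenBases

variable {C : Type v} [Category.{w} C]

/-- A `u`-small family of clopen subobjects of `X` containing all of them up to isomorphism. -/
structure ClopenBasis (τ : Precoverage C) (X : C) where
  S : Type u
  obj : S → Over X
  clopen : ∀ s, clopens τ (obj s).hom
  mono : ∀ s, Mono (obj s).hom
  exists_iso : ∀ V : Over X, clopens τ V.hom → ∃ s, Nonempty (V ≅ obj s)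

variable {τ : Precoverage C} {X : C}

theorem IsMPresite.nonempty_clopenBasis (h : IsMPresite τ) (h1 : NG1.{u} τ) (X : C) :
    Nonempty (ClopenBasis.{u} τ X) := by
  have := h1 X
  refine ⟨{
    S := Shrink.{u} {A : Subobject X // clopens τ A.arrow}
    obj s := Over.mk ((equivShrink _).symm s).1.arrow
    clopen s := ((equivShrink _).symm s).2
    mono s := inferInstanceAs (Mono ((equivShrink _).symm s).1.arrow)
    exists_iso V hV := ?_ }⟩
  have := h.mono_of_clopens hV
  refine ⟨equivShrink _ ⟨Subobject.mk V.hom, h.clopens_subobjectMk_arrow hV⟩, ?_⟩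
  rw [Equiv.symm_apply_apply]
  exact ⟨Over.isoMk (Subobject.underlyingIso V.hom).symm (by simp)⟩

namespace ClopenBasis

instance (B : ClopenBasis.{u} τ X) : Preorder B.S where
  le s t := Nonempty (B.obj s ⟶ B.obj t)
  le_refl s := ⟨𝟙 _⟩
  le_trans _ _ _ := fun ⟨a⟩ ⟨b⟩ => ⟨a ≫ b⟩

variable (B : ClopenBasis.{u} τ X)

instance (s : B.S) : Mono (B.obj s).hom := B.mono s

instance (V : Over X) (s : B.S) : Subsingleton (V ⟶ B.obj s) :=
  ⟨fun a b => Over.OverMorphism.ext <| by simp [← cancel_mono (B.obj s).hom]⟩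

/-- The inclusion of the site of clopen subobjects of `X` into the category of objects over `X`. -/
noncomputable abbrev toOver : B.S ⥤ Over X where
  obj := B.obj
  map g := g.le.some

/-- The inclusion of the site of clopen subobjects of `X` into the ambient category. -/
noncomputable abbrev forget : B.S ⥤ C where
  obj s := (B.obj s).left
  map g := (B.toOver.map g).left
  map_id s := congrArg Over.Hom.left (B.toOver.map_id s)
  map_comp f g := congrArg Over.Hom.left (B.toOver.map_comp f g)

theorem left_eq_forget_map {s t : B.S} (a : B.obj s ⟶ B.obj t) (g : s ⟶ t) :
    a.left = B.forget.map g :=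
  congrArg Over.Hom.left (Subsingleton.elim a (B.toOver.map g))

theorem exists_hom (V : Over X) (hV : clopens τ V.hom) {W : Over X} (a : V ⟶ W) :
    ∃ (s : B.S) (e : V ≅ B.obj s) (b : B.obj s ⟶ W), e.hom ≫ b = a := by
  obtain ⟨s, ⟨e⟩⟩ := B.exists_iso V hV
  exact ⟨s, e, e.inv ≫ a, e.hom_inv_id_assoc a⟩

theorem sections_mem {W : Over X} (hW : etale τ W.hom) :
    Sieve.ofArrows (fun x : Σ s : B.S, B.obj s ⟶ W => (B.obj x.1).left) (fun x => x.2.left) ∈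
      τ.toGrothendieck W.left := by
  refine τ.toGrothendieck.superset_covering ?_ hW
  rw [Sieve.generate_le_iff]
  rintro V a ha
  obtain ⟨s, e, b, he⟩ := B.exists_hom (Over.mk (a ≫ W.hom)) ha.2 (Over.homMk a)
  exact (Sieve.mem_ofArrows_iff _ _ _).2 ⟨⟨s, b⟩, e.hom.left, congrArg Over.Hom.left he.symm⟩

variable (h : IsGluingPresite.{u} τ)

include h

theorem clopen_section {W : Over X} (hW : etale τ W.hom) {s : B.S} (a : B.obj s ⟶ W) :
    clopens τ a.left := by
  have : Mono (a.left ≫ W.hom) := by rw [Over.w]; infer_instance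
  have := mono_of_mono a.left W.hom
  refine h.clopens_of_etale_of_mono (h.etale_of_postcomp (f := W.hom) ?_ hW)
  rw [Over.w]
  exact h.etale_of_clopens (B.clopen s)

theorem exists_isPullback {W : Over X} (hW : etale τ W.hom) {s t : B.S} (a : B.obj s ⟶ W)
    (b : B.obj t ⟶ W) : ∃ (r : B.S) (g : r ⟶ s) (k : r ⟶ t),
      IsPullback (B.forget.map g) (B.forget.map k) a.left b.left := by
  have ha := B.clopen_section h hW a
  have := h.hasPullback_of_clopens ha b.left
  have H := IsPullback.of_hasPullback a.left b.left
  have hp := h.isClopos.fst_of_isPullback H (B.clopen_section h hW b)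
  obtain ⟨r, ⟨e⟩⟩ := B.exists_iso (Over.mk (pullback.fst a.left b.left ≫ (B.obj s).hom))
    (h.clopens_comp hp (B.clopen s))
  let a' : B.obj r ⟶ B.obj s := e.inv ≫ Over.homMk (pullback.fst a.left b.left)
  let b' : B.obj r ⟶ B.obj t := e.inv ≫ Over.homMk (pullback.snd a.left b.left) (by
    simp only [Over.mk_hom]
    rw [← Over.w a, ← Over.w b, pullback.condition_assoc])
  refine ⟨r, homOfLE ⟨a'⟩, homOfLE ⟨b'⟩, ?_⟩
  rw [← B.left_eq_forget_map a', ← B.left_eq_forget_map b']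
  exact H.of_iso ((Over.forget X).mapIso e) (Iso.refl _) (Iso.refl _) (Iso.refl _)
    (by simp [a']) (by simp [b']) (by simp) (by simp)

theorem exists_isPullback_map {s t r : B.S} (g : s ⟶ r) (k : t ⟶ r) :
    ∃ (q : B.S) (g' : q ⟶ s) (k' : q ⟶ t),
      IsPullback (B.forget.map g') (B.forget.map k') (B.forget.map g) (B.forget.map k) :=
  B.exists_isPullback h (h.etale_of_clopens (B.clopen r)) (B.toOver.map g) (B.toOver.map k)

/-- The topology on the poset of clopen subobjects of `X`: a sieve is covering if the inclusions
belonging to it generate a covering sieve in the ambient category. -/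
def topology : GrothendieckTopology B.S where
  sieves s := {R | R.functorPushforward B.forget ∈ τ.toGrothendieck (B.obj s).left}
  top_mem' s := by
    rw [Set.mem_ofPred, Sieve.functorPushforward_top]
    exact τ.toGrothendieck.top_mem _
  pullback_stable' s t R f hR := by
    refine τ.toGrothendieck.superset_covering ?_
      (τ.toGrothendieck.pullback_stable (B.forget.map f) hR)
    rintro W k ⟨r, g, m, hg, e⟩
    obtain ⟨q, g', k', H⟩ := B.exists_isPullback_map h g f
    refine ⟨q, k', H.lift m k e.symm, ?_, (H.lift_snd ..).symm⟩
    have w : k' ≫ f = g' ≫ g := Subsingleton.elim _ _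
    rw [Sieve.pullback_apply, w]
    exact R.downward_closed hg g'
  transitive' s R hR R' H := by
    refine τ.toGrothendieck.transitive hR _ ?_
    rintro W _ ⟨r, f, m, hf, rfl⟩
    rw [Sieve.pullback_comp]
    refine τ.toGrothendieck.pullback_stable m (τ.toGrothendieck.superset_covering ?_ (H hf))
    rintro V _ ⟨q, g, l, hg, rfl⟩
    exact ⟨q, g ≫ f, l, hg, by rw [Functor.map_comp, Category.assoc]⟩

end ClopenBasis

end ClopenBases

section BaseChanges

open Opposite

variable {C : Type v} [Category.{w} C] {τ : Precoverage C} {X : C}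

/-- A functorial choice of inverse images along `f` of the members of a basis of clopen
subobjects. -/
structure BaseChange (B : ClopenBasis.{u} τ X) {X' : C} (f : X' ⟶ X) where
  functor : B.S ⥤ Over X'
  proj : ∀ s, (functor.obj s).left ⟶ (B.obj s).left
  isPullback : ∀ s, IsPullback (proj s) (functor.obj s).hom (B.obj s).hom f

namespace BaseChange

/-- The inverse image along the identity. -/
noncomputable abbrev id (B : ClopenBasis.{u} τ X) : BaseChange B (𝟙 X) where
  functor := B.toOver
  proj _ := 𝟙 _
  isPullback s := IsPullback.id_horiz (B.obj s).hom

theorem nonempty (h : IsPresite τ) (B : ClopenBasis.{u} τ X) {X' : C} (f : X' ⟶ X) :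
    Nonempty (BaseChange B f) := by
  have (s : B.S) := h.hasPullback_of_clopens (B.clopen s) f
  have H (s : B.S) := IsPullback.of_hasPullback (B.obj s).hom f
  let m {s t : B.S} (g : s ⟶ t) := (H t).lift (pullback.fst _ _ ≫ B.forget.map g)
    (pullback.snd (B.obj s).hom f) (by simp [pullback.condition])
  have hm {s t : B.S} (g : s ⟶ t) : m g ≫ pullback.snd (B.obj t).hom f = pullback.snd _ _ :=
    (H t).lift_snd ..
  exact ⟨{
    functor :=
      { obj s := Over.mk (pullback.snd (B.obj s).hom f)
        map g := Over.homMk (m g) (hm g)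
        map_id s := by ext1; simp [← cancel_mono (pullback.snd (B.obj s).hom f), hm]
        map_comp {_ _ t} g k := by ext1; simp [← cancel_mono (pullback.snd (B.obj t).hom f), hm] }
    proj s := pullback.fst _ _
    isPullback := H }⟩

variable {B : ClopenBasis.{u} τ X} {X' : C} {f : X' ⟶ X} (D : BaseChange B f)

theorem map_left_proj {s t : B.S} (g : s ⟶ t) :
    (D.functor.map g).left ≫ D.proj t = D.proj s ≫ B.forget.map g := by
  rw [← cancel_mono (B.obj t).hom, Category.assoc, Category.assoc, (D.isPullback t).w, Over.w,
    Over.w_assoc, (D.isPullback s).w]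

section Lift

variable {W : Over X} {W' : Over X'} {q : W'.left ⟶ W.left} (H : IsPullback q W'.hom W.hom f)

include H in
theorem hom_ext_left {V : Over X'} {a b : V ⟶ W'} (w : a.left ≫ q = b.left ≫ q) : a = b :=
  Over.OverMorphism.ext <| H.hom_ext w <| (Over.w a).trans (Over.w b).symm

/-- The inverse image of a section. -/
noncomputable def lift {s : B.S} (a : B.obj s ⟶ W) : D.functor.obj s ⟶ W' :=
  Over.homMk (H.lift (D.proj s ≫ a.left) (D.functor.obj s).hom (by
    rw [Category.assoc, Over.w, (D.isPullback s).w])) (H.lift_snd ..)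

theorem lift_left_comp {s : B.S} (a : B.obj s ⟶ W) :
    (D.lift H a).left ≫ q = D.proj s ≫ a.left :=
  H.lift_fst ..

theorem map_comp_lift {s t : B.S} (g : s ⟶ t) (a : B.obj t ⟶ W) :
    D.functor.map g ≫ D.lift H a = D.lift H (B.toOver.map g ≫ a) :=
  hom_ext_left H <| by
    rw [Over.comp_left, Category.assoc, lift_left_comp, lift_left_comp, ← Category.assoc,
      map_left_proj, Category.assoc, Over.comp_left]

theorem lift_isPullback_map {s t : B.S} (g : s ⟶ t) :
    D.lift (D.isPullback t) (B.toOver.map g) = D.functor.map g :=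
  hom_ext_left (D.isPullback t) <| by rw [lift_left_comp, map_left_proj]

theorem isPullback_lift {s : B.S} (a : B.obj s ⟶ W) :
    IsPullback (D.lift H a).left (D.proj s) q a.left := by
  refine .of_right (h₁₂ := W'.hom) (h₂₂ := W.hom) (v₁₃ := f) ?_ (D.lift_left_comp H a) H.flip
  rw [Over.w, Over.w]
  exact (D.isPullback s).flip

theorem isPullback_lift_lift {r s t : B.S} {g : r ⟶ s} {k : r ⟶ t} {a : B.obj s ⟶ W}
    {b : B.obj t ⟶ W} (P : IsPullback (B.forget.map g) (B.forget.map k) a.left b.left) :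
    IsPullback (D.functor.map g).left (D.functor.map k).left (D.lift H a).left
      (D.lift H b).left := by
  have hg : IsPullback (D.functor.map g).left (D.proj r) (D.proj s) (B.forget.map g) := by
    rw [← lift_isPullback_map]
    exact D.isPullback_lift (D.isPullback s) _
  refine (IsPullback.of_right (h₁₂ := D.proj t) (h₂₂ := q) (v₁₃ := b.left) ?_ ?_
    (D.isPullback_lift H b).flip).flip
  · rw [map_left_proj, lift_left_comp]
    exact hg.flip.paste_horiz P.flip
  · rw [← Over.comp_left, ← Over.comp_left, map_comp_lift, map_comp_lift]
    exact congrArg (fun c => (D.lift H c).left) (Over.OverMorphism.ext P.w.symm)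

theorem ofArrows_lift_mem {I : Type*} {s : I → B.S} {a : ∀ i, B.obj (s i) ⟶ W}
    (hc : Sieve.ofArrows _ (fun i => (a i).left) ∈ τ.toGrothendieck W.left) :
    Sieve.ofArrows _ (fun i => (D.lift H (a i)).left) ∈ τ.toGrothendieck W'.left :=
  ofArrows_mem_of_isPullback hc q _ (fun i => D.proj (s i)) fun _ => (D.isPullback_lift H _)

variable (h : IsGluingPresite.{u} τ)

include h

theorem hom_ext_of_lift {I : Type*} {s : I → B.S} {a : ∀ i, B.obj (s i) ⟶ W}
    (hc : Sieve.ofArrows _ (fun i => (a i).left) ∈ τ.toGrothendieck W.left) {T : Over X'}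
    {x y : W' ⟶ T} (w : ∀ i, D.lift H (a i) ≫ x = D.lift H (a i) ≫ y) : x = y := by
  have := h.subcanonical
  exact Over.OverMorphism.ext <| hom_ext_of_ofArrows_mem (D.ofArrows_lift_mem H hc) fun i =>
    congrArg Over.Hom.left (w i)

theorem exists_desc (hW : etale τ W.hom) {I : Type*} {s : I → B.S} {a : ∀ i, B.obj (s i) ⟶ W}
    (hc : Sieve.ofArrows _ (fun i => (a i).left) ∈ τ.toGrothendieck W.left) {T : Over X'}
    (e : ∀ i, D.functor.obj (s i) ⟶ T)
    (he : ∀ (i j : I) (r : B.S) (g : r ⟶ s i) (k : r ⟶ s j),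
      B.toOver.map g ≫ a i = B.toOver.map k ≫ a j →
        D.functor.map g ≫ e i = D.functor.map k ≫ e j) :
    ∃ d : W' ⟶ T, ∀ i, D.lift H (a i) ≫ d = e i := by
  have := h.subcanonical
  have hc' := D.ofArrows_lift_mem H hc
  obtain ⟨d, hd⟩ := exists_desc_of_ofArrows_mem hc' (fun i => (e i).left) fun i j V x y w => by
    obtain ⟨r, g, k, P⟩ := B.exists_isPullback h hW (a i) (a j)
    have P' := D.isPullback_lift_lift H P
    have hgk := congrArg Over.Hom.left (he i j r g k (Over.OverMorphism.ext P.w))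
    obtain ⟨l, rfl, rfl⟩ := P'.exists_lift x y w
    rw [Category.assoc, Category.assoc]
    exact congrArg (l ≫ ·) hgk
  have hdT : d ≫ T.hom = W'.hom := hom_ext_of_ofArrows_mem hc' fun i => by
    rw [← Category.assoc, hd, Over.w, Over.w]
  exact ⟨Over.homMk d hdT, fun i => Over.OverMorphism.ext (hd i)⟩

end Lift

end BaseChange

end BaseChanges

section Sections

open Opposite

section RestrictedYoneda

variable {A : Type v} [Category.{w} A] {E : Type v'} [Category.{w'} E] [LocallySmall.{u} E]
  (G : A ⥤ E)

/-- The Yoneda functor of `E` restricted along `G`, with values shrunk to `Type u`. -/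
noncomputable def restrictedYoneda : E ⥤ Aᵒᵖ ⥤ Type u :=
  shrinkYoneda.{u} ⋙ (Functor.whiskeringLeft _ _ _).obj G.op

variable {G}

/-- The values of `restrictedYoneda G` are hom-sets. -/
noncomputable def restrictedYonedaEquiv {Z : E} {s : A} :
    ((restrictedYoneda G).obj Z).obj (op s) ≃ (G.obj s ⟶ Z) :=
  shrinkYonedaObjObjEquiv

theorem restrictedYonedaEquiv_obj_map {Z : E} {s t : A} (g : s ⟶ t)
    (x : ((restrictedYoneda G).obj Z).obj (op t)) :
    restrictedYonedaEquiv (((restrictedYoneda G).obj Z).map g.op x) =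
      G.map g ≫ restrictedYonedaEquiv x :=
  shrinkYonedaObjObjEquiv_obj_map ..

theorem restrictedYonedaEquiv_map_app {Z Z' : E} (z : Z ⟶ Z') {s : A}
    (x : ((restrictedYoneda G).obj Z).obj (op s)) :
    restrictedYonedaEquiv (((restrictedYoneda G).map z).app (op s) x) =
      restrictedYonedaEquiv x ≫ z :=
  shrinkYonedaObjObjEquiv_map_app ..

end RestrictedYoneda

variable {C : Type v} [Category.{w} C]

theorem IsUCategory.locallySmall (h : IsUCategory.{u} C) : LocallySmall.{u} C := by
  obtain ⟨S, _, ⟨e⟩⟩ := h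
  exact locallySmall_of_faithful e.functor

variable {τ : Precoverage C} {X : C} [LocallySmall.{u} C]

namespace BaseChange

variable {B : ClopenBasis.{u} τ X} {X' : C} {f : X' ⟶ X} (D : BaseChange B f)

/-- The sheaves of sections over the inverse images of the clopen subobjects in a basis. -/
noncomputable abbrev sections : Over X' ⥤ B.Sᵒᵖ ⥤ Type u :=
  restrictedYoneda D.functor

theorem isSheaf_sections (h : IsGluingPresite.{u} τ) (Z : Over X') :
    Presieve.IsSheaf (B.topology h) (D.sections.obj Z) := by
  intro s R hR x hx
  rw [Presieve.compatible_iff_sieveCompatible] at hx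
  let I := Σ r : B.S, {g : r ⟶ s // R g}
  have hc : Sieve.ofArrows _ (fun i : I => (B.toOver.map i.2.1).left) ∈
      τ.toGrothendieck (B.obj s).left := by
    refine τ.toGrothendieck.superset_covering ?_ hR
    rintro V _ ⟨r, g, l, hg, rfl⟩
    exact (Sieve.mem_ofArrows_iff _ _ _).2 ⟨⟨r, g, hg⟩, l, rfl⟩
  obtain ⟨d, hd⟩ := D.exists_desc (D.isPullback s) h (h.etale_of_clopens (B.clopen s)) hc
    (T := Z) (fun i => restrictedYonedaEquiv (x i.2.1 i.2.2)) fun i j r g k _ => by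
      rw [← restrictedYonedaEquiv_obj_map, ← restrictedYonedaEquiv_obj_map, ← hx, ← hx]
      congr 1
  have hd' (i : I) : D.functor.map i.2.1 ≫ d = restrictedYonedaEquiv (x i.2.1 i.2.2) := by
    rw [← lift_isPullback_map]
    exact hd i
  refine ⟨restrictedYonedaEquiv.symm d, fun r g hg => restrictedYonedaEquiv.injective ?_,
    fun y hy => restrictedYonedaEquiv.injective (D.hom_ext_of_lift (D.isPullback s) h hc ?_)⟩
  · rw [restrictedYonedaEquiv_obj_map, Equiv.apply_symm_apply]
    exact hd' ⟨r, g, hg⟩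
  · intro i
    rw [Equiv.apply_symm_apply, lift_isPullback_map, hd', ← restrictedYonedaEquiv_obj_map,
      hy _ i.2.2]

section PullbackSections

variable {W : Over X} {W' : Over X'} {q : W'.left ⟶ W.left} (H : IsPullback q W'.hom W.hom f)

/-- The inverse image of sections. -/
noncomputable def pullbackSections :
    (restrictedYoneda.{u} B.toOver).obj W ⟶ D.sections.obj W' where
  app s := ↾fun x => restrictedYonedaEquiv.symm (D.lift H (restrictedYonedaEquiv x))
  naturality s t g := by
    ext x
    refine restrictedYonedaEquiv.injective ?_
    refine (Equiv.apply_symm_apply ..).trans ?_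
    refine (congrArg (D.lift H) (restrictedYonedaEquiv_obj_map g.unop x)).trans ?_
    rw [← map_comp_lift]
    exact ((restrictedYonedaEquiv_obj_map g.unop _).trans
      (congrArg (D.functor.map g.unop ≫ ·) (Equiv.apply_symm_apply ..))).symm

theorem restrictedYonedaEquiv_pullbackSections_app {s : B.S}
    (x : ((restrictedYoneda.{u} B.toOver).obj W).obj (op s)) :
    restrictedYonedaEquiv ((D.pullbackSections H).app (op s) x) =
      D.lift H (restrictedYonedaEquiv x) :=
  Equiv.apply_symm_apply ..

theorem pullbackSections_naturality {V : Over X} {V' : Over X'} {q' : V'.left ⟶ V.left}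
    (H' : IsPullback q' V'.hom V.hom f) {β : V ⟶ W} {β' : V' ⟶ W'}
    (w : β'.left ≫ q = q' ≫ β.left) :
    D.pullbackSections H' ≫ D.sections.map β' =
      (restrictedYoneda.{u} B.toOver).map β ≫ D.pullbackSections H := by
  refine NatTrans.ext <| funext fun s => ConcreteCategory.hom_ext _ _ fun x =>
    restrictedYonedaEquiv.injective ?_
  rw [NatTrans.comp_app, NatTrans.comp_app, comp_apply, comp_apply, restrictedYonedaEquiv_map_app,
    restrictedYonedaEquiv_pullbackSections_app, restrictedYonedaEquiv_pullbackSections_app,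
    restrictedYonedaEquiv_map_app]
  exact hom_ext_left H <| by
    rw [Over.comp_left, Category.assoc, w, ← Category.assoc, lift_left_comp, lift_left_comp,
      Category.assoc, Over.comp_left]

theorem restrictedYonedaEquiv_pullbackSections_comp_map_app {Z : Over X'} (γ : W' ⟶ Z) {s : B.S}
    (a : B.obj s ⟶ W) :
    restrictedYonedaEquiv ((D.pullbackSections H ≫ D.sections.map γ).app (op s)
      (restrictedYonedaEquiv.symm a)) = D.lift H a ≫ γ := by
  rw [NatTrans.comp_app, comp_apply, restrictedYonedaEquiv_map_app,
    restrictedYonedaEquiv_pullbackSections_app, Equiv.apply_symm_apply]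

theorem pullbackSections_comp_map_bijective (h : IsGluingPresite.{u} τ) (hW : etale τ W.hom)
    (Z : Over X') :
    Function.Bijective fun γ : W' ⟶ Z => D.pullbackSections H ≫ D.sections.map γ := by
  refine ⟨fun γ γ' w => D.hom_ext_of_lift H h (B.sections_mem hW) fun ⟨s, a⟩ => ?_, fun θ => ?_⟩
  · rw [← restrictedYonedaEquiv_pullbackSections_comp_map_app,
      ← restrictedYonedaEquiv_pullbackSections_comp_map_app]
    exact congrArg (fun θ => restrictedYonedaEquiv (θ.app _ (restrictedYonedaEquiv.symm a))) w
  · let e (s : B.S) (a : B.obj s ⟶ W) : D.functor.obj s ⟶ Z :=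
      restrictedYonedaEquiv (θ.app (op s) (restrictedYonedaEquiv.symm a))
    have he {r s : B.S} (g : r ⟶ s) (a : B.obj s ⟶ W) :
        D.functor.map g ≫ e s a = e r (B.toOver.map g ≫ a) := by
      rw [← restrictedYonedaEquiv_obj_map, ← NatTrans.naturality_apply]
      refine congrArg (fun x => restrictedYonedaEquiv (θ.app _ x))
        (restrictedYonedaEquiv.injective ?_)
      rw [restrictedYonedaEquiv_obj_map, Equiv.apply_symm_apply, Equiv.apply_symm_apply]
    obtain ⟨d, hd⟩ := D.exists_desc H h hW (B.sections_mem hW) (fun x => e x.1 x.2)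
      fun i j r g k w => by rw [he, he, w]
    refine ⟨d, ?_⟩
    ext s x
    obtain ⟨a, rfl⟩ := restrictedYonedaEquiv.symm.surjective x
    refine restrictedYonedaEquiv.injective ?_
    exact (D.restrictedYonedaEquiv_pullbackSections_comp_map_app H d a).trans (hd ⟨s.unop, a⟩)

end PullbackSections

end BaseChange

end Sections

section SheavesAreEtale

open Opposite

variable {C : Type v} [Category.{w} C] {τ : Precoverage C} {X : C} {B : ClopenBasis.{u} τ X}

/-- The objects of a preorder on which two sections of a presheaf agree. -/
def agreement {A : Type u} [Preorder A] {F : Aᵒᵖ ⥤ Type u} {s t : A} (x : F.obj (op s))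
    (y : F.obj (op t)) : Set A :=
  {r | ∃ (g : r ⟶ s) (k : r ⟶ t), F.map g.op x = F.map k.op y}

namespace ClopenBasis

theorem exists_isLUB (h : IsGluingPresite.{u} τ) (A : Set B.S) : ∃ z, IsLUB A z ∧
    Sieve.ofObjects (Subtype.val : A → B.S) z ∈ B.topology h z := by
  have := h.subcanonical
  obtain ⟨Z, z, hz, hc, hl⟩ := h.exists_union (S := Presieve.ofArrows
    (fun r : A => (B.obj r).left) (fun r => (B.obj r).hom)) (by rintro _ _ ⟨r⟩; exact B.clopen _)
  obtain ⟨s, ⟨e⟩⟩ := B.exists_iso (Over.mk z) hz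
  have le_s : s ∈ upperBounds A := fun r hr => by
    obtain ⟨l, w⟩ := hl (B.obj r).hom (.mk (f := fun r : A => (B.obj r).hom) ⟨r, hr⟩)
    exact ⟨Over.homMk l w ≫ e.hom⟩
  refine ⟨s, ⟨le_s, fun t ht => ?_⟩, τ.toGrothendieck.superset_covering ?_
    (τ.toGrothendieck.pullback_stable e.inv.left hc)⟩
  · obtain ⟨l, hl⟩ := exists_lift_of_mem (B.obj t).hom z hc (by
      rintro W k ⟨_, m, _, ⟨r⟩, hm⟩
      obtain ⟨a⟩ := ht r.2
      exact ⟨m ≫ a.left, by rw [Category.assoc, Over.w, hm]⟩)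
    exact ⟨e.inv ≫ Over.homMk l hl⟩
  · rintro W k ⟨_, m, _, ⟨r⟩, hm⟩
    refine ⟨r, homOfLE (le_s r.2), m, ⟨r, ⟨𝟙 _⟩⟩, ?_⟩
    rw [← cancel_mono (B.obj s).hom, Category.assoc, Over.w, hm, Category.assoc]
    exact congrArg (k ≫ ·) (Over.w e.inv).symm

variable (F : B.Sᵒᵖ ⥤ Type u)

theorem exists_isGreatest_agreement {F : B.Sᵒᵖ ⥤ Type u} (h : IsGluingPresite.{u} τ)
    (hF : Presieve.IsSeparated (B.topology h) F) {s t : B.S} (x : F.obj (op s))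
    (y : F.obj (op t)) : ∃ z, IsGreatest (agreement x y) z := by
  obtain ⟨z, hz, hc⟩ := B.exists_isLUB h (agreement x y)
  have hs : z ≤ s := hz.2 fun r ⟨g, _⟩ => g.le
  have ht : z ≤ t := hz.2 fun r ⟨_, k, _⟩ => k.le
  refine ⟨z, ⟨homOfLE hs, homOfLE ht, (hF _ hc).ext ?_⟩, hz.1⟩
  rintro q a ⟨⟨r, g, k, e⟩, ⟨b⟩⟩
  rw [← Functor.map_comp_apply, ← Functor.map_comp_apply]
  exact (Functor.map_comp_apply F g.op b.op x).trans
    ((congrArg (F.map b.op) e).trans (Functor.map_comp_apply F k.op b.op y).symm)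

/-- The copies of the clopen subobjects of `X` indexed by the sections of `F` are glued where the
sections agree. -/
def gluingRelation (h : IsGluingPresite.{u} τ) :
    GluingRelation fun x : Σ s : B.S, F.obj (op s) => (B.obj x.1).left where
  rel {x y} T a b := ∃ (r : B.S) (g : r ⟶ x.1) (k : r ⟶ y.1) (m : T ⟶ (B.obj r).left),
    m ≫ B.forget.map g = a ∧ m ≫ B.forget.map k = b ∧ F.map g.op x.2 = F.map k.op y.2
  refl {x} T a := ⟨x.1, 𝟙 _, 𝟙 _, a, by rw [B.forget.map_id, Category.comp_id],
    by rw [B.forget.map_id, Category.comp_id], rfl⟩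
  symm := fun ⟨r, g, k, m, hg, hk, e⟩ => ⟨r, k, g, m, hk, hg, e.symm⟩
  trans {x y z T a b c} := by
    rintro ⟨r, g, k, m, rfl, rfl, e⟩ ⟨r', g', k', m', hm, rfl, e'⟩
    obtain ⟨q, l, l', H⟩ := B.exists_isPullback_map h k g'
    refine ⟨q, l ≫ g, l' ≫ k', H.lift m m' hm.symm, ?_, ?_, ?_⟩
    · exact (congrArg _ (B.forget.map_comp l g)).trans (H.lift_fst_assoc ..)
    · exact (congrArg _ (B.forget.map_comp l' k')).trans (H.lift_snd_assoc ..)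
    · rw [op_comp, op_comp, Functor.map_comp_apply, Functor.map_comp_apply, e, ← e',
        ← Functor.map_comp_apply, ← Functor.map_comp_apply]
      rfl
  precomp := by
    rintro x y T T' t _ _ ⟨r, g, k, m, rfl, rfl, e⟩
    exact ⟨r, g, k, t ≫ m, Category.assoc .., Category.assoc .., e⟩

variable {F} {h : IsGluingPresite.{u} τ}

theorem gluingRelation_isRepresentedBy {x y : Σ s : B.S, F.obj (op s)} {z : B.S}
    (hz : z ∈ upperBounds (agreement x.2 y.2)) {g : z ⟶ x.1} {k : z ⟶ y.1}
    (e : F.map g.op x.2 = F.map k.op y.2) :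
    (B.gluingRelation F h).IsRepresentedBy (B.forget.map g) (B.forget.map k) where
  rel := ⟨z, g, k, 𝟙 _, Category.id_comp _, Category.id_comp _, e⟩
  exists_lift := by
    rintro T _ _ ⟨r, g', k', m, rfl, rfl, e'⟩
    obtain ⟨u⟩ : Nonempty (r ⟶ z) := ⟨homOfLE (hz ⟨g', k', e'⟩)⟩
    refine ⟨m ≫ B.forget.map u, ?_, ?_⟩
    · rw [Category.assoc, ← B.forget.map_comp, Subsingleton.elim (u ≫ g) g']
    · rw [Category.assoc, ← B.forget.map_comp, Subsingleton.elim (u ≫ k) k']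

theorem exists_isGluing_gluingRelation (hF : Presieve.IsSeparated (B.topology h) F) :
    ∃ (W : Over X) (σ : ∀ s, F.obj (op s) → (B.obj s ⟶ W)), etale τ W.hom ∧
      Sieve.ofArrows _ (fun x : Σ s, F.obj (op s) => (σ x.1 x.2).left) ∈
        τ.toGrothendieck W.left ∧
      (B.gluingRelation F h).IsGluing fun x => (σ x.1 x.2).left := by
  have := h.subcanonical
  obtain ⟨V, π, hπ, hV, hρ⟩ := h.exists_gluing (B.gluingRelation F h) fun x y => by
    obtain ⟨z, ⟨g, k, e⟩, hz⟩ := B.exists_isGreatest_agreement h hF x.2 y.2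
    exact ⟨_, _, _, B.clopen_section h (h.etale_of_clopens (B.clopen x.1)) (B.toOver.map g),
      gluingRelation_isRepresentedBy hz e⟩
  obtain ⟨p, hp⟩ := exists_desc_of_ofArrows_mem hV (fun x => (B.obj x.1).hom) fun x y T a b e => by
    obtain ⟨r, g, k, m, rfl, rfl, -⟩ := hρ.comp_eq_comp_iff.1 e
    rw [Category.assoc, Category.assoc, Over.w, Over.w]
  refine ⟨Over.mk p, fun s x => Over.homMk (π ⟨s, x⟩) (hp _), ?_, hV, hρ⟩
  refine h.etale_of_cover (S := Presieve.ofArrows _ π) ?_ hV ?_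
  · rintro _ _ ⟨x⟩
    exact hπ x
  · rintro _ _ ⟨x⟩
    exact (hp x).symm ▸ h.etale_of_clopens (B.clopen x.1)

section IsGluing

variable {W : Over X} {σ : ∀ s, F.obj (op s) → (B.obj s ⟶ W)}
  (hσ : (B.gluingRelation F h).IsGluing fun x : Σ s, F.obj (op s) => (σ x.1 x.2).left)

include hσ

theorem map_comp_of_isGluing {r s : B.S} (g : r ⟶ s) (x : F.obj (op s)) :
    B.toOver.map g ≫ σ s x = σ r (F.map g.op x) := by
  refine Over.OverMorphism.ext ?_
  have e := (hσ.comp_eq_comp_iff (i := ⟨s, x⟩) (j := ⟨r, F.map g.op x⟩)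
    (a := B.forget.map g) (b := 𝟙 _)).2 ⟨r, g, 𝟙 r, 𝟙 _, Category.id_comp _, ?_, ?_⟩
  · rwa [Category.id_comp] at e
  · rw [B.forget.map_id, Category.id_comp]
  · rw [op_id, Functor.map_id_apply]

theorem injective_of_isGluing (s : B.S) : Function.Injective (σ s) := by
  intro x y e
  obtain ⟨r, g, k, m, hm, -, e'⟩ := (hσ.comp_eq_comp_iff (i := ⟨s, x⟩) (j := ⟨s, y⟩)
    (a := 𝟙 _) (b := 𝟙 _)).1 (congrArg (𝟙 _ ≫ ·) (congrArg Over.Hom.left e))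
  have hsr : s ≤ r := ⟨Over.homMk m (by rw [← Over.w (B.toOver.map g), reassoc_of% hm])⟩
  have restrict (l : r ⟶ s) (x : F.obj (op s)) : F.map (homOfLE hsr).op (F.map l.op x) = x := by
    rw [← Functor.map_comp_apply, ← op_comp, Subsingleton.elim (homOfLE hsr ≫ l) (𝟙 s), op_id,
      Functor.map_id_apply]
  rw [← restrict g x, e', restrict]

theorem sieve_mem_topology_of_isGluing (hW : etale τ W.hom)
    (hc : Sieve.ofArrows _ (fun x : Σ s, F.obj (op s) => (σ x.1 x.2).left) ∈
      τ.toGrothendieck W.left) {s : B.S} (a : B.obj s ⟶ W) (R : Sieve s)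
    (hR : ∀ (r : B.S) (g : r ⟶ s) (x : F.obj (op r)), σ r x = B.toOver.map g ≫ a → R g) :
    R ∈ B.topology h s := by
  refine τ.toGrothendieck.superset_covering ?_ (τ.toGrothendieck.pullback_stable a.left hc)
  rintro T k ⟨_, m, _, ⟨t, x⟩, hm⟩
  obtain ⟨r, g, l, H⟩ := B.exists_isPullback h hW (σ t x) a
  refine ⟨r, l, H.lift m k hm, hR r l (F.map g.op x) ?_, (H.lift_snd ..).symm⟩
  rw [← map_comp_of_isGluing hσ]
  exact Over.OverMorphism.ext H.w

theorem surjective_of_isGluing (hF : Presieve.IsSheaf (B.topology h) F) (hW : etale τ W.hom)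
    (hc : Sieve.ofArrows _ (fun x : Σ s, F.obj (op s) => (σ x.1 x.2).left) ∈
      τ.toGrothendieck W.left) (s : B.S) : Function.Surjective (σ s) := by
  have := h.subcanonical
  intro a
  let R : Sieve s :=
    { arrows := fun r g => ∃ x, σ r x = B.toOver.map g ≫ a
      downward_closed := by
        rintro r r' g ⟨x, hx⟩ g'
        exact ⟨F.map g'.op x, by
          rw [← map_comp_of_isGluing hσ, hx, ← Category.assoc, ← B.toOver.map_comp]⟩ }
  have hR : R ∈ B.topology h s := sieve_mem_topology_of_isGluing hσ hW hc a R fun r g x e => ⟨x, e⟩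
  choose y hy using fun (r : B.S) (g : r ⟶ s) (hg : R g) => hg
  obtain ⟨x, hx, -⟩ := hF R hR y <| (Presieve.compatible_iff_sieveCompatible _).2 <| by
    intro r r' g g' hg
    refine injective_of_isGluing hσ r' ?_
    rw [hy, ← map_comp_of_isGluing hσ, hy, ← Category.assoc, ← B.toOver.map_comp]
  refine ⟨x, Over.OverMorphism.ext (hom_ext_of_mem (J := τ.toGrothendieck) hR ?_)⟩
  rintro T _ ⟨r, g, m, hg, rfl⟩
  have e : B.toOver.map g ≫ σ s x = B.toOver.map g ≫ a := by
    rw [map_comp_of_isGluing hσ, hx g hg, hy]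
  rw [Category.assoc, Category.assoc]
  exact congrArg (m ≫ ·) (congrArg Over.Hom.left e)

end IsGluing

theorem exists_etale_iso [LocallySmall.{u} C] (hF : Presieve.IsSheaf (B.topology h) F) :
    ∃ W : Over X, etale τ W.hom ∧ Nonempty ((restrictedYoneda B.toOver).obj W ≅ F) := by
  obtain ⟨W, σ, hW, hc, hσ⟩ := exists_isGluing_gluingRelation hF.isSeparated
  let e (s : B.S) : F.obj (op s) ≃ (B.obj s ⟶ W) :=
    Equiv.ofBijective (σ s) ⟨injective_of_isGluing hσ s, surjective_of_isGluing hσ hF hW hc s⟩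
  refine ⟨W, hW, ⟨(NatIso.ofComponents
    (fun s => ((e s.unop).trans (restrictedYonedaEquiv (G := B.toOver)).symm).toIso)
    fun {s t} g => ?_).symm⟩⟩
  refine ConcreteCategory.hom_ext _ _ fun x => restrictedYonedaEquiv.injective ?_
  refine (Equiv.apply_symm_apply ..).trans (.trans ?_ (restrictedYonedaEquiv_obj_map g.unop _).symm)
  exact (map_comp_of_isGluing hσ g.unop x).symm.trans
    (congrArg (B.toOver.map g.unop ≫ ·) (Equiv.apply_symm_apply ..).symm)

end ClopenBasis

end SheavesAreEtale

section OverCategories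

variable {C : Type v} [Category.{w} C] {O : MorphismProperty C} {X Y : C}

theorem isPullback_over {P A B D : O.Over ⊤ X} {p : P ⟶ A} {q : P ⟶ B} {f : A ⟶ D} {g : B ⟶ D}
    (H : IsPullback p.left q.left f.left g.left) : IsPullback p q f g :=
  .of_map (MorphismProperty.Over.forget O ⊤ X) (by ext; exact H.w) <|
    .of_map (CategoryTheory.Over.forget X) (by ext; exact H.w) H

theorem exists_isPullback_over [O.HasPullbacks] [O.IsStableUnderBaseChange]
    [O.IsStableUnderComposition] [O.HasOfPostcompProperty O] {A B D : O.Over ⊤ X}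
    (a : A ⟶ D) (b : B ⟶ D) :
    ∃ (P : O.Over ⊤ X) (p : P ⟶ A) (q : P ⟶ B), IsPullback p.left q.left a.left b.left := by
  have hb : O b.left := O.of_postcomp _ D.hom D.prop <| by
    rw [MorphismProperty.Over.w]
    exact B.prop
  have := MorphismProperty.HasPullbacks.hasPullback a.left hb
  have H := IsPullback.of_hasPullback b.left a.left
  refine ⟨.mk ⊤ (pullback.snd b.left a.left ≫ A.hom) (O.comp_mem _ _ (O.of_isPullback H hb) A.prop),
    MorphismProperty.Over.homMk (pullback.snd _ _),
    MorphismProperty.Over.homMk (pullback.fst _ _) ?_, H.flip⟩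
  change pullback.fst b.left a.left ≫ B.hom = pullback.snd _ _ ≫ A.hom
  rw [← MorphismProperty.Over.w b, ← MorphismProperty.Over.w a, H.w_assoc]

section Pullback

variable [O.HasPullbacks] [O.IsStableUnderBaseChange] (f : X ⟶ Y)

/-- The projection of the inverse image along `f` of an object over `Y` onto this object. -/
noncomputable def overPullbackFst (W : O.Over ⊤ Y) :
    ((MorphismProperty.Over.pullback O ⊤ f).obj W).left ⟶ W.left :=
  pullback.fst W.hom f

theorem isPullback_overPullback_obj (W : O.Over ⊤ Y) :
    IsPullback (overPullbackFst f W) ((MorphismProperty.Over.pullback O ⊤ f).obj W).hom W.hom f :=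
  .of_hasPullback _ _

theorem isPullback_overPullback_map {V W : O.Over ⊤ Y} (k : V ⟶ W) :
    IsPullback (overPullbackFst f V) ((MorphismProperty.Over.pullback O ⊤ f).map k).left k.left
      (overPullbackFst f W) := by
  refine .of_bot ?_ ?_ (isPullback_overPullback_obj f W)
  · rw [MorphismProperty.Over.w, MorphismProperty.Over.w]
    exact isPullback_overPullback_obj f V
  · rw [MorphismProperty.Over.pullback_map_left]
    exact (pullback.lift_fst ..).symm

theorem isPullback_overPullback_map_left {P A B D : O.Over ⊤ Y} {p : P ⟶ A} {q : P ⟶ B}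
    {a : A ⟶ D} {b : B ⟶ D} (H : IsPullback p.left q.left a.left b.left) :
    letI F := MorphismProperty.Over.pullback O ⊤ f
    IsPullback (F.map p).left (F.map q).left (F.map a).left (F.map b).left := by
  refine (IsPullback.of_right ?_ ?_ (isPullback_overPullback_map f b)).flip
  · rw [← (isPullback_overPullback_map f q).w, ← (isPullback_overPullback_map f a).w]
    exact (isPullback_overPullback_map f p).paste_horiz H.flip
  · let F := MorphismProperty.Over.pullback O ⊤ f
    have w : F.map q ≫ F.map b = F.map p ≫ F.map a := by
      rw [← F.map_comp, ← F.map_comp, (isPullback_over H).w]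
    exact congrArg (fun k => k.left) w

theorem preservesFiniteLimits_overPullback [O.IsMultiplicative] [O.HasOfPostcompProperty O] :
    PreservesFiniteLimits (MorphismProperty.Over.pullback O ⊤ f) := by
  let F := MorphismProperty.Over.pullback O ⊤ f
  have {A B D : O.Over ⊤ Y} {a : A ⟶ D} {b : B ⟶ D} : HasLimit (cospan a b) := by
    obtain ⟨P, p, q, H⟩ := exists_isPullback_over a b
    exact (isPullback_over H).hasPullback
  have : HasPullbacks (O.Over ⊤ Y) := hasPullbacks_of_hasLimit_cospan _
  have {A B D : O.Over ⊤ Y} (a : A ⟶ D) (b : B ⟶ D) : PreservesLimit (cospan a b) F := by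
    obtain ⟨P, p, q, H⟩ := exists_isPullback_over a b
    have H' := isPullback_over H
    exact preservesLimit_of_preserves_limit_cone H'.isLimit <|
      (isLimitMapConePullbackConeEquiv F H'.w).symm
        (isPullback_over (isPullback_overPullback_map_left f H)).isLimit
  have : PreservesLimitsOfShape WalkingCospan F :=
    ⟨fun {K} => preservesLimit_of_iso_diagram F (diagramIsoCospan K).symm⟩
  have : PreservesLimit (Functor.empty.{0} (O.Over ⊤ Y)) F := by
    let T : O.Over ⊤ Y := .mk ⊤ (𝟙 Y) (O.id_mem Y)
    have : IsIso (F.obj T).hom :=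
      (isPullback_overPullback_obj f T).isIso_snd_of_isIso (IsIso.id Y)
    exact preservesLimit_of_preserves_limit_cone (MorphismProperty.Over.mkIdTerminal O Y) <|
      (isLimitMapConeEmptyConeEquiv F _).symm <|
        (MorphismProperty.Over.mkIdTerminal O X).ofIso <|
          MorphismProperty.Over.isoMk (@asIso _ _ _ _ (F.obj T).hom this).symm
            (@IsIso.inv_hom_id _ _ _ _ (F.obj T).hom this)
  have := preservesLimitsOfShape_pempty_of_preservesTerminal F
  exact preservesFiniteLimits_of_preservesTerminal_and_pullbacks F

end Pullback

end OverCategories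

section Topos

open Opposite

variable {C : Type v} [Category.{w} C] {τ : Precoverage C} {X : C}

namespace ClopenBasis

variable (B : ClopenBasis.{u} τ X) (h : IsGluingPresite.{u} τ) [LocallySmall.{u} C]

theorem pullbackSections_id (W : Over X) :
    (BaseChange.id B).pullbackSections (IsPullback.id_horiz W.hom) = 𝟙 _ := by
  refine NatTrans.ext <| funext fun s => ConcreteCategory.hom_ext _ _ fun x =>
    restrictedYonedaEquiv.injective ?_
  refine ((BaseChange.id B).restrictedYonedaEquiv_pullbackSections_app _ x).trans ?_
  refine Over.OverMorphism.ext ?_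
  exact (Category.comp_id _).symm.trans <|
    ((BaseChange.id B).lift_left_comp _ _).trans (Category.id_comp _)

include h in
theorem restrictedYoneda_map_bijective {W : Over X} (hW : etale τ W.hom) (Z : Over X) :
    Function.Bijective fun γ : W ⟶ Z => (restrictedYoneda.{u} B.toOver).map γ := by
  have := (BaseChange.id B).pullbackSections_comp_map_bijective (IsPullback.id_horiz W.hom) h hW Z
  simpa only [pullbackSections_id, Category.id_comp] using this

/-- The sheaf of sections of an étale arrow over the clopen subobjects in a basis. -/
noncomputable def sheafOfSections :
    (etale τ).Over ⊤ X ⥤ Sheaf (B.topology h) (Type u) :=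
  ObjectProperty.lift _ (MorphismProperty.Over.forget _ ⊤ X ⋙ restrictedYoneda B.toOver) fun W =>
    (isSheaf_iff_isSheaf_of_type _ _).2 ((BaseChange.id B).isSheaf_sections h W.toComma)

theorem isEquivalence_sheafOfSections : (B.sheafOfSections h).IsEquivalence where
  faithful := ⟨fun {W Z} α β w => (MorphismProperty.Over.forget _ ⊤ X).map_injective <|
    (B.restrictedYoneda_map_bijective h W.prop Z.toComma).1 (congrArg (·.hom) w)⟩
  full := ⟨fun {W Z} θ => by
    obtain ⟨γ, hγ⟩ := (B.restrictedYoneda_map_bijective h W.prop Z.toComma).2 θ.hom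
    refine ⟨(MorphismProperty.Over.forget _ ⊤ X).preimage γ, ObjectProperty.hom_ext _ ?_⟩
    exact (congrArg _ ((MorphismProperty.Over.forget _ ⊤ X).map_preimage γ)).trans hγ⟩
  essSurj := ⟨fun F => by
    obtain ⟨W, hW, ⟨e⟩⟩ :=
      B.exists_etale_iso (h := h) ((isSheaf_iff_isSheaf_of_type _ _).1 F.property)
    exact ⟨.mk ⊤ W.hom hW, ⟨(fullyFaithfulSheafToPresheaf _ _).preimageIso
      (X := (B.sheafOfSections h).obj (.mk ⊤ W.hom hW)) e⟩⟩⟩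

end ClopenBasis

namespace IsGluingPresite

variable (h : IsGluingPresite.{u} τ)

include h

theorem isUTopos (X : C) : IsUTopos.{u} ((etale τ).Over ⊤ X) := by
  have := h.isUCategory.locallySmall
  obtain ⟨B⟩ := h.nonempty_clopenBasis h.ng1 X
  have := B.isEquivalence_sheafOfSections h
  exact ⟨B.S, inferInstance, B.topology h, ⟨(B.sheafOfSections h).asEquivalence⟩⟩

section Pushforward

variable [(etale τ).HasPullbacks] [(etale τ).IsStableUnderBaseChange] {Y : C} (f : X ⟶ Y)

theorem exists_overPullback_map_comp_bijective (Z : (etale τ).Over ⊤ X) :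
    letI F := MorphismProperty.Over.pullback (etale τ) ⊤ f
    ∃ (V : (etale τ).Over ⊤ Y) (ε : F.obj V ⟶ Z),
      ∀ W : (etale τ).Over ⊤ Y, Function.Bijective fun β : W ⟶ V => F.map β ≫ ε := by
  let F := MorphismProperty.Over.pullback (etale τ) ⊤ f
  let G := MorphismProperty.Over.forget (etale τ) ⊤
  have := h.isUCategory.locallySmall
  obtain ⟨B⟩ := h.nonempty_clopenBasis h.ng1 Y
  obtain ⟨D⟩ := BaseChange.nonempty h.toIsPresite B f
  obtain ⟨V, hV, ⟨φ⟩⟩ := B.exists_etale_iso (D.isSheaf_sections h ((G X).obj Z))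
  let V' : (etale τ).Over ⊤ Y := .mk ⊤ V.hom hV
  let η (W : (etale τ).Over ⊤ Y) :
      (restrictedYoneda B.toOver).obj ((G Y).obj W) ⟶ D.sections.obj ((G X).obj (F.obj W)) :=
    D.pullbackSections (isPullback_overPullback_obj f W)
  have G_bijective {X : C} (W Z : (etale τ).Over ⊤ X) :
      Function.Bijective fun k : W ⟶ Z => (G X).map k :=
    ⟨(G X).map_injective, (G X).map_surjective⟩
  have η_bijective (W : (etale τ).Over ⊤ Y) (Z : (etale τ).Over ⊤ X) :
      Function.Bijective fun k : F.obj W ⟶ Z => η W ≫ D.sections.map ((G X).map k) :=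
    (D.pullbackSections_comp_map_bijective (isPullback_overPullback_obj f W) h W.prop _).comp
      (G_bijective _ _)
  obtain ⟨ε, hε⟩ := (η_bijective V' Z).2 φ.hom
  refine ⟨V', ε, fun W => ((η_bijective W Z).of_comp_iff' _).1 ?_⟩
  have hcomp : Function.Bijective fun β : W ⟶ V' =>
      (restrictedYoneda B.toOver).map ((G Y).map β) ≫ φ.hom :=
    (((Iso.homToEquiv φ).bijective).comp (B.restrictedYoneda_map_bijective h W.prop V)).comp
      (G_bijective _ _)
  refine (congrArg Function.Bijective <| funext fun β => ?_).mpr hcomp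
  have naturality : η W ≫ D.sections.map ((G X).map (F.map β)) =
      (restrictedYoneda B.toOver).map ((G Y).map β) ≫ η V' :=
    D.pullbackSections_naturality _ _ (isPullback_overPullback_map f β).w.symm
  calc η W ≫ D.sections.map ((G X).map (F.map β ≫ ε))
    _ = (η W ≫ D.sections.map ((G X).map (F.map β))) ≫ D.sections.map ((G X).map ε) := by
      rw [Functor.map_comp, Functor.map_comp, Category.assoc]
    _ = (restrictedYoneda B.toOver).map ((G Y).map β) ≫ η V' ≫ D.sections.map ((G X).map ε) := by
      rw [naturality, Category.assoc]
    _ = (restrictedYoneda B.toOver).map ((G Y).map β) ≫ φ.hom := congrArg _ hε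

theorem isLeftAdjoint_overPullback :
    (MorphismProperty.Over.pullback (etale τ) ⊤ f).IsLeftAdjoint := by
  choose G ε hε using h.exists_overPullback_map_comp_bijective f
  let e W Z := (Equiv.ofBijective _ (hε Z W)).symm
  refine (Adjunction.adjunctionOfEquivRight e fun W W' Z g k => (hε Z _).1 ?_).isLeftAdjoint
  have he W Z k : (MorphismProperty.Over.pullback _ ⊤ f).map (e W Z k) ≫ ε Z = k :=
    (Equiv.ofBijective _ (hε Z W)).apply_symm_apply k
  simp only [he, Functor.map_comp, Category.assoc]

end Pushforward

end IsGluingPresite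

end Topos

section EtaleGlutos

variable {C : Type v} [Category.{w} C] {τ : Precoverage C}

namespace IsGluingPresite

variable (h : IsGluingPresite.{u} τ)

include h

theorem etale_coproductDesc {I : Type u} {U : I → C} {X : C} (f : ∀ i, U i ⟶ X)
    (hf : ∀ i, etale τ (f i)) (c : Cofan U) (hc : IsColimit c) :
    etale τ (hc.desc (Cofan.mk X f)) := by
  obtain ⟨Q, π, hπ, hQ, hd⟩ := h.exists_coproduct U
  have := h.subcanonical
  have (i : I) : Mono (π i) := h.mono_of_clopens (hπ i)
  have hQ' := (isUniversalColimit_cofan hQ hd).isColimit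
  have hfac i : π i ≫ hQ'.desc (Cofan.mk X f) = f i := hQ'.fac (Cofan.mk X f) ⟨i⟩
  have hdesc : etale τ (hQ'.desc (Cofan.mk X f)) := by
    refine h.etale_of_cover (S := Presieve.ofArrows U π) ?_ hQ ?_
    · rintro _ _ ⟨i⟩
      exact hπ i
    · rintro _ _ ⟨i⟩
      exact (hfac i).symm ▸ hf i
  have : hc.desc (Cofan.mk X f) =
      (hc.coconePointUniqueUpToIso hQ').hom ≫ hQ'.desc (Cofan.mk X f) :=
    hc.hom_ext fun _ => by simp
  exact this ▸ h.etale_comp (h.etale_of_clopens (h.clopens_of_isIso _)) hdesc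

theorem isUGlutos_etale : IsUGlutos.{u} C (etale τ) where
  toIsClopos := h.isClopos_etale
  isUCategory := h.isUCategory
  of_postcomp _ _ _ _ _ := h.etale_of_postcomp
  isUTopos := h.isUTopos
  inverseImage X Y f := by
    have := h.isClopos_etale.hasPullbacks
    have := h.isClopos_etale.isStableUnderBaseChange
    have := h.isClopos_etale.isStableUnderComposition
    have : (etale τ).HasOfPostcompProperty (etale τ) :=
      ⟨fun _ _ hg hfg => h.etale_of_postcomp hfg hg⟩
    have : (etale τ).ContainsIdentities := ⟨fun _ => h.etale_of_clopens (h.clopens_of_isIso _)⟩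
    have : (etale τ).IsMultiplicative := {}
    exact ⟨preservesFiniteLimits_overPullback f, h.isLeftAdjoint_overPullback f⟩
  coproducts I U := by
    obtain ⟨Q, π, hπ, hQ, hd⟩ := h.exists_coproduct U
    have := h.subcanonical
    have (i : I) : Mono (π i) := h.mono_of_clopens (hπ i)
    exact ⟨Cofan.mk Q π, isUniversalColimit_cofan hQ hd,
      fun i => ⟨h.etale_of_clopens (hπ i), this i⟩,
      fun i j hij Z p q H => nonempty_isInitial_of_bot_mem (hd i j Z p q hij H.w)⟩
  coproductDesc _ _ _ f hf c hc := h.etale_coproductDesc f hf c hc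
  effectiveEpi _ _ _ hf _ := h.effectiveEpi_of_etale hf
  of_precomp _ _ _ _ _ hpf hp _ := h.etale_of_precomp hpf hp
  quotients _ _ _ _ hE hu _ hl := h.exists_quotient hE hu hl
  localPullbacks _ _ _ _ _ _ _ hr _ _ := h.hasPullback_of_epi hr

end IsGluingPresite

end EtaleGlutos

/-! ### The canonical topology of a glutos -/

section UniversalColimits

variable {C : Type v} [Category.{w} C]

theorem hom_ext_of_isUniversalColimit {K : Type*} [Category* K] {F : K ⥤ C} {c : Cocone F}
    (hc : IsUniversalColimit c) {Y : C} {f : Y ⟶ c.pt} {P : K → C} {p : ∀ k, P k ⟶ Y}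
    {q : ∀ k, P k ⟶ F.obj k} (H : ∀ k, IsPullback (p k) (q k) f (c.ι.app k)) {T : C}
    {g g' : Y ⟶ T} (e : ∀ k, p k ≫ g = p k ≫ g') : g = g' := by
  let F' : K ⥤ C :=
    { obj := P
      map := fun {k l} m => (H l).lift (p k) (q k ≫ F.map m) (by simp [(H k).w])
      map_id := fun k => (H k).hom_ext (by simp) (by simp)
      map_comp := fun m n => (H _).hom_ext (by simp) (by simp) }
  have hp {k l} (m : k ⟶ l) : F'.map m ≫ p l = p k := (H _).lift_fst ..
  have hq {k l} (m : k ⟶ l) : F'.map m ≫ q l = q k ≫ F.map m := (H _).lift_snd ..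
  let c' : Cocone F' := ⟨Y, { app := p, naturality := fun k l m => by simp [hp] }⟩
  let α : F' ⟶ F := { app := q, naturality := fun _ _ => hq }
  obtain ⟨hc'⟩ := hc c' α f (by ext k; exact (H k).w.symm) (fun k l m =>
    .of_right (h₁₂ := p l) (v₁₃ := f) (h₂₂ := c.ι.app l) (by rw [hp, c.w]; exact H k) (hq m) (H l))
    H
  exact hc'.hom_ext e

theorem isEpiSink_of_isUniversalColimit_cofan {I : Type*} {U : I → C} {c : Cofan U}
    (hc : IsUniversalColimit c) {Y : C} {f : Y ⟶ c.pt} {V : I → C} {p : ∀ i, V i ⟶ Y}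
    {q : ∀ i, V i ⟶ U i} (H : ∀ i, IsPullback (p i) (q i) f (c.inj i)) :
    IsEpiSink (Presieve.ofArrows V p) :=
  isEpiSink_ofArrows_iff.2 fun _ _ _ e =>
    hom_ext_of_isUniversalColimit hc (fun k => H k.as) fun k => e k.as

theorem epi_of_isUniversalColimit_cofork {R X Q : C} {u v : R ⟶ X} {q : X ⟶ Q}
    {h : u ≫ q = v ≫ q} (hc : IsUniversalColimit (Cofork.ofπ q h)) {V Y : C} {f : Y ⟶ Q}
    {p : V ⟶ Y} {x : V ⟶ X} (H : IsPullback p x f q) [HasPullback f (u ≫ q)] : Epi p := by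
  refine ⟨fun {T} g g' e => ?_⟩
  have H₀ := IsPullback.of_hasPullback f (u ≫ q)
  let H' : ∀ k, Σ' (V : C) (p : V ⟶ Y) (q' : V ⟶ (parallelPair u v).obj k),
      IsPullback p q' f ((Cofork.ofπ q h).ι.app k) := fun
    | .zero => ⟨_, _, _, H₀⟩
    | .one => ⟨_, _, _, H⟩
  refine hom_ext_of_isUniversalColimit hc (fun k => (H' k).2.2.2) ?_
  rintro (_ | _)
  · change pullback.fst f (u ≫ q) ≫ g = pullback.fst f (u ≫ q) ≫ g'
    obtain ⟨t, ht, -⟩ := H.exists_lift (pullback.fst f (u ≫ q)) (pullback.snd f (u ≫ q) ≫ u) (by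
      rw [Category.assoc, H₀.w])
    simpa only [Category.assoc, ← ht] using congrArg (t ≫ ·) e
  · exact e

end UniversalColimits

section GlutosTopology

variable {E : Type v} [Category.{w} E] {P : MorphismProperty E}

namespace IsUGlutos

section

variable (h : IsUGlutos.{u} E P)

include h

theorem isUniversalColimit_cofork_of_epi {R X Y : E} {p : X ⟶ Y} (hp : P p) [Epi p] {a b : R ⟶ X}
    (H : IsKernelPair p a b) : IsUniversalColimit (Cofork.ofπ p H.w) := by
  have ha : P a := h.fst_of_isPullback H hp
  have hb : P b := h.snd_of_isPullback H hp
  have := h.hasPullback hb a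
  have := h.hasPullback hp p
  have := h.effectiveEpi p hp inferInstance
  obtain ⟨Q, q, hq, -, -, hc⟩ := h.quotients a b
    (IsKernelPair.equivalenceRelation p a b (pullback.isLimit b a) H).isEquivalenceRelation ha hb
    (locallyOCoequalizable_of_comp_eq (h.of_isIso _ inferInstance) hp H.w)
  exact hc.of_iso (hc.isColimit.uniqueUpToIso H.toCoequalizer')

theorem epi_of_isPullback {X Y X' Y' : E} {f : Y' ⟶ Y} {p : X ⟶ Y} {p' : X' ⟶ Y'} {x : X' ⟶ X}
    (H : IsPullback p' x f p) (hp : P p) [Epi p] : Epi p' := by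
  have := h.hasPullback hp p
  have HR := IsPullback.of_hasPullback p p
  have := h.hasPullback (h.comp (h.fst_of_isPullback HR hp) hp) f
  have := hasPullback_symmetry (pullback.fst p p ≫ p) f
  exact epi_of_isUniversalColimit_cofork (h.isUniversalColimit_cofork_of_epi hp HR) H

variable {I : Type u} {X : E} {U : I → E} {a : ∀ i, U i ⟶ X} (ha : ∀ i, P (a i))

include ha

theorem exists_epi_from_coproduct (hepi : IsEpiSink (Presieve.ofArrows U a)) :
    ∃ (c : Cofan U) (p : c.pt ⟶ X), IsUniversalColimit c ∧ (∀ i, P (c.inj i)) ∧ P p ∧ Epi p ∧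
      ∀ i, c.inj i ≫ p = a i := by
  obtain ⟨c, hc, hinj, -⟩ := h.coproducts I U
  have hfac (i : I) : c.inj i ≫ hc.isColimit.desc (Cofan.mk X a) = a i :=
    hc.isColimit.fac (Cofan.mk X a) ⟨i⟩
  refine ⟨c, _, hc, fun i => (hinj i).1, h.coproductDesc I U X a ha c hc.isColimit,
    ⟨fun g g' e => isEpiSink_ofArrows_iff.1 hepi g g' fun i => ?_⟩, hfac⟩
  rw [← hfac, Category.assoc, e, Category.assoc]

theorem isEpiSink_of_isPullback (hepi : IsEpiSink (Presieve.ofArrows U a)) {Y : E} {f : Y ⟶ X}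
    {V : I → E} {b : ∀ i, V i ⟶ Y} {t : ∀ i, V i ⟶ U i}
    (H : ∀ i, IsPullback (b i) (t i) f (a i)) : IsEpiSink (Presieve.ofArrows V b) := by
  obtain ⟨c, p, hc, -, hp, _, hfac⟩ := h.exists_epi_from_coproduct ha hepi
  have := h.hasPullback hp f
  have HZ := (IsPullback.of_hasPullback p f).flip
  have := h.epi_of_isPullback HZ hp
  have w (i : I) : b i ≫ f = (t i ≫ c.inj i) ≫ p := by rw [(H i).w, Category.assoc, hfac]
  have H' (i : I) : IsPullback (HZ.lift _ _ (w i)) (t i) (pullback.fst p f) (c.inj i) :=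
    .of_right (by rw [HZ.lift_fst, hfac]; exact H i) (HZ.lift_snd ..) HZ
  refine isEpiSink_ofArrows_iff.2 fun T g g' e => (cancel_epi (pullback.snd p f)).1 ?_
  refine isEpiSink_ofArrows_iff.1 (isEpiSink_of_isUniversalColimit_cofan hc H') _ _ fun i => ?_
  rw [HZ.lift_fst_assoc, HZ.lift_fst_assoc, e]

theorem exists_desc_of_isEpiSink (hepi : IsEpiSink (Presieve.ofArrows U a)) {T : E}
    (e : ∀ i, U i ⟶ T) (he : ∀ (i j : I) (W : E) (s : W ⟶ U i) (t : W ⟶ U j), s ≫ a i = t ≫ a j →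
      s ≫ e i = t ≫ e j) : ∃ d : X ⟶ T, ∀ i, a i ≫ d = e i := by
  obtain ⟨c, p, hc, hinj, hp, _, hfac⟩ := h.exists_epi_from_coproduct ha hepi
  have := h.effectiveEpi p hp inferInstance
  have := h.hasPullback hp p
  let k : c.pt ⟶ T := hc.isColimit.desc (Cofan.mk T e)
  have hk (i : I) : c.inj i ≫ k = e i := hc.isColimit.fac (Cofan.mk T e) ⟨i⟩
  have hext {Z : E} (g : Z ⟶ c.pt) {x y : Z ⟶ T}
      (hxy : ∀ i W (s : W ⟶ Z) (t : W ⟶ U i), s ≫ g = t ≫ c.inj i → s ≫ x = s ≫ y) : x = y := by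
    have (i : I) := h.hasPullback (hinj i) g
    have H (i : I) := (IsPullback.of_hasPullback (c.inj i) g).flip
    exact isEpiSink_ofArrows_iff.1 (isEpiSink_of_isUniversalColimit_cofan hc H) x y fun i =>
      hxy i _ _ _ (H i).w
  have hpk : pullback.fst p p ≫ k = pullback.snd p p ≫ k := by
    refine hext (pullback.fst p p) fun i W s t es => ?_
    refine hext (s ≫ pullback.snd p p) fun j W' s' t' es' => ?_
    have w : (s' ≫ t) ≫ a i = t' ≫ a j := by
      rw [← hfac, ← hfac, ← Category.assoc t', ← es', Category.assoc, Category.assoc,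
        Category.assoc, ← pullback.condition, reassoc_of% es]
    calc s' ≫ s ≫ pullback.fst p p ≫ k = (s' ≫ t) ≫ e i := by
          rw [reassoc_of% es, hk, Category.assoc]
      _ = t' ≫ e j := he _ _ _ _ _ w
      _ = s' ≫ s ≫ pullback.snd p p ≫ k := by
          rw [← hk, ← Category.assoc t', ← es']; simp only [Category.assoc]
  obtain ⟨d, hd⟩ := IsRegularEpi.exists_of_isKernelPair p (IsPullback.of_hasPullback p p) k hpk
  exact ⟨d, fun i => by rw [← hfac, Category.assoc, hd, hk]⟩

theorem of_epiFamily (hepi : IsEpiSink (Presieve.ofArrows U a)) {Y : E} (f : X ⟶ Y)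
    (hf : ∀ i, P (a i ≫ f)) : P f := by
  obtain ⟨c, p, hc, -, hp, _, hfac⟩ := h.exists_epi_from_coproduct ha hepi
  have hpf : hc.isColimit.desc (Cofan.mk Y fun i => a i ≫ f) = p ≫ f :=
    (hc.isColimit.uniq (Cofan.mk Y fun i => a i ≫ f) (p ≫ f) fun i =>
      (Category.assoc _ _ _).symm.trans (congrArg (· ≫ f) (hfac i.as))).symm
  exact h.of_precomp p f (hpf ▸ h.coproductDesc I U Y _ hf c hc.isColimit) hp inferInstance

end

/-- The Grothendieck topology of a glutos: a sieve is covering if it contains a small epi family of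
arrows of `P`. -/
def topology (h : IsUGlutos.{u} E P) : GrothendieckTopology E where
  sieves X := {R | ∃ (I : Type u) (U : I → E) (a : ∀ i, U i ⟶ X), (∀ i, P (a i)) ∧
    IsEpiSink (Presieve.ofArrows U a) ∧ ∀ i, R (a i)}
  top_mem' X := ⟨PUnit, fun _ => X, fun _ => 𝟙 X, fun _ => h.of_isIso _ inferInstance,
    isEpiSink_ofArrows_iff.2 fun _ g g' e => by simpa using e ⟨⟩, fun _ => trivial⟩
  pullback_stable' X Y R f := by
    rintro ⟨I, U, a, ha, hepi, hR⟩
    have (i : I) := h.hasPullback (ha i) f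
    have H (i : I) := IsPullback.of_hasPullback (a i) f
    refine ⟨I, _, fun i => pullback.snd (a i) f, fun i => h.snd_of_isPullback (H i) (ha i),
      h.isEpiSink_of_isPullback ha hepi fun i => (H i).flip, fun i => ?_⟩
    change R (pullback.snd (a i) f ≫ f)
    rw [← (H i).w]
    exact R.downward_closed (hR i) _
  transitive' X R hR R' H := by
    obtain ⟨I, U, a, ha, hepi, hR⟩ := hR
    choose K V b hb hepi' hR' using fun i => H (hR i)
    simp only [isEpiSink_ofArrows_iff] at hepi hepi'
    refine ⟨Σ i, K i, fun x => V x.1 x.2, fun x => b x.1 x.2 ≫ a x.1,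
      fun x => h.comp (hb _ _) (ha _), isEpiSink_ofArrows_iff.2 fun T g g' e =>
        hepi g g' fun i => hepi' i _ _ fun j => ?_, fun x => hR' x.1 x.2⟩
    simpa only [Category.assoc] using e ⟨i, j⟩

variable (h : IsUGlutos.{u} E P)

include h

theorem ofArrows_mem_topology {I : Type u} {X : E} {U : I → E} {a : ∀ i, U i ⟶ X}
    (ha : ∀ i, P (a i)) (hepi : IsEpiSink (Presieve.ofArrows U a)) :
    Sieve.ofArrows U a ∈ h.topology X :=
  ⟨I, U, a, ha, hepi, fun i => Sieve.ofArrows_mk _ _ i⟩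

theorem bot_mem_topology {Z : E} (hZ : IsInitial Z) : ⊥ ∈ h.topology Z :=
  ⟨PEmpty, PEmpty.elim, fun i => i.elim, fun i => i.elim, fun _ _ _ _ => hZ.hom_ext _ _,
    fun i => i.elim⟩

theorem subcanonical_topology : h.topology.Subcanonical := by
  refine GrothendieckTopology.Subcanonical.of_isSheaf_yoneda_obj _ fun T X R hR => ?_
  obtain ⟨I, U, a, ha, hepi, hR⟩ := hR
  intro x hx
  obtain ⟨d, hd⟩ := h.exists_desc_of_isEpiSink ha hepi (T := T) (fun i => x (a i) (hR i))
    fun i j W s t e => hx s t (hR i) (hR j) e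
  refine ⟨d, fun Y f hf => ?_, fun d' hd' => isEpiSink_ofArrows_iff.1 hepi _ _ fun i => ?_⟩
  · have (i : I) := h.hasPullback (ha i) f
    have H (i : I) := (IsPullback.of_hasPullback (a i) f).flip
    refine isEpiSink_ofArrows_iff.1 (h.isEpiSink_of_isPullback ha hepi H) _ _ fun i => ?_
    have := hx (pullback.snd (a i) f) (pullback.fst (a i) f) hf (hR i) (H i).w
    change pullback.snd (a i) f ≫ f ≫ d = pullback.snd (a i) f ≫ x f hf
    rw [reassoc_of% (H i).w, hd]
    exact this.symm
  · rw [hd]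
    exact hd' _ (hR i)

end IsUGlutos

namespace IsClopos

theorem clopens_epiPretopology_iff (h : IsClopos P) {X Y : E} {f : X ⟶ Y} :
    clopens (epiPretopology P) f ↔ P f := by
  refine ⟨fun ⟨S, hS, hf⟩ => hS.1 f hf, fun hf => ?_⟩
  refine ⟨fun Z g => P g, ⟨fun _ _ hg => hg, fun Z g g' H => ?_⟩, hf⟩
  simpa only [Category.id_comp] using H (𝟙 Y) (h.of_isIso _ inferInstance)

theorem clopens_monoPart_iff (h : IsClopos P) {X Y : E} {f : X ⟶ Y} :
    clopens (monoPart (epiPretopology P)) f ↔ P f ∧ Mono f := by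
  refine ⟨fun ⟨S, hS, hf⟩ => ⟨hS.1.1 f hf, hS.2 f hf⟩, fun hf => ?_⟩
  refine ⟨fun Z g => P g ∧ Mono g, ⟨⟨fun _ _ hg => hg.1, fun Z g g' H => ?_⟩,
    fun _ _ hg => hg.2⟩, hf⟩
  simpa only [Category.id_comp] using H (𝟙 Y) ⟨h.of_isIso _ inferInstance, inferInstance⟩

end IsClopos

end GlutosTopology

/-! ### Extension of continuous functors to étale arrows -/

section Extension

variable {C : Type v} [Category.{w} C] {τ : Precoverage C}
  {E : Type v'} [Category.{w'} E] {P : MorphismProperty E}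

theorem IsUGlutos.map_clopens (hE : IsUGlutos.{u} E P) {F : C ⥤ E}
    (hF : IsContinuous τ (epiPretopology P) F) {X Y : C} {f : X ⟶ Y} (hf : clopens τ f) :
    P (F.map f) :=
  hE.clopens_epiPretopology_iff.1 (hF.map_clopen _ hf)

namespace IsGluingPresite

section

variable (h : IsGluingPresite.{u} τ) (hE : IsUGlutos.{u} E P) {F : C ⥤ E}
  (hF : IsContinuous τ (epiPretopology P) F)

include h hF

theorem exists_small_isEpiSink_map {X : C} {S : Presieve X} (hS : SinkIn (clopens τ) S)
    (hc : Sieve.generate S ∈ τ.toGrothendieck X) :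
    ∃ (I : Type u) (U : I → C) (a : ∀ i, U i ⟶ X), (∀ i, S (a i)) ∧
      IsEpiSink (Presieve.ofArrows (fun i => F.obj (U i)) fun i => F.map (a i)) := by
  obtain ⟨I, U, a, haS, e⟩ := h.exists_small_ofArrows h.ng1 hS
  rw [e] at hc
  have hmap := hF.map_covering _ ((h.ofArrows_mem_iff fun i => hS _ (haS i)).2 hc)
  exact ⟨I, U, a, haS, isEpiSink_ofArrows_iff.2 fun T g g' H =>
    hmap.2 g g' (by rintro _ _ ⟨⟨i⟩⟩; exact H i)⟩

theorem isEpiSink_map_of_etale {X : C} {S : Presieve X} (hS : SinkIn (etale τ) S)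
    (hepi : IsEpiSink S) : IsEpiSink (S.map F) := by
  intro T g g' H
  let S' : Presieve X := fun W a => clopens τ a ∧ ∃ (Y : C) (f : Y ⟶ X) (b : W ⟶ Y),
    S f ∧ b ≫ f = a
  have hS' : Sieve.generate S' ∈ τ.toGrothendieck X := by
    refine mem_of_generate_mem (h.generate_mem_of_isEpiSink hS hepi) fun Y f hf =>
      τ.toGrothendieck.superset_covering ?_ (hS f hf)
    rw [Sieve.generate_le_iff]
    exact fun W b hb => ⟨W, 𝟙 W, b ≫ f, ⟨hb.2, Y, f, b, hf, rfl⟩, by simp⟩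
  obtain ⟨I, U, a, ha, hepi⟩ := h.exists_small_isEpiSink_map hF (fun _ _ ha => ha.1) hS'
  refine isEpiSink_ofArrows_iff.1 hepi g g' fun i => ?_
  obtain ⟨-, Y, f, b, hf, e⟩ := ha i
  rw [← e, F.map_comp, Category.assoc, Category.assoc, H _ (.of hf)]

include hE

theorem map_etale {X Y : C} {f : X ⟶ Y} (hf : etale τ f) : P (F.map f) := by
  obtain ⟨I, U, a, ha, hepi⟩ := h.exists_small_isEpiSink_map hF (fun _ _ ha => ha.1) hf
  refine hE.of_epiFamily (fun i => hE.map_clopens hF (ha i).1) hepi _ fun i => ?_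
  rw [← F.map_comp]
  exact hE.map_clopens hF (ha i).2

theorem map_isPullback_of_etale {W X Y Z : C} {p : W ⟶ X} {q : W ⟶ Y} {f : X ⟶ Z} {g : Y ⟶ Z}
    (hf : etale τ f) (H : IsPullback p q f g) :
    IsPullback (F.map p) (F.map q) (F.map f) (F.map g) := by
  obtain ⟨I, U, a, ha, hepi⟩ := h.exists_small_isEpiSink_map hF (fun _ _ ha => ha.1) hf
  have (i : I) := h.hasPullback_of_clopens (ha i).1 p
  have Ha (i : I) := IsPullback.of_hasPullback (a i) p
  have := hE.subcanonical_topology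
  refine isPullback_of_ofArrows_mem
    (hE.ofArrows_mem_topology (fun i => hE.map_clopens hF (ha i).1) hepi)
    (by rw [← F.map_comp, H.w, F.map_comp])
    (fun i => hF.map_isPullback _ _ _ _ (ha i).1 (Ha i)) fun i => ?_
  rw [← F.map_comp, ← F.map_comp]
  exact hF.map_isPullback _ _ _ _ (ha i).2 ((Ha i).flip.paste_horiz H.flip).flip

theorem isContinuous_etale : IsContinuous (epiPretopology (etale τ)) (epiPretopology P) F where
  map_covering X S hS :=
    ⟨by rintro _ _ ⟨hf⟩; exact h.map_etale hE hF (hS.1 _ hf),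
      h.isEpiSink_map_of_etale hF hS.1 hS.2⟩
  map_clopen X Y f hf := hE.clopens_epiPretopology_iff.2
    (h.map_etale hE hF (h.isClopos_etale.clopens_epiPretopology_iff.1 hf))
  map_isPullback W X Y Z p q f g hf :=
    h.map_isPullback_of_etale hE hF (h.isClopos_etale.clopens_epiPretopology_iff.1 hf)

end

end IsGluingPresite

theorem presieve_map_id {X : C} (S : Presieve X) : S.map (𝟭 C) = S :=
  le_antisymm (by rintro _ _ ⟨hf⟩; exact hf) fun _ _ hf => .of (F := 𝟭 C) hf

theorem presiteEquivalent_refl (τ : Precoverage C) : PresiteEquivalent τ τ := by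
  have : IsContinuous τ τ (𝟭 C) :=
    ⟨fun X S hS => by rwa [presieve_map_id], fun _ _ _ hf => hf, fun _ _ _ _ _ _ _ _ _ H => H⟩
  exact ⟨CategoryTheory.Equivalence.refl, this, this⟩

namespace IsGluingPresite

variable (h : IsGluingPresite.{u} τ)

include h

theorem mem_epiPretopology_etale {X : C} {S : Presieve X} (hS : S ∈ τ X) :
    S ∈ epiPretopology (etale τ) X :=
  have := h.subcanonical
  ⟨fun _ _ hf => h.etale_of_clopens (sinkIn_clopens_of_mem hS _ hf),
    isEpiSink_of_generate_mem (Precoverage.generate_mem_toGrothendieck hS)⟩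

theorem isContinuous_id_etale : IsContinuous τ (epiPretopology (etale τ)) (𝟭 C) where
  map_covering X S hS := by
    rw [presieve_map_id]
    exact h.mem_epiPretopology_etale hS
  map_clopen X Y f hf := h.isClopos_etale.clopens_epiPretopology_iff.2 (h.etale_of_clopens hf)
  map_isPullback _ _ _ _ _ _ _ _ _ H := H

theorem isUniversalArrow_id : IsUniversalArrow.{u} τ (etale τ) (𝟭 C) := by
  refine ⟨h.isContinuous_id_etale, fun E _ P hE => ?_⟩
  let K : ContinuousFunctors τ (epiPretopology P) ⥤
      ContinuousFunctors (epiPretopology (etale τ)) (epiPretopology P) :=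
    ObjectProperty.lift _ (ObjectProperty.ι _) fun F => h.isContinuous_etale hE F.property
  have hK : K ⋙ precomp (epiPretopology P) (𝟭 C) h.isContinuous_id_etale = 𝟭 _ := rfl
  have hK' : precomp (epiPretopology P) (𝟭 C) h.isContinuous_id_etale ⋙ K = 𝟭 _ := rfl
  exact ⟨(CategoryTheory.Equivalence.mk _ K (eqToIso hK'.symm) (eqToIso hK)).isEquivalence_functor,
    K, hK⟩

theorem isUPresite : IsUPresite.{u} τ where
  toIsPresite := h.toIsPresite
  isUCategory := h.isUCategory
  localGenerators X := by
    obtain ⟨B⟩ := h.nonempty_clopenBasis h.ng1 X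
    refine ⟨Set.range fun s => (B.obj s).left, inferInstance, fun U a ha => ?_⟩
    obtain ⟨s, ⟨e⟩⟩ := B.exists_iso (Over.mk a) ha
    refine ⟨_, h.hasIsos.mem_coverings_of_isIso ((Over.forget X).mapIso e).inv, ?_⟩
    rintro _ _ ⟨⟩
    exact ⟨s, rfl⟩

theorem clopens_monoPart_etale_iff {X Y : C} {f : X ⟶ Y} :
    clopens (monoPart (epiPretopology (etale τ))) f ↔ clopens τ f :=
  h.isClopos_etale.clopens_monoPart_iff.trans
    ⟨fun ⟨hf, _⟩ => h.clopens_of_etale_of_mono hf,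
      fun hf => ⟨h.etale_of_clopens hf, h.mono_of_clopens hf⟩⟩

theorem monoPart_epiPretopology_etale : monoPart (epiPretopology (etale τ)) = τ := by
  refine Precoverage.ext (funext fun X => Set.ext fun S => ⟨fun hS => ?_, fun hS => ?_⟩)
  · exact h.ng3 X S (fun _ _ hf => h.clopens_monoPart_etale_iff.1 ⟨S, hS, hf⟩) hS.1.2
  · exact ⟨h.mem_epiPretopology_etale hS, h.mono S hS⟩

theorem isNearlyUGlutos : IsNearlyUGlutos.{u} τ :=
  ⟨h.isUPresite, C, inferInstance, τ, C, inferInstance, etale τ, 𝟭 C, h.isUPresite,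
    h.isUGlutos_etale, h.isUniversalArrow_id, h.monoPart_epiPretopology_etale.symm ▸
      presiteEquivalent_refl τ⟩

end IsGluingPresite

end Extension

/-! ### Gluing in a glutos -/

section GluingInSites

variable {C : Type v} [Category.{w} C] {J : GrothendieckTopology C} [J.Subcanonical] {I : Type*}
  {U : I → C}

namespace GluingRelation

variable {ρ : GluingRelation U}

namespace IsRepresentedBy

theorem rel_of_disjoint {i j : I} {V T : C} {p : V ⟶ U i} {q : V ⟶ U j} {a : T ⟶ U i} {b : T ⟶ U j}
    (h : ρ.IsRepresentedBy p q) (r : (disjoint J U).rel a b) : ρ.rel a b := by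
  obtain ⟨rfl, rfl⟩ | hT := r
  · simpa using ρ.refl a
  · have r := ρ.precomp ((nonempty_isInitial_of_bot_mem hT).some.to V) h.rel
    rwa [hom_ext_of_bot_mem hT (_ ≫ p) a, hom_ext_of_bot_mem hT (_ ≫ q) b] at r

theorem rel_of_mem {i j : I} {V T : C} {p : V ⟶ U i} {q : V ⟶ U j} {a : T ⟶ U i} {b : T ⟶ U j}
    (h : ρ.IsRepresentedBy p q) (hpq : JointlyMono₂ p q) {A : Sieve T} (hA : A ∈ J T)
    (H : ∀ ⦃W : C⦄ (k : W ⟶ T), A k → ρ.rel (k ≫ a) (k ≫ b)) : ρ.rel a b := by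
  obtain ⟨l, rfl, rfl⟩ := exists_jointLift_of_mem hpq hA fun W k hk => h.exists_lift (H k hk)
  exact ρ.precomp l h.rel

theorem eq_of_rel {i : I} {V T : C} {p q : V ⟶ U i} [Mono p] (h : ρ.IsRepresentedBy p q)
    {a b : T ⟶ U i} (r : ρ.rel a b) : a = b := by
  obtain ⟨t, rfl, rfl⟩ := h.exists_lift r
  rw [h.eq_of_mono]

end IsRepresentedBy

section Spans

variable {R X : C} {π : ∀ i, U i ⟶ X} {V : I × I → C} {p : ∀ x, V x ⟶ U x.1} {q : ∀ x, V x ⟶ U x.2}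
  {ι : ∀ x, V x ⟶ R} {u v : R ⟶ X}

theorem jointlyMono₂_of_disjoint [∀ x, Mono (p x)] (hπ : (disjoint J U).IsGluing π)
    (hι : Sieve.ofArrows V ι ∈ J R) (hu : ∀ x, ι x ≫ u = p x ≫ π x.1)
    (hv : ∀ x, ι x ≫ v = q x ≫ π x.2) : JointlyMono₂ u v := by
  refine ⟨fun T s t e e' => hom_ext_of_mem (J.intersection_covering (J.pullback_stable s hι)
    (J.pullback_stable t hι)) ?_⟩
  rintro W k ⟨⟨_, a, _, ⟨i, j⟩, ha⟩, ⟨_, b, _, ⟨i', j'⟩, hb⟩⟩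
  have r : (disjoint J U).rel (a ≫ p (i, j)) (b ≫ p (i', j')) := hπ.comp_eq_comp_iff.1 <| by
    rw [Category.assoc, Category.assoc, ← hu, ← hu, reassoc_of% ha, reassoc_of% hb, e]
  have r' : (disjoint J U).rel (a ≫ q (i, j)) (b ≫ q (i', j')) := hπ.comp_eq_comp_iff.1 <| by
    rw [Category.assoc, Category.assoc, ← hv, ← hv, reassoc_of% ha, reassoc_of% hb, e']
  obtain ⟨ei, hp⟩ | hW := r
  · obtain ⟨ej, -⟩ | hW := r'
    · obtain rfl : i = i' := ei
      obtain rfl : j = j' := ej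
      have ab : a = b := (cancel_mono (p (i, j))).1 (by simpa using hp)
      rw [← ha, ← hb, ab]
    · exact hom_ext_of_bot_mem hW _ _
  · exact hom_ext_of_bot_mem hW _ _

theorem exists_lift_iff_rel [∀ x, Mono (p x)] (hρ : ∀ x, ρ.IsRepresentedBy (p x) (q x))
    (hπ : (disjoint J U).IsGluing π) (hι : Sieve.ofArrows V ι ∈ J R)
    (hu : ∀ x, ι x ≫ u = p x ≫ π x.1) (hv : ∀ x, ι x ≫ v = q x ≫ π x.2) {i j : I} {T : C}
    {a : T ⟶ U i} {b : T ⟶ U j} :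
    (∃ l : T ⟶ R, l ≫ u = a ≫ π i ∧ l ≫ v = b ≫ π j) ↔ ρ.rel a b := by
  constructor
  · rintro ⟨l, hl, hl'⟩
    refine (hρ (i, j)).rel_of_mem (jointlyMono₂_of_mono _ _) (J.pullback_stable l hι) ?_
    rintro W k ⟨_, c, _, ⟨x⟩, hc⟩
    have r : (disjoint J U).rel (c ≫ p x) (k ≫ a) := hπ.comp_eq_comp_iff.1 <| by
      rw [Category.assoc, Category.assoc, ← hu, reassoc_of% hc, hl]
    have r' : (disjoint J U).rel (c ≫ q x) (k ≫ b) := hπ.comp_eq_comp_iff.1 <| by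
      rw [Category.assoc, Category.assoc, ← hv, reassoc_of% hc, hl']
    exact ρ.trans (ρ.symm ((hρ (x.1, i)).rel_of_disjoint r))
      (ρ.trans (ρ.precomp c (hρ x).rel) ((hρ (x.2, j)).rel_of_disjoint r'))
  · intro r
    obtain ⟨t, rfl, rfl⟩ := (hρ (i, j)).exists_lift r
    exact ⟨t ≫ ι (i, j), by simp only [Category.assoc, hu], by simp only [Category.assoc, hv]⟩

theorem isEquivalenceRelation (hπ : Sieve.ofArrows U π ∈ J X) (huv : JointlyMono₂ u v)
    [HasPullback v u] (H : ∀ {i j : I} {T : C} {a : T ⟶ U i} {b : T ⟶ U j},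
      (∃ l : T ⟶ R, l ≫ u = a ≫ π i ∧ l ≫ v = b ≫ π j) ↔ ρ.rel a b) :
    IsEquivalenceRelation u v := by
  obtain ⟨r, hr, hr'⟩ : ∃ r : X ⟶ R, r ≫ u = 𝟙 X ∧ r ≫ v = 𝟙 X := by
    refine exists_jointLift_of_mem huv hπ ?_
    rintro W _ ⟨_, a, _, ⟨i⟩, rfl⟩
    simpa only [Category.comp_id] using H.2 (ρ.refl a)
  obtain ⟨s, hs, hs'⟩ : ∃ s : R ⟶ R, s ≫ u = v ∧ s ≫ v = u := by
    simpa only [Category.id_comp] using exists_jointLift_of_mem huv (s := v) (t := u)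
      (J.intersection_covering (J.pullback_stable v hπ) (J.pullback_stable u hπ)) (by
      rintro W k ⟨⟨_, a, _, ⟨i⟩, ha⟩, ⟨_, b, _, ⟨j⟩, hb⟩⟩
      rw [← ha, ← hb]
      exact H.2 (ρ.symm (H.1 ⟨k, hb.symm, ha.symm⟩)))
  obtain ⟨t, ht, ht'⟩ := exists_jointLift_of_mem huv (s := pullback.fst v u ≫ u)
    (t := pullback.snd v u ≫ v) (J.intersection_covering (J.intersection_covering
      (J.pullback_stable (pullback.fst v u ≫ u) hπ) (J.pullback_stable (pullback.fst v u ≫ v) hπ))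
      (J.pullback_stable (pullback.snd v u ≫ v) hπ)) (by
    rintro W k ⟨⟨⟨_, a, _, ⟨i⟩, ha⟩, ⟨_, b, _, ⟨j⟩, hb⟩⟩, ⟨_, c, _, ⟨l⟩, hc⟩⟩
    rw [← ha, ← hc]
    refine H.2 (ρ.trans (b := b) (H.1 ⟨k ≫ pullback.fst v u, ?_, ?_⟩)
      (H.1 ⟨k ≫ pullback.snd v u, ?_, ?_⟩))
    · rw [ha, Category.assoc]
    · rw [hb, Category.assoc]
    · rw [hb, Category.assoc, pullback.condition]
    · rw [hc, Category.assoc])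
  exact EquivalenceRelation.isEquivalenceRelation
    { toJointlyMono₂ := huv
      r := r
      reflexivity₁ := hr
      reflexivity₂ := hr'
      s := s
      symmetry₁ := hs
      symmetry₂ := hs'
      c := _
      isLimit := pullback.isLimit v u
      t := t
      transitivity₁ := ht
      transitivity₂ := ht' }

end Spans

end GluingRelation

end GluingInSites

section GlutosGluing

variable {E : Type v} [Category.{w} E] {P : MorphismProperty E}

theorem IsClopos.locallyOCoequalizable (h : IsClopos P) {R X : E} {u v : R ⟶ X} (hv : P v)
    {I : Type*} {U : I → E} {a : ∀ i, U i ⟶ X} (ha : ∀ i, P (a i))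
    (hepi : IsEpiSink (Presieve.ofArrows U a))
    (H : ∀ {i : I} {T : E} {r : T ⟶ R} {s t : T ⟶ U i}, r ≫ u = s ≫ a i → r ≫ v = t ≫ a i →
      s = t) : LocallyOCoequalizable P u v := by
  refine ⟨_, fun _ _ ⟨i⟩ => ha i, hepi, ?_⟩
  rintro _ _ ⟨i⟩
  have := h.hasPullback (ha i) u
  have := h.hasPullback hv (a i)
  have H₀ := IsPullback.of_hasPullback (a i) u
  have H₁ := IsPullback.of_hasPullback v (a i)
  have := h.hasPullback (h.snd_of_isPullback H₀ (ha i)) (pullback.fst v (a i))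
  have H₂ := IsPullback.of_hasPullback (pullback.snd (a i) u) (pullback.fst v (a i))
  refine ⟨_, _, _, ⟨_, _, _, _, _, _, _, _, H₀, H₁, H₂, rfl, rfl⟩, _, 𝟙 _,
    h.of_isIso _ inferInstance, congrArg (· ≫ 𝟙 _) (H (r := pullback.fst _ _ ≫ pullback.snd _ _)
      ?_ ?_)⟩
  · simp only [Category.assoc, H₀.w]
  · rw [H₂.w, Category.assoc, Category.assoc, H₁.w]

namespace IsUGlutos

variable (h : IsUGlutos.{u} E P)

include h

theorem exists_coproduct {I : Type u} (U : I → E) : ∃ (Q : E) (π : ∀ i, U i ⟶ Q), (∀ i, P (π i)) ∧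
    (GluingRelation.disjoint h.topology U).IsGluing π ∧
    ∀ {X : E} (f : ∀ i, U i ⟶ X), (∀ i, P (f i)) → ∃ d : Q ⟶ X, P d ∧ ∀ i, π i ≫ d = f i := by
  obtain ⟨c, hc, hinj, hd⟩ := h.coproducts I U
  refine ⟨c.pt, c.inj, fun i => (hinj i).1, ⟨isEpiSink_ofArrows_iff.2 fun Z g g' e =>
    hc.isColimit.hom_ext fun i => e i.as, fun {i j T a b} => ⟨fun e => ?_, fun r => ?_⟩⟩,
    fun f hf => ⟨_, h.coproductDesc I U _ f hf c hc.isColimit, fun i => hc.isColimit.fac _ ⟨i⟩⟩⟩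
  · obtain rfl | hij := eq_or_ne i j
    · have := (hinj i).2
      exact .inl ⟨rfl, by simpa using (cancel_mono _).1 e⟩
    · have := h.hasPullback (hinj i).1 (c.inj j)
      obtain ⟨hZ⟩ := hd i j hij _ _ _ (IsPullback.of_hasPullback (c.inj i) (c.inj j))
      exact .inr (bot_mem_of_hom (pullback.lift a b e) (h.bot_mem_topology hZ))
  · have := h.subcanonical_topology
    obtain ⟨rfl, rfl⟩ | hT := r
    · simp
    · exact hom_ext_of_bot_mem hT _ _

theorem exists_isGluing {I : Type u} {U : I → E} (ρ : GluingRelation U)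
    (rep : ∀ i j, ∃ (V : E) (p : V ⟶ U i) (q : V ⟶ U j), P p ∧ P q ∧ Mono p ∧
      ρ.IsRepresentedBy p q) :
    ∃ (Q : E) (π : ∀ i, U i ⟶ Q), (∀ i, P (π i)) ∧ (∀ i, Mono (π i)) ∧ ρ.IsGluing π := by
  have := h.subcanonical_topology
  choose V p q hp hq _ hρ using fun x : I × I => rep x.1 x.2
  obtain ⟨X, π, hπ, hπd, -⟩ := h.exists_coproduct U
  obtain ⟨R, ι, hι, hιd, hdesc⟩ := h.exists_coproduct V
  obtain ⟨u, hu, eu⟩ := hdesc (fun x => p x ≫ π x.1) fun x => h.comp (hp x) (hπ _)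
  obtain ⟨v, hv, ev⟩ := hdesc (fun x => q x ≫ π x.2) fun x => h.comp (hq x) (hπ _)
  have hιc := h.ofArrows_mem_topology hι hιd.isEpiSink
  have := h.hasPullback hv u
  have huv : JointlyMono₂ u v := GluingRelation.jointlyMono₂_of_disjoint hπd hιc eu ev
  have key {i j : I} {T : E} {a : T ⟶ U i} {b : T ⟶ U j} :=
    GluingRelation.exists_lift_iff_rel hρ hπd hιc eu ev (a := a) (b := b)
  have huv' : IsEquivalenceRelation u v :=
    GluingRelation.isEquivalenceRelation (h.ofArrows_mem_topology hπ hπd.isEpiSink) huv key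
  obtain ⟨Q, k, hk, hkP, hker, hQ⟩ := h.quotients u v huv' hu hv <|
    h.locallyOCoequalizable hv hπ hπd.isEpiSink fun {i T r s t} e e' =>
      (hρ (i, i)).eq_of_rel (key.1 ⟨r, e, e'⟩)
  have hrel {i j : I} {T : E} {a : T ⟶ U i} {b : T ⟶ U j} :
      a ≫ π i ≫ k = b ≫ π j ≫ k ↔ ρ.rel a b := by
    rw [← key, ← Category.assoc, ← Category.assoc]
    refine ⟨fun e => hker.exists_lift _ _ e, fun ⟨l, hl, hl'⟩ => ?_⟩
    rw [← hl, ← hl', Category.assoc, Category.assoc, hk]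
  have : Epi k := epi_of_isColimit_cofork hQ.isColimit
  refine ⟨Q, fun i => π i ≫ k, fun i => h.comp (hπ i) hkP, fun i => ⟨fun {T} a b e =>
    (hρ (i, i)).eq_of_rel (hrel.1 e)⟩, ⟨isEpiSink_ofArrows_iff.2 fun Z g g' e => ?_, hrel⟩⟩
  rw [← cancel_epi k]
  exact isEpiSink_ofArrows_iff.1 hπd.isEpiSink _ _ fun i => by
    simpa only [Category.assoc] using e i

end IsUGlutos

end GlutosGluing

/-! ### From nearly `𝒰`-glutoses to the gluing conditions -/

section Generators

variable {C : Type v} [Category.{w} C] {τ : Precoverage C}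

theorem subobject_le_of_factors [τ.toGrothendieck.Subcanonical] {X : C} {A B : Subobject X}
    {S : Presieve (A : C)} (hS : S ∈ τ A)
    (h : ∀ ⦃V : C⦄ (s : V ⟶ (A : C)), S s → B.Factors (s ≫ A.arrow)) : A ≤ B := by
  obtain ⟨l, hl⟩ := exists_lift_of_mem B.arrow A.arrow
    (Precoverage.generate_mem_toGrothendieck hS) (by
      rintro W _ ⟨V, b, s, hs, rfl⟩
      exact ⟨b ≫ B.factorThru _ (h s hs), by simp⟩)
  exact Subobject.le_of_comm l hl

theorem ng1_of_isUPresite (hsub : τ.toGrothendieck.Subcanonical)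
    (hU : IsUPresite.{u} τ) : NG1.{u} τ := by
  intro X
  have := hU.isUCategory.locallySmall
  obtain ⟨G, hG, hcov⟩ := hU.localGenerators X
  let factoring (A : {A : Subobject X // clopens τ A.arrow}) : Set (Σ V : G, (V.1 ⟶ X)) :=
    {k | A.1.Factors k.2}
  have le_of_factoring_eq {A B : {A : Subobject X // clopens τ A.arrow}}
      (e : factoring A = factoring B) : A.1 ≤ B.1 := by
    obtain ⟨S, hS, hSG⟩ := hcov _ A.2
    refine subobject_le_of_factors hS fun V s hs => (Set.ext_iff.1 e ⟨⟨V, hSG s hs⟩, _⟩).1 ?_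
    exact (Subobject.factors_iff _ _).2 ⟨s, rfl⟩
  exact small_of_injective (f := factoring) fun A B e =>
    Subtype.ext (le_antisymm (le_of_factoring_eq e) (le_of_factoring_eq e.symm))

end Generators

section Equivalences

variable {C : Type v} [Category.{w} C] {D : Type v'} [Category.{w'} D]

theorem IsEpiSink.map_equivalence {X : C} {S : Presieve X} (hS : IsEpiSink S) (e : C ≌ D) :
    IsEpiSink (S.map e.functor) := by
  intro Z g g' H
  apply e.inverse.map_injective
  rw [← cancel_epi (e.unit.app X)]
  refine hS _ _ fun Y f hf => ?_
  simpa using congrArg (e.unit.app Y ≫ ·) (congrArg e.inverse.map (H _ (.of hf)))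

namespace GluingRelation

variable {I : Type*} {U : I → C} {ρ : GluingRelation U}

/-- The pullback of a gluing relation along a functor `G` and arrows `κ i : G.obj (W i) ⟶ U i`. -/
def comap (ρ : GluingRelation U) (G : D ⥤ C) {W : I → D} (κ : ∀ i, G.obj (W i) ⟶ U i) :
    GluingRelation W where
  rel a b := ρ.rel (G.map a ≫ κ _) (G.map b ≫ κ _)
  refl _ := ρ.refl _
  symm := ρ.symm
  trans := ρ.trans
  precomp t _ _ r := by simpa only [Functor.map_comp, Category.assoc] using ρ.precomp (G.map t) r

theorem IsRepresentedBy.comap_equivalence {i j : I} {V : C} {p : V ⟶ U i} {q : V ⟶ U j}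
    (h : ρ.IsRepresentedBy p q) (e : C ≌ D) :
    (ρ.comap e.inverse fun i => e.unitInv.app (U i)).IsRepresentedBy
      (e.functor.map p) (e.functor.map q) where
  rel := by simpa [comap] using ρ.precomp (e.unitInv.app V) h.rel
  exists_lift {T a b} r := by
    obtain ⟨t, tp, tq⟩ := h.exists_lift r
    refine ⟨e.counitInv.app T ≫ e.functor.map t, ?_, ?_⟩
    · rw [Category.assoc, ← Functor.map_comp, tp]
      simp
    · rw [Category.assoc, ← Functor.map_comp, tq]
      simp

theorem IsGluing.of_comap_equivalence {e : C ≌ D} {Q : D} {π : ∀ i, e.functor.obj (U i) ⟶ Q}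
    (h : (ρ.comap e.inverse fun i => e.unitInv.app (U i)).IsGluing π) :
    ρ.IsGluing fun i => e.unit.app (U i) ≫ e.inverse.map (π i) where
  isEpiSink := isEpiSink_ofArrows_iff.2 fun Z g g' H => by
    apply e.functor.map_injective
    rw [← cancel_epi (e.counitInv.app Q)]
    exact isEpiSink_ofArrows_iff.1 h.isEpiSink _ _ fun i => by
      simpa using congrArg e.functor.map (H i)
  comp_eq_comp_iff {i j T a b} := by
    have comp_eq {k : I} (c : T ⟶ U k) : c ≫ e.unit.app (U k) ≫ e.inverse.map (π k) =
        e.unit.app T ≫ e.inverse.map (e.functor.map c ≫ π k) := by simp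
    rw [comp_eq, comp_eq, cancel_epi, e.inverse.map_injective.eq_iff, h.comp_eq_comp_iff]
    refine ⟨fun r => ?_, fun r => ?_⟩
    · simpa using ρ.precomp (e.unit.app T) r
    · simpa [comap] using ρ.precomp (e.unitInv.app T) r

end GluingRelation

end Equivalences

section Unions

variable {C : Type v} [Category.{w} C] {τ : Precoverage C}

theorem GluingRelation.IsGluing.exists_mono_desc {J : GrothendieckTopology C} [J.Subcanonical]
    {X Q : C} {I : Type*} {U : I → C} {a : ∀ i, U i ⟶ X} {π : ∀ i, U i ⟶ Q}
    (h : (ker a).IsGluing π) (hπ : Sieve.ofArrows U π ∈ J Q) :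
    ∃ m : Q ⟶ X, Mono m ∧ ∀ i, π i ≫ m = a i := by
  obtain ⟨m, hm⟩ := exists_desc_of_ofArrows_mem hπ a fun i j W s t => h.comp_eq_comp_iff.1
  refine ⟨m, ⟨fun {T} s t e => hom_ext_of_mem (J.intersection_covering
    (J.pullback_stable s hπ) (J.pullback_stable t hπ)) ?_⟩, hm⟩
  rintro W k ⟨⟨_, x, _, ⟨i⟩, ex⟩, ⟨_, y, _, ⟨j⟩, ey⟩⟩
  rw [← ex, ← ey, h.comp_eq_comp_iff]
  change x ≫ a i = y ≫ a j
  rw [← hm, ← hm, reassoc_of% ex, reassoc_of% ey, e]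

theorem IsMPresite.ng2_of_small (hM : IsMPresite τ) (h1 : NG1.{u} τ)
    (H : ∀ ⦃X : C⦄ ⦃I : Type u⦄ (U : I → C) (a : ∀ i, U i ⟶ X), (∀ i, clopens τ (a i)) →
      ∃ (Q : C) (m : Q ⟶ X) (π : ∀ i, U i ⟶ Q), Sieve.ofArrows U π ∈ τ.toGrothendieck Q ∧
        clopens τ m ∧ ∀ i, π i ≫ m = a i) : NG2 τ := by
  intro X K V b hb
  have hS : SinkIn (clopens τ) (Presieve.ofArrows V b) := fun _ _ ⟨i⟩ => hb i
  obtain ⟨I, U, a, ha, hgen⟩ := hM.exists_small_ofArrows h1 hS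
  obtain ⟨Q, m, π, hπ, hm, e⟩ := H U a fun i => hS _ (ha i)
  have := hM.mono_of_clopens hm
  have exists_lift (k : K) : ∃ l : V k ⟶ Q, l ≫ m = b k := by
    have hk : Sieve.ofArrows U a (b k) := hgen ▸ Sieve.ofArrows_mk V b k
    obtain ⟨_, c, _, ⟨i⟩, hc⟩ := hk
    exact ⟨c ≫ π i, by rw [Category.assoc, e, hc]⟩
  choose l hl using exists_lift
  have hlcl (k : K) : clopens τ (l k) := hM.isClopos.of_comp_mono (f := m) (by rw [hl]; exact hb k)
  refine ⟨Q, m, l, (hM.ofArrows_mem_iff hlcl).2 (τ.toGrothendieck.superset_covering ?_ hπ), hm, hl⟩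
  rw [Sieve.generate_le_iff]
  rintro _ _ ⟨i⟩
  have hi : Sieve.ofArrows V b (a i) := Sieve.le_generate _ _ _ (ha i)
  obtain ⟨_, c, _, ⟨k⟩, hc⟩ := hi
  exact ⟨_, c, _, .mk k, by rw [← cancel_mono m, Category.assoc, hl, hc, e]⟩

end Unions

section Transport

variable {C : Type v} [Category.{w} C] {τ : Precoverage C} {D : Type v'} [Category.{w'} D]
  {O : MorphismProperty D} (hM : IsMPresite τ) (hD : IsUGlutos.{u} D O) (e : C ≌ D)
  (hF : IsContinuous τ (monoPart (epiPretopology O)) e.functor)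
  (hG : IsContinuous (monoPart (epiPretopology O)) τ e.inverse)

include hM hD hF hG

theorem clopens_iff_of_presiteEquivalence {X Y : C} {f : X ⟶ Y} :
    clopens τ f ↔ O (e.functor.map f) ∧ Mono (e.functor.map f) := by
  rw [← hD.toIsClopos.clopens_monoPart_iff]
  refine ⟨hF.map_clopen f, fun hf => ?_⟩
  have hf' : f = e.unit.app X ≫ e.inverse.map (e.functor.map f) ≫ e.unitInv.app Y := by simp
  rw [hf']
  exact hM.isClopos.comp (hM.clopens_of_isIso _)
    (hM.isClopos.comp (hG.map_clopen _ hf) (hM.clopens_of_isIso _))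

theorem ng3_of_presiteEquivalence : NG3 τ := by
  intro X S hS he
  have hFS : S.map e.functor ∈ monoPart (epiPretopology O) (e.functor.obj X) := by
    have hcl {Y : C} {f : Y ⟶ X} (hf : S f) :=
      (clopens_iff_of_presiteEquivalence hM hD e hF hG).1 (hS f hf)
    exact ⟨⟨fun _ _ ⟨hf⟩ => (hcl hf).1, he.map_equivalence e⟩, fun _ _ ⟨hf⟩ => (hcl hf).2⟩
  rw [hM.mem_iff_generate_mem hS]
  refine τ.toGrothendieck.superset_covering ?_ (τ.toGrothendieck.pullback_stable (e.unit.app X)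
    (Precoverage.generate_mem_toGrothendieck (hG.map_covering _ hFS)))
  rintro T k ⟨_, b, _, ⟨@⟨Y, f, hf⟩⟩, hk⟩
  refine ⟨Y, b ≫ e.unitInv.app Y, f, hf, ?_⟩
  have := e.unitInv.naturality f
  simp only [Functor.comp_map, Functor.id_map] at hk this
  rw [Category.assoc, ← this, reassoc_of% hk]
  simp

theorem exists_isGluing_of_presiteEquivalence {I : Type u} {U : I → C} (ρ : GluingRelation U)
    (rep : ∀ i j, ∃ (V : C) (p : V ⟶ U i) (q : V ⟶ U j), clopens τ p ∧ clopens τ q ∧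
      ρ.IsRepresentedBy p q) :
    ∃ (Q : C) (π : ∀ i, U i ⟶ Q), (∀ i, clopens τ (π i)) ∧
      Sieve.ofArrows U π ∈ τ.toGrothendieck Q ∧ ρ.IsGluing π := by
  have hcl {X Y : C} {f : X ⟶ Y} :=
    clopens_iff_of_presiteEquivalence hM hD e hF hG (f := f)
  obtain ⟨Q, π, hπ, hπm, hρ⟩ := hD.exists_isGluing
    (ρ.comap e.inverse fun i => e.unitInv.app (U i)) fun i j => by
      obtain ⟨V, p, q, hp, hq, h⟩ := rep i j
      exact ⟨_, _, _, (hcl.1 hp).1, (hcl.1 hq).1, (hcl.1 hp).2, h.comap_equivalence e⟩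
  have hπ' (i : I) : clopens τ (e.unit.app (U i) ≫ e.inverse.map (π i)) :=
    hM.isClopos.comp (hM.clopens_of_isIso _)
      (hG.map_clopen _ (hD.toIsClopos.clopens_monoPart_iff.2 ⟨hπ i, hπm i⟩))
  exact ⟨_, _, hπ', hM.generate_mem_of_isGluing (ng3_of_presiteEquivalence hM hD e hF hG) hπ'
    hρ.of_comap_equivalence, hρ.of_comap_equivalence⟩

theorem gluingCondition_of_presiteEquivalence (hsub : τ.toGrothendieck.Subcanonical) :
    GluingCondition.{u} (clopens τ) := by
  intro I d hd hO _
  obtain ⟨Q, π, hπ, hcov, hρ⟩ := exists_isGluing_of_presiteEquivalence hM hD e hF hG hd.relation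
    fun i j => ⟨_, _, _, (hO (i, j)).1, (hO (i, j)).2, hd.isRepresentedBy i j⟩
  have hpb (i j : I) : IsPullback (d.fst (i, j)) (d.snd (i, j)) (π i) (π j) :=
    (hd.isRepresentedBy i j).isPullback (hd.jointlyMono i j) hρ
  refine ⟨Multicofork.ofπ d Q π fun a => (hpb a.1 a.2).w, ?_, hpb, hπ⟩
  refine isUniversalColimit_of_cover (J := τ.toGrothendieck) _
    (fun i : I => (WalkingMultispan.right i : WalkingMultispan (MultispanShape.prod I))) hcov
    (fun i j T a b h => .inr ⟨.left (i, j), WalkingMultispan.Hom.fst (J := .prod I) (i, j),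
      WalkingMultispan.Hom.snd (J := .prod I) (i, j), (hpb i j).lift a b h,
      (hpb i j).lift_fst .., (hpb i j).lift_snd ..⟩) ?_
  rintro (⟨i, j⟩ | i)
  · exact ⟨i, ⟨WalkingMultispan.Hom.fst (J := .prod I) (i, j)⟩⟩
  · exact ⟨i, ⟨𝟙 _⟩⟩

theorem clopens_of_cover_of_presiteEquivalence (hsub : τ.toGrothendieck.Subcanonical) {I : Type u}
    {U : I → C} {Q X : C} {π : ∀ i, U i ⟶ Q} (hπ : ∀ i, clopens τ (π i))
    (hcov : Sieve.ofArrows U π ∈ τ.toGrothendieck Q) {m : Q ⟶ X} [Mono m]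
    (hm : ∀ i, clopens τ (π i ≫ m)) : clopens τ m := by
  have hcl {X Y : C} {f : X ⟶ Y} :=
    clopens_iff_of_presiteEquivalence hM hD e hF hG (f := f)
  have hepi : IsEpiSink ((Presieve.ofArrows U π).map e.functor) :=
    (isEpiSink_of_generate_mem hcov).map_equivalence e
  rw [Presieve.map_ofArrows] at hepi
  refine hcl.2 ⟨hD.of_epiFamily (fun i => (hcl.1 (hπ i)).1) hepi _ fun i => ?_, inferInstance⟩
  rw [← Functor.map_comp]
  exact (hcl.1 (hm i)).1

theorem ng2_of_presiteEquivalence (hsub : τ.toGrothendieck.Subcanonical) (h1 : NG1.{u} τ) :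
    NG2 τ := by
  refine hM.ng2_of_small h1 fun X I U a ha => ?_
  obtain ⟨Q, π, hπ, hcov, hker⟩ := exists_isGluing_of_presiteEquivalence hM hD e hF hG
    (GluingRelation.ker a) fun i j => by
      have := hM.hasPullback_of_clopens (ha i) (a j)
      have H := IsPullback.of_hasPullback (a i) (a j)
      exact ⟨_, _, _, hM.isClopos.fst_of_isPullback H (ha j),
        hM.isClopos.snd_of_isPullback H (ha i), GluingRelation.isRepresentedBy_ker H⟩
  obtain ⟨m, _, hm⟩ := hker.exists_mono_desc hcov
  exact ⟨Q, m, π, hcov, clopens_of_cover_of_presiteEquivalence hM hD e hF hG hsub hπ hcov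
    fun i => by rw [hm]; exact ha i, hm⟩

end Transport

theorem IsNearlyUGlutos.isGluingPresite {C : Type v} [Category.{w} C] {τ : Precoverage C}
    (hM : IsMPresite τ) (hsub : τ.toGrothendieck.Subcanonical) (hN : IsNearlyUGlutos.{u} τ) :
    IsGluingPresite.{u} τ := by
  obtain ⟨hU, B, _, ρ, D, _, O, Y, -, hD, -, e, hF, hG⟩ := hN
  have h1 := ng1_of_isUPresite hsub hU
  exact ⟨hM, hU.isUCategory, hsub, gluingCondition_of_presiteEquivalence hM hD e hF hG hsub, h1,
    ng2_of_presiteEquivalence hM hD e hF hG hsub h1, ng3_of_presiteEquivalence hM hD e hF hG⟩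

end Glutos

theorem mainTheorem9 {C : Type v} [Category.{w} C] (τ : Precoverage C)
    (hM : Glutos.IsMPresite τ) (hU : Glutos.IsUCategory.{u} C)
    (hsub : τ.toGrothendieck.Subcanonical) :
    (Glutos.IsNearlyUGlutos.{u} τ ↔
      Glutos.GluingCondition.{u} (Glutos.clopens τ) ∧
        Glutos.NG1.{u} τ ∧ Glutos.NG2 τ ∧ Glutos.NG3 τ) ∧
    (Glutos.NG2 τ → ∀ (X : C) (A : Set (Subobject X)), (∀ a ∈ A, Glutos.clopens τ a.arrow) →
      ∃ b : Subobject X, IsLUB A b ∧ Glutos.clopens τ b.arrow) ∧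
    (Glutos.NG3 τ → ∀ (X : C) (S : Presieve X), Glutos.SinkIn (Glutos.clopens τ) S →
      Glutos.IsEpiSink S → Glutos.IsUniversalEffectiveEpiSink S) := by
  refine ⟨⟨fun hN => ?_, fun ⟨hg, h1, h2, h3⟩ =>
    Glutos.IsGluingPresite.isNearlyUGlutos ⟨hM, hU, hsub, hg, h1, h2, h3⟩⟩,
    hM.exists_isLUB_of_ng2 hsub, fun h3 X S hS he =>
      Glutos.isUniversalEffectiveEpiSink_of_mem hsub (h3 X S hS he)⟩
  have h := hN.isGluingPresite hM hsub
  exact ⟨h.gluing, h.ng1, h.ng2, h.ng3⟩
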